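/- Let $\mathbb R^{2,n}$ be $\mathbb R^{n+2}$ with coordinates $(u,v,x_1,\dots,x_n)$ and scalar product $\langle\cdot|\cdot\rangle$ of quadratic form $q=-u^2-v^2+x_1^2+\dots+x_n^2$. Let $AdS^{1,n}=\{q=-1\}$, time-oriented by $\partial/\partial\theta$, where $u=r\cos\theta$, $v=r\sin\theta$. A timelike geodesic of $AdS^{1,n}$ is the intersection of $AdS^{1,n}$ with a negative definite 2-plane. Let $\mathcal U^{1,n}$ be the unit timelike bundle: the set of pairs $(x,y)$ with $x\in AdS^{1,n}$ and $y$ a future-oriented timelike tangent vector at $x$ with $q(y)=-1$. Its geodesic flow is $\Phi^t(x,y)=(\cos t\,x+\sin t\,y,\,-\sin t\,x+\cos t\,y)$, generated by $Z$. Let $\lambda_{(x,y)}(\dot x,\dot y)=-\langle\dot x|y\rangle$ be the Liouville form, let $\|\cdot\|$ be the pseudo-Riemannian metric $\|(\dot x,\dot y)\|=q(\dot x)+q(\dot y)$ on $\mathcal U^{1,n}$, let $\mathcal T_{2n}=\mathcal U^{1,n}/\Phi$ be the orbit space, and let $\pi:\mathcal U^{1,n}\to\mathcal T_{2n}$ be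 the projection. 1. Sending an orbit to the set of its base points is a bijection from $\mathcal T_{2n}$ onto the set of timelike geodesics of $AdS^{1,n}$. The set $\mathcal U^{1,n}$ is a smooth embedded submanifold of $\mathbb R^{2,n}\times\mathbb R^{2,n}$ whose tangent space at $(x,y)$ is $\{(\dot x,\dot y):\langle\dot x|x\rangle=\langle\dot y|y\rangle=\langle\dot x|y\rangle+\langle\dot y|x\rangle=0\}$. The flow $\Phi$ is smooth, and along each orbit the component $y$ is the velocity of the component $x$. The form $\lambda$ is a contact form; $\Phi$ is the flow of its Reeb field $Z(x,y)=(y,-x)$, that is, $\lambda(Z)=1$ and $i_Z\,d\lambda=0$; $\Phi$ preserves $\lambda$; and $\ker\lambda=Z^\perp$ for $\|\cdot\|$. The space $\mathcal T_{2n}$ is a smooth $2n$-manifold for which $\pi$ is a smooth submersion with $\ker d\pi=\mathbb R Z$. 2. There is a unique 2-form $\omega$ on $\mathcal T_{2n}$ with $\pi^*\omega=d\lambda$, and it is symplectic. The endomorphism $(\dot x,\dot y)\mapsto(\dot y,-\dot x)$ of $Z^\perp$ and the restriction of $\|\cdot\|$ to $Z^\perp$ induce an (integrable) complex structure $J$ and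 a Riemannian metric $g$ on $\mathcal T_{2n}$, with $\omega(\xi,\xi')=g(\xi,J\xi')$ and $g(J\xi,J\xi')=g(\xi,\xi')$. 3. Let $S$ be a smooth $n$-manifold and $x:S\to AdS^{1,n}$ a smooth spacelike immersion. For each $s\in S$ there is a unique timelike geodesic $\nu(s)=[x(s),y(s)]$ through $x(s)$ orthogonal to $x$ there, i.e. with $(x(s),y(s))\in\mathcal U^{1,n}$ and $\langle dx_s(\cdot)|y(s)\rangle=0$. The Gauss map $\nu:S\to\mathcal T_{2n}$ is a smooth immersion with $\nu^*\omega=0$, i.e. a Lagrangian immersion. If moreover $x$ is an embedding and every timelike geodesic meets $x(S)$ at most once, then $\nu$ is an embedding; if every timelike geodesic meets $x(S)$ exactly once, its image is also closed. 4. Conversely, let $S$ be a simply connected smooth $n$-manifold and $\varphi:S\to\mathcal T_{2n}$ a Lagrangian immersion. Then there is a smooth immersion $\hat\varphi:S\to\mathcal U^{1,n}$ with $\pi\circ\hat\varphi=\varphi$ which is orthogonal to $Z$ and spacelike for $\|\cdot\|$. For every $s_0\in S$ and every sufficiently small $t\ne0$ there is a neighbourhood of $s_0$ on which the base point component of $\Phi^t\circ\hat\varphi$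 is a spacelike immersion in $AdS^{1,n}$ with Gauss map $\varphi$. This also holds for $t=0$ if the base point component of $\hat\varphi$ is an immersion at $s_0$. -/

import Mathlib

open Set Filter Topology Complex
open scoped Manifold ContDiff

noncomputable section

/-! ### Differential forms on manifolds -/

section Forms

variable {E : Type*} [NormedAddCommGroup E] [NormedSpace ℝ E]
  {H : Type*} [TopologicalSpace H] (I : ModelWithCorners ℝ E H)
  (M : Type*) [TopologicalSpace M] [ChartedSpace H M]
  {E' : Type*} [NormedAddCommGroup E'] [NormedSpace ℝ E']
  {H' : Type*} [TopologicalSpace H'] (I' : ModelWithCorners ℝ E' H')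
  {M' : Type*} [TopologicalSpace M'] [ChartedSpace H' M']

/-- Real differential forms of degree `k` on a manifold (not necessarily smooth). -/
abbrev DForm (k : ℕ) : Type _ := ∀ x : M, TangentSpace I x [⋀^Fin k]→L[ℝ] ℝ

variable {M} {k : ℕ}

/-- The expression of a form in the preferred chart at `x` (for manifolds without boundary). -/
def DForm.inChart {I : ModelWithCorners ℝ E H} (η : DForm I M k) (x : M) :
    E → E [⋀^Fin k]→L[ℝ] ℝ := fun u =>
  (η ((extChartAt I x).symm u)).compContinuousLinearMap
    (mfderiv 𝓘(ℝ, E) I (extChartAt I x).symm u : E →L[ℝ] _)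

/-- A form is smooth if its chart expressions are smooth. -/
def DForm.IsSmooth {I : ModelWithCorners ℝ E H} (η : DForm I M k) : Prop :=
  ∀ x : M, ContDiffOn ℝ ∞ (η.inChart x) (extChartAt I x).target

/-- The exterior derivative of a form, computed in charts. -/
def DForm.d {I : ModelWithCorners ℝ E H} (η : DForm I M k) : DForm I M (k + 1) := fun x =>
  (extDeriv (η.inChart x) (extChartAt I x x)).compContinuousLinearMap
    (mfderiv I 𝓘(ℝ, E) (extChartAt I x) x : TangentSpace I x →L[ℝ] E)

/-- The pullback of a form by a map. -/
def DForm.pullback {I' : ModelWithCorners ℝ E' H'} (f : M → M') (η : DForm I' M' k) :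
    DForm I M k := fun x =>
  (η (f x)).compContinuousLinearMap (mfderiv I I' f x)

/-- A symplectic form: a smooth closed nondegenerate 2-form. -/
structure IsSymplectic {I : ModelWithCorners ℝ E H} (Ω : DForm I M 2) : Prop where
  smooth : Ω.IsSmooth
  closed : Ω.d = 0
  nondegenerate : ∀ (x : M) (v : TangentSpace I x), (∀ w, Ω x ![v, w] = 0) → v = 0

/-- A contact form: a smooth nowhere vanishing 1-form `α` whose exterior derivative is
nondegenerate on the hyperplanes `ker α`. -/
structure IsContactForm {I : ModelWithCorners ℝ E H} (α : DForm I M 1) : Prop where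
  smooth : α.IsSmooth
  ne_zero : ∀ x : M, α x ≠ 0
  nondegenerate : ∀ (x : M) (v : TangentSpace I x), α x ![v] = 0 →
    (∀ w, α x ![w] = 0 → α.d x ![v, w] = 0) → v = 0

/-- `R` is the Reeb vector field of `α`: `α(R) = 1` and `dα(R, ·) = 0`. -/
def IsReebField {I : ModelWithCorners ℝ E H} (α : DForm I M 1) (R : ∀ x : M, TangentSpace I x) :
    Prop :=
  ∀ x : M, α x ![R x] = 1 ∧ ∀ w, α.d x ![R x, w] = 0

end Forms

/-! ### Anti-de Sitter space and its unit timelike bundle -/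

namespace AdSGauss

/-- The vector space `ℝ^{2,n}` with coordinates `(u, v, x₁, …, xₙ)`. -/
abbrev R2 (n : ℕ) : Type := ℝ × ℝ × EuclideanSpace ℝ (Fin n)

variable {n : ℕ}

/-- The scalar product of signature `(2,n)` on `ℝ^{2,n}`. -/
def ip (a b : R2 n) : ℝ := -(a.1 * b.1) - a.2.1 * b.2.1 + ∑ i, a.2.2 i * b.2.2 i

/-- `a ↦ ⟨a | b⟩` as a continuous linear form. -/
def ipL (b : R2 n) : R2 n →L[ℝ] ℝ :=
  LinearMap.toContinuousLinearMap
    { toFun := fun a => ip a b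
      map_add' := fun a a' => by
        simp only [ip, Prod.fst_add, Prod.snd_add, PiLp.add_apply, add_mul, Finset.sum_add_distrib]
        ring
      map_smul' := fun c a => by
        simp only [ip, Prod.smul_fst, Prod.smul_snd, PiLp.smul_apply, smul_eq_mul,
          RingHom.id_apply, mul_assoc, ← Finset.mul_sum]
        ring }

variable (n) in
/-- Anti-de Sitter space `{q = -1}` in `ℝ^{2,n}`. -/
def AdS : Set (R2 n) := {x | ip x x = -1}

/-- The vector field `∂/∂θ` in the coordinates `u = r cos θ`, `v = r sin θ`; it gives the time
orientation of anti-de Sitter space. -/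
def dtheta (x : R2 n) : R2 n := (-x.2.1, x.1, 0)

variable (n) in
/-- The set of pairs `(x, y)` where `x` is a point of anti-de Sitter space and `y` is a future
oriented timelike tangent vector at `x` of norm `-1`. -/
def unitSet : Set (R2 n × R2 n) :=
  {p | p.1 ∈ AdS n ∧ ip p.1 p.2 = 0 ∧ ip p.2 p.2 = -1 ∧ ip p.2 (dtheta p.1) < 0}

variable (n) in
/-- The unit timelike bundle of anti-de Sitter space. -/
abbrev UT : Type := unitSet n

/-- A timelike geodesic of anti-de Sitter space, as a subset: the intersection with a negative
definite 2-plane. -/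
def IsTimelikeGeodesic (γ : Set (R2 n)) : Prop :=
  ∃ P : Submodule ℝ (R2 n), Module.finrank ℝ P = 2 ∧ (∀ v ∈ P, v ≠ 0 → ip v v < 0) ∧
    γ = AdS n ∩ P

lemma ip_comm (a b : R2 n) : ip a b = ip b a := by
  simp only [ip, mul_comm]

lemma ip_comb (a b c d : ℝ) (x y : R2 n) :
    ip (a • x + b • y) (c • x + d • y) =
      a * c * ip x x + (a * d + b * c) * ip x y + b * d * ip y y := by
  simp only [ip, Prod.fst_add, Prod.snd_add, Prod.smul_fst, Prod.smul_snd, smul_eq_mul,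
    PiLp.add_apply, PiLp.smul_apply]
  have : ∑ i, (a * x.2.2 i + b * y.2.2 i) * (c * x.2.2 i + d * y.2.2 i) =
      a * c * ∑ i, x.2.2 i * x.2.2 i + (a * d + b * c) * ∑ i, x.2.2 i * y.2.2 i
        + b * d * ∑ i, y.2.2 i * y.2.2 i := by
    simp only [Finset.mul_sum, ← Finset.sum_add_distrib]
    exact Finset.sum_congr rfl fun i _ => by ring
  rw [this]; ring

/-- The rotation of a pair of vectors of angle given by `cos = a`, `sin = b`. -/
def rotPair (a b : ℝ) (p : R2 n × R2 n) : R2 n × R2 n :=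
  (a • p.1 + b • p.2, -b • p.1 + a • p.2)

lemma ip_dtheta (x y : R2 n) : ip y (dtheta x) = -(x.1 * y.2.1 - x.2.1 * y.1) := by
  simp [ip, dtheta]; ring

lemma rotPair_mem {a b : ℝ} (h : a ^ 2 + b ^ 2 = 1) {p : R2 n × R2 n} (hp : p ∈ unitSet n) :
    rotPair a b p ∈ unitSet n := by
  obtain ⟨h1, h2, h3, h4⟩ := hp
  simp only [AdS, mem_ofPred_eq] at h1
  refine ⟨?_, ?_, ?_, ?_⟩
  · simp only [AdS, mem_ofPred_eq, rotPair, ip_comb, h1, h2, h3]; linarith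
  · simp only [rotPair, ip_comb, h1, h2, h3]; ring
  · simp only [rotPair, ip_comb, h1, h2, h3]; linarith
  · rw [ip_dtheta] at h4 ⊢
    have : (rotPair a b p).1.1 * (rotPair a b p).2.2.1 - (rotPair a b p).1.2.1 * (rotPair a b p).2.1
        = (a ^ 2 + b ^ 2) * (p.1.1 * p.2.2.1 - p.1.2.1 * p.2.1) := by
      simp [rotPair]; ring
    rw [this, h, one_mul]; exact h4

/-- The geodesic flow
`Φ^t(x, y) = (cos t x + sin t y, - sin t x + cos t y)` on the unit timelike bundle. -/
def flow (t : ℝ) (p : UT n) : UT n :=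
  ⟨rotPair (Real.cos t) (Real.sin t) p.1, rotPair_mem (Real.cos_sq_add_sin_sq t) p.2⟩

lemma flow_zero (p : UT n) : flow 0 p = p := by
  apply Subtype.ext; simp [flow, rotPair]

lemma flow_flow (s t : ℝ) (p : UT n) : flow s (flow t p) = flow (s + t) p := by
  apply Subtype.ext
  simp only [flow, rotPair, Real.cos_add, Real.sin_add]
  ext <;> simp <;> ring

variable (n) in
/-- The orbit relation of the geodesic flow. -/
def orbitSetoid : Setoid (UT n) where
  r p q := ∃ t : ℝ, flow t p = q
  iseqv :=
    { refl := fun p => ⟨0, flow_zero p⟩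
      symm := by
        rintro p q ⟨t, rfl⟩
        exact ⟨-t, by rw [flow_flow, neg_add_cancel, flow_zero]⟩
      trans := by
        rintro p q r ⟨t, rfl⟩ ⟨s, rfl⟩
        exact ⟨s + t, (flow_flow s t p).symm⟩ }

variable (n) in
/-- The orbit space of the geodesic flow, with the quotient topology. -/
def TG : Type := Quotient (orbitSetoid n)

instance : TopologicalSpace (TG n) := inferInstanceAs (TopologicalSpace (Quotient (orbitSetoid n)))

/-- The projection of the unit timelike bundle onto the orbit space. -/
def proj (p : UT n) : TG n := Quotient.mk (orbitSetoid n) p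

/-- The set of points of anti-de Sitter space lying on an orbit of the geodesic flow. -/
def geodesicOf (τ : TG n) : Set (R2 n) := {x | ∃ p : UT n, proj p = τ ∧ p.1.1 = x}

/-! ### The smooth structure of the orbit space

Write `z = x - i y ∈ ℂ^{2,n}`. The flow acts by `z ↦ e^{it} z`, so that the functions
`z_j / (z_u + i z_v)` descend to the orbit space; they are global coordinates. -/

variable (n) in
/-- The model vector space `ℂ^n` of the orbit space. -/
abbrev EC : Type := EuclideanSpace ℂ (Fin n)

/-- The function `z_u + i z_v` where `z = x - i y`. -/
def zeta (p : R2 n × R2 n) : ℂ := ⟨p.1.1 + p.2.2.1, p.1.2.1 - p.2.1⟩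

/-- The function `z_u - i z_v` where `z = x - i y`. -/
def eta (p : R2 n × R2 n) : ℂ := ⟨p.1.1 - p.2.2.1, -p.1.2.1 - p.2.1⟩

/-- The function `z_j` where `z = x - i y`. -/
def zj (p : R2 n × R2 n) (j : Fin n) : ℂ := ⟨p.1.2.2 j, -p.2.2.2 j⟩

lemma pair_ext {p q : R2 n × R2 n} (h1 : zeta p = zeta q) (h2 : eta p = eta q)
    (h3 : ∀ j, zj p j = zj q j) : p = q := by
  simp only [zeta, eta, zj, Complex.mk.injEq] at h1 h2 h3
  obtain ⟨a, b⟩ := h1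
  obtain ⟨c, d⟩ := h2
  ext j
  · linarith
  · linarith
  · exact (h3 j).1
  · linarith
  · linarith
  · linarith [(h3 j).2]

lemma zeta_rot (a b : ℝ) (p : R2 n × R2 n) : zeta (rotPair a b p) = ⟨a, b⟩ * zeta p := by
  apply Complex.ext <;> simp [zeta, rotPair] <;> ring

lemma eta_rot (a b : ℝ) (p : R2 n × R2 n) : eta (rotPair a b p) = ⟨a, b⟩ * eta p := by
  apply Complex.ext <;> simp [eta, rotPair] <;> ring

lemma zj_rot (a b : ℝ) (p : R2 n × R2 n) (j : Fin n) :
    zj (rotPair a b p) j = ⟨a, b⟩ * zj p j := by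
  apply Complex.ext <;> simp [zj, rotPair]

lemma zeta_mul_eta {p : R2 n × R2 n} (hp : p ∈ unitSet n) :
    zeta p * eta p = ∑ j, zj p j ^ 2 := by
  obtain ⟨h1, h2, h3, -⟩ := hp
  simp only [AdS, mem_ofPred_eq, ip] at h1 h2 h3
  apply Complex.ext
  · simp only [zeta, eta, zj, Complex.mul_re, Complex.re_sum, pow_two]
    have : ∑ j, (p.1.2.2 j * p.1.2.2 j - -p.2.2.2 j * -p.2.2.2 j) =
        ∑ j, p.1.2.2 j * p.1.2.2 j - ∑ j, p.2.2.2 j * p.2.2.2 j := by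
      rw [← Finset.sum_sub_distrib]; exact Finset.sum_congr rfl fun i _ => by ring
    rw [this]; linarith
  · simp only [zeta, eta, zj, Complex.mul_im, Complex.im_sum, pow_two]
    have : ∑ j, (p.1.2.2 j * -p.2.2.2 j + -p.2.2.2 j * p.1.2.2 j) =
        -2 * ∑ j, p.1.2.2 j * p.2.2.2 j := by
      rw [Finset.mul_sum]; exact Finset.sum_congr rfl fun i _ => by ring
    rw [this]; linarith

lemma normSq_sum {p : R2 n × R2 n} (hp : p ∈ unitSet n) :
    normSq (zeta p) + normSq (eta p) = 4 + 2 * ∑ j, normSq (zj p j) := by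
  obtain ⟨h1, h2, h3, -⟩ := hp
  simp only [AdS, mem_ofPred_eq, ip] at h1 h2 h3
  simp only [zeta, eta, zj, Complex.normSq_mk]
  have : ∑ j, (p.1.2.2 j * p.1.2.2 j + -p.2.2.2 j * -p.2.2.2 j) =
      ∑ j, p.1.2.2 j * p.1.2.2 j + ∑ j, p.2.2.2 j * p.2.2.2 j := by
    rw [← Finset.sum_add_distrib]; exact Finset.sum_congr rfl fun i _ => by ring
  rw [this]; linarith

lemma normSq_sub (p : R2 n × R2 n) :
    normSq (zeta p) - normSq (eta p) = -4 * ip p.2 (dtheta p.1) := by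
  rw [ip_dtheta]; simp only [zeta, eta, Complex.normSq_mk]; ring

lemma zeta_ne_zero {p : R2 n × R2 n} (hp : p ∈ unitSet n) : zeta p ≠ 0 := by
  intro h
  have h1 := normSq_sub p
  have h2 := hp.2.2.2
  have h3 := normSq_nonneg (eta p)
  rw [h, map_zero] at h1
  linarith

/-- The coordinates `z_j / (z_u + i z_v)`, `z = x - i y`, on the unit timelike bundle. -/
def preCoord (p : UT n) : EC n := WithLp.toLp 2 fun j => zj p.1 j / zeta p.1

lemma preCoord_flow (t : ℝ) (p : UT n) : preCoord (flow t p) = preCoord p := by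
  ext j
  have h : (⟨Real.cos t, Real.sin t⟩ : ℂ) ≠ 0 := by
    intro h
    have h1 := congrArg Complex.re h
    have h2 := congrArg Complex.im h
    simp only [Complex.zero_re, Complex.zero_im] at h1 h2
    have h3 := Real.cos_sq_add_sin_sq t
    rw [h1, h2] at h3
    norm_num at h3
  simp only [preCoord, flow, zeta_rot, zj_rot]
  exact mul_div_mul_left _ _ h

/-- The global coordinates on the orbit space. -/
def coord : TG n → EC n :=
  Quotient.lift preCoord (by rintro p q ⟨t, rfl⟩; exact (preCoord_flow t p).symm)

lemma coord_proj (p : UT n) : coord (proj p) = preCoord p := rfl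

lemma continuous_zeta : Continuous (zeta : R2 n × R2 n → ℂ) := by
  have : (zeta : R2 n × R2 n → ℂ) =
      fun p => ((p.1.1 + p.2.2.1 : ℝ) : ℂ) + ((p.1.2.1 - p.2.1 : ℝ) : ℂ) * Complex.I := by
    funext p; apply Complex.ext <;> simp [zeta]
  rw [this]; fun_prop

lemma continuous_zj (j : Fin n) : Continuous (fun p : R2 n × R2 n => zj p j) := by
  have : (fun p : R2 n × R2 n => zj p j) =
      fun p => ((p.1.2.2 j : ℝ) : ℂ) + ((-p.2.2.2 j : ℝ) : ℂ) * Complex.I := by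
    funext p; apply Complex.ext <;> simp [zj]
  rw [this]; fun_prop

lemma continuous_proj : Continuous (proj : UT n → TG n) := continuous_quotient_mk'

lemma continuous_coord : Continuous (coord : TG n → EC n) := by
  apply Continuous.quotient_lift
  apply (PiLp.continuous_toLp 2 _).comp
  refine continuous_pi fun j => ?_
  exact ((continuous_zj j).comp continuous_subtype_val).div
    (continuous_zeta.comp continuous_subtype_val) fun p => zeta_ne_zero p.2

variable (n) in
/-- The Lie ball, image of the coordinates. -/
def lieBall : Set (EC n) :=
  {w | ‖∑ j, w j ^ 2‖ < 1 ∧ 0 < 1 + ‖∑ j, w j ^ 2‖ ^ 2 - 2 * ∑ j, ‖w j‖ ^ 2}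

lemma isOpen_lieBall : IsOpen (lieBall n) := by
  have h1 : IsOpen {w : EC n | ‖∑ j, w j ^ 2‖ < 1} := isOpen_lt (by fun_prop) continuous_const
  have h2 : IsOpen {w : EC n | 0 < 1 + ‖∑ j, w j ^ 2‖ ^ 2 - 2 * ∑ j, ‖w j‖ ^ 2} :=
    isOpen_lt continuous_const (by fun_prop)
  exact h1.inter h2

/-- The pair `(x, y)` with `z_u + i z_v = r`, `z_u - i z_v = r ∑ w_j²`, `z_j = r w_j`. -/
def secPair (r : ℝ) (w : EC n) : R2 n × R2 n :=
  ((r * (1 + (∑ j, w j ^ 2).re) / 2, -(r * (∑ j, w j ^ 2).im) / 2,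
      WithLp.toLp 2 fun j => r * (w j).re),
    (-(r * (∑ j, w j ^ 2).im) / 2, r * (1 - (∑ j, w j ^ 2).re) / 2,
      WithLp.toLp 2 fun j => -(r * (w j).im)))

/-- The normalization factor. -/
def secR (w : EC n) : ℝ := 2 / √(1 + ‖∑ j, w j ^ 2‖ ^ 2 - 2 * ∑ j, ‖w j‖ ^ 2)

lemma zeta_sec (r : ℝ) (w : EC n) : zeta (secPair r w) = r := by
  apply Complex.ext <;> simp [zeta, secPair] <;> ring

lemma eta_sec (r : ℝ) (w : EC n) : eta (secPair r w) = r * ∑ j, w j ^ 2 := by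
  apply Complex.ext <;> simp only [eta, secPair, Complex.re_ofReal_mul, Complex.im_ofReal_mul] <;>
    ring

lemma zj_sec (r : ℝ) (w : EC n) (j : Fin n) : zj (secPair r w) j = r * w j := by
  apply Complex.ext <;> simp [zj, secPair]

lemma secR_pos {w : EC n} (hw : w ∈ lieBall n) : 0 < secR w :=
  div_pos two_pos (Real.sqrt_pos.2 hw.2)

/-- The algebraic characterization of the unit timelike bundle in complex coordinates. -/
lemma mem_unitSet_of {p : R2 n × R2 n} (h1 : zeta p * eta p = ∑ j, zj p j ^ 2)
    (h2 : normSq (zeta p) + normSq (eta p) = 4 + 2 * ∑ j, normSq (zj p j))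
    (h3 : normSq (eta p) < normSq (zeta p)) : p ∈ unitSet n := by
  have e1 := congrArg Complex.re h1
  have e2 := congrArg Complex.im h1
  simp only [zeta, eta, zj, Complex.mul_re, Complex.re_sum, pow_two] at e1
  simp only [zeta, eta, zj, Complex.mul_im, Complex.im_sum, pow_two] at e2
  simp only [zeta, eta, zj, Complex.normSq_mk] at h2
  have s1 : ∑ j, (p.1.2.2 j * p.1.2.2 j - -p.2.2.2 j * -p.2.2.2 j) =
      ∑ j, p.1.2.2 j * p.1.2.2 j - ∑ j, p.2.2.2 j * p.2.2.2 j := by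
    rw [← Finset.sum_sub_distrib]; exact Finset.sum_congr rfl fun i _ => by ring
  have s2 : ∑ j, (p.1.2.2 j * -p.2.2.2 j + -p.2.2.2 j * p.1.2.2 j) =
      -2 * ∑ j, p.1.2.2 j * p.2.2.2 j := by
    rw [Finset.mul_sum]; exact Finset.sum_congr rfl fun i _ => by ring
  have s3 : ∑ j, (p.1.2.2 j * p.1.2.2 j + -p.2.2.2 j * -p.2.2.2 j) =
      ∑ j, p.1.2.2 j * p.1.2.2 j + ∑ j, p.2.2.2 j * p.2.2.2 j := by
    rw [← Finset.sum_add_distrib]; exact Finset.sum_congr rfl fun i _ => by ring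
  rw [s1] at e1
  rw [s2] at e2
  rw [s3] at h2
  refine ⟨?_, ?_, ?_, ?_⟩
  · simp only [AdS, mem_ofPred_eq, ip]; linarith
  · simp only [ip]; linarith
  · simp only [ip]; linarith
  · have := normSq_sub p
    linarith

lemma secPair_mem {w : EC n} (hw : w ∈ lieBall n) : secPair (secR w) w ∈ unitSet n := by
  have hr := secR_pos hw
  have hr2 : secR w ^ 2 * (1 + ‖∑ j, w j ^ 2‖ ^ 2 - 2 * ∑ j, ‖w j‖ ^ 2) = 4 := by
    rw [secR, div_pow, Real.sq_sqrt hw.2.le, div_mul_cancel₀ _ hw.2.ne']; norm_num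
  apply mem_unitSet_of
  · simp only [zeta_sec, eta_sec, zj_sec, mul_pow, ← Finset.mul_sum]; ring
  · simp only [zeta_sec, eta_sec, zj_sec, map_mul, normSq_ofReal, ← Finset.mul_sum]
    simp only [Complex.normSq_eq_norm_sq]
    linarith
  · simp only [zeta_sec, eta_sec, map_mul, normSq_ofReal]
    rw [Complex.normSq_eq_norm_sq]
    have h0 := norm_nonneg (∑ j, w j ^ 2)
    have : ‖∑ j, w j ^ 2‖ ^ 2 < 1 := by nlinarith [hw.1]
    nlinarith [mul_pos hr hr]

/-- The section of the unit timelike bundle over the Lie ball with `z_u + i z_v > 0`. -/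
def sec (w : lieBall n) : UT n := ⟨secPair (secR w.1) w.1, secPair_mem w.2⟩

lemma continuous_sec : Continuous (sec : lieBall n → UT n) := by
  have hR : Continuous fun w : lieBall n => secR w.1 := by
    unfold secR
    refine continuous_const.div (by fun_prop) fun w => (Real.sqrt_pos.2 w.2.2).ne'
  refine Continuous.subtype_mk ?_ _
  unfold secPair
  fun_prop

lemma preCoord_sec (w : lieBall n) : preCoord (sec w) = w.1 := by
  ext j
  have : (secR w.1 : ℂ) ≠ 0 := by exact_mod_cast (secR_pos w.2).ne'
  simp only [preCoord, sec, zeta_sec, zj_sec]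
  exact mul_div_cancel_left₀ _ this

lemma preCoord_mem (p : UT n) : preCoord p ∈ lieBall n := by
  have hz := zeta_ne_zero p.2
  have hzp : 0 < ‖zeta p.1‖ := norm_pos_iff.2 hz
  have h1 := zeta_mul_eta p.2
  have h2 := normSq_sum p.2
  have h3 := normSq_sub p.1
  have h4 := p.2.2.2.2
  have hs : ∑ j, (preCoord p) j ^ 2 = eta p.1 / zeta p.1 := by
    simp only [preCoord, div_pow, ← Finset.sum_div, ← h1]
    field_simp
  have hn : ∑ j, ‖(preCoord p) j‖ ^ 2 = (∑ j, normSq (zj p.1 j)) / ‖zeta p.1‖ ^ 2 := by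
    simp only [preCoord, norm_div, div_pow, ← Finset.sum_div, Complex.normSq_eq_norm_sq]
  simp only [Complex.normSq_eq_norm_sq (zeta _), Complex.normSq_eq_norm_sq (eta _)] at h2 h3
  refine ⟨?_, ?_⟩
  · rw [hs, norm_div, div_lt_one hzp]
    exact lt_of_pow_lt_pow_left₀ 2 hzp.le (by linarith)
  · rw [hs, hn, norm_div]
    have : 1 + (‖eta p.1‖ / ‖zeta p.1‖) ^ 2 - 2 * ((∑ j, normSq (zj p.1 j)) / ‖zeta p.1‖ ^ 2) =
        (‖zeta p.1‖ ^ 2 + ‖eta p.1‖ ^ 2 - 2 * ∑ j, normSq (zj p.1 j)) / ‖zeta p.1‖ ^ 2 := by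
      field_simp
    rw [this]
    apply div_pos _ (by positivity)
    linarith

/-- Two pairs with the same coordinates differ by a rotation, of angle the difference of the
arguments of `z_u + i z_v`. -/
lemma eq_rot_of_preCoord_eq {p q : UT n} (h : preCoord p = preCoord q) :
    ‖zeta q.1 / zeta p.1‖ = 1 ∧
      q.1 = rotPair (zeta q.1 / zeta p.1).re (zeta q.1 / zeta p.1).im p.1 := by
  have hp := zeta_ne_zero p.2
  have hq := zeta_ne_zero q.2
  set c := zeta q.1 / zeta p.1 with hc
  have hc0 : c ≠ 0 := div_ne_zero hq hp
  have ez : zeta q.1 = c * zeta p.1 := by rw [hc]; field_simp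
  have ej : ∀ j, zj q.1 j = c * zj p.1 j := fun j => by
    have := congrArg (fun w : EC n => w j) h
    simp only [preCoord] at this
    rw [hc]; field_simp at this ⊢; linear_combination -this
  have ee : eta q.1 = c * eta p.1 := by
    have h1 := zeta_mul_eta p.2
    have h2 := zeta_mul_eta q.2
    simp only [ej, mul_pow, ← Finset.mul_sum, ← h1] at h2
    rw [ez] at h2
    apply mul_left_cancel₀ (mul_ne_zero hc0 hp)
    linear_combination h2
  refine ⟨?_, ?_⟩
  · have h1 := normSq_sum p.2
    have h2 := normSq_sum q.2
    simp only [ez, ej, ee, map_mul, ← Finset.mul_sum] at h2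
    have h3 : normSq c * 4 = 4 := by linear_combination h2 - normSq c * h1
    have h4 : ‖c‖ ^ 2 = 1 := by rw [← Complex.normSq_eq_norm_sq]; linarith
    nlinarith [norm_nonneg c]
  · apply pair_ext
    · rw [zeta_rot, Complex.eta]; exact ez
    · rw [eta_rot, Complex.eta]; exact ee
    · intro j; rw [zj_rot, Complex.eta]; exact ej j

lemma proj_eq_of_rot {p q : UT n} {c : ℂ} (hc : ‖c‖ = 1) (h : q.1 = rotPair c.re c.im p.1) :
    proj p = proj q := by
  apply Quotient.sound
  refine ⟨Complex.arg c, ?_⟩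
  have h0 : c ≠ 0 := by rintro rfl; simp at hc
  apply Subtype.ext
  rw [h]
  change rotPair (Real.cos c.arg) (Real.sin c.arg) p.1 = _
  rw [Complex.cos_arg h0, Complex.sin_arg, hc, div_one, div_one]

lemma coord_injective : Function.Injective (coord : TG n → EC n) := by
  intro τ τ'
  induction τ using Quotient.inductionOn with | _ p
  induction τ' using Quotient.inductionOn with | _ q
  intro h
  obtain ⟨h1, h2⟩ := eq_rot_of_preCoord_eq (p := p) (q := q) h
  exact proj_eq_of_rot h1 h2

lemma coord_mem (τ : TG n) : coord τ ∈ lieBall n := by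
  induction τ using Quotient.inductionOn with | _ p
  exact preCoord_mem p

/-- The global coordinates as a homeomorphism onto the Lie ball. -/
def coordHomeo : TG n ≃ₜ lieBall n where
  toFun τ := ⟨coord τ, coord_mem τ⟩
  invFun w := proj (sec w)
  left_inv τ := coord_injective (preCoord_sec ⟨coord τ, coord_mem τ⟩)
  right_inv w := Subtype.ext (preCoord_sec w)
  continuous_toFun := continuous_coord.subtype_mk _
  continuous_invFun := continuous_proj.comp continuous_sec

lemma isOpenEmbedding_coord : IsOpenEmbedding (coord : TG n → EC n) :=
  isOpen_lieBall.isOpenEmbedding_subtypeVal.comp coordHomeo.isOpenEmbedding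

instance : Nonempty (TG n) :=
  ⟨coordHomeo.symm ⟨0, by simp [lieBall]⟩⟩

/-- The smooth structure of the orbit space, of dimension `2n`. -/
instance : ChartedSpace (EC n) (TG n) := isOpenEmbedding_coord.singletonChartedSpace

instance : IsManifold 𝓘(ℝ, EC n) ∞ (TG n) := isOpenEmbedding_coord.isManifold_singleton

/-! ### The smooth structure of the unit timelike bundle -/

/-- The global section of the unit timelike bundle over the orbit space. -/
def gsec (τ : TG n) : UT n := sec (coordHomeo τ)

lemma proj_gsec (τ : TG n) : proj (gsec τ) = τ := coordHomeo.left_inv τ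

/-- The argument of `z_u + i z_v` as a point of the circle. -/
def phase (p : UT n) : Circle :=
  ⟨zeta p.1 / ‖zeta p.1‖, by
    rw [← SetLike.mem_coe, Submonoid.coe_unitSphere, mem_sphere_zero_iff_norm, norm_div, Complex.norm_real, norm_norm,
      div_self (norm_ne_zero_iff.2 (zeta_ne_zero p.2))]⟩

lemma circle_sq (c : Circle) : (c : ℂ).re ^ 2 + (c : ℂ).im ^ 2 = 1 := by
  have h := Circle.normSq_coe c
  rw [Complex.normSq_apply] at h
  linarith

/-- The rotation of a point of the unit timelike bundle along the flow. -/
def circleRot (c : Circle) (p : UT n) : UT n :=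
  ⟨rotPair (c : ℂ).re (c : ℂ).im p.1, rotPair_mem (circle_sq c) p.2⟩

lemma proj_circleRot (c : Circle) (p : UT n) : proj (circleRot c p) = proj p :=
  (proj_eq_of_rot (Circle.norm_coe c) rfl).symm

lemma zeta_gsec (τ : TG n) : ∃ r : ℝ, 0 < r ∧ zeta (gsec τ).1 = r :=
  ⟨_, secR_pos (coordHomeo τ).2, zeta_sec _ _⟩

/-- The unit timelike bundle is homeomorphic to the product of the orbit space and a circle. -/
def bundleHomeo : UT n ≃ₜ TG n × Circle where
  toFun p := (proj p, phase p)
  invFun a := circleRot a.2 (gsec a.1)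
  left_inv p := by
    obtain ⟨r, hr, hz⟩ := zeta_gsec (proj p)
    have h : preCoord (gsec (proj p)) = preCoord p := by
      rw [← coord_proj, ← coord_proj, proj_gsec]
    obtain ⟨h1, h2⟩ := eq_rot_of_preCoord_eq h
    apply Subtype.ext
    rw [h2]
    have : ((phase p : Circle) : ℂ) = zeta p.1 / zeta (gsec (proj p)).1 := by
      have h3 : ‖zeta p.1‖ = r := by
        rw [norm_div, hz, Complex.norm_real, Real.norm_of_nonneg hr.le, div_eq_one_iff_eq hr.ne']
          at h1
        exact h1
      change zeta p.1 / ‖zeta p.1‖ = _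
      rw [h3, hz]
    simp only [circleRot, this]
  right_inv a := by
    obtain ⟨r, hr, hz⟩ := zeta_gsec a.1
    refine Prod.ext ((proj_circleRot _ _).trans (proj_gsec _)) ?_
    apply Circle.ext
    change zeta (circleRot a.2 (gsec a.1)).1 / ‖zeta (circleRot a.2 (gsec a.1)).1‖ = _
    have hz2 : zeta (circleRot a.2 (gsec a.1)).1 = a.2 * r := by
      simp only [circleRot, zeta_rot, hz, Complex.eta]
    rw [hz2, norm_mul, Circle.norm_coe, one_mul, Complex.norm_real, Real.norm_of_nonneg hr.le]
    exact mul_div_cancel_right₀ _ (by exact_mod_cast hr.ne')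
  continuous_toFun := by
    refine continuous_proj.prodMk ?_
    refine Continuous.subtype_mk ?_ _
    have h : Continuous fun p : UT n => zeta p.1 := continuous_zeta.comp continuous_subtype_val
    refine h.div (Complex.continuous_ofReal.comp h.norm) fun p => ?_
    exact_mod_cast norm_ne_zero_iff.2 (zeta_ne_zero p.2)
  continuous_invFun := by
    have hg : Continuous fun a : TG n × Circle => (gsec a.1).1 :=
      continuous_subtype_val.comp (continuous_sec.comp (coordHomeo.continuous.comp continuous_fst))
    have hc : Continuous fun a : TG n × Circle => (a.2 : ℂ) :=
      continuous_subtype_val.comp continuous_snd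
    refine Continuous.subtype_mk ?_ _
    unfold rotPair
    have h1 := Complex.continuous_re.comp hc
    have h2 := Complex.continuous_im.comp hc
    exact ((h1.smul hg.fst).add (h2.smul hg.snd)).prodMk
      ((h2.neg.smul hg.fst).add (h1.smul hg.snd))

variable (n) in
/-- The model space of the unit timelike bundle, of dimension `2n + 1`. -/
abbrev HU : Type := ModelProd (EC n) (EuclideanSpace ℝ (Fin 1))

variable (n) in
/-- The model with corners of the orbit space. -/
abbrev IT : ModelWithCorners ℝ (EC n) (EC n) := 𝓘(ℝ, EC n)

variable (n) in
/-- The model with corners of the unit timelike bundle. -/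
abbrev IU : ModelWithCorners ℝ (EC n × EuclideanSpace ℝ (Fin 1)) (HU n) := (IT n).prod (𝓡 1)

/-- The smooth structure of the unit timelike bundle, of dimension `2n + 1`. -/
instance : ChartedSpace (HU n) (UT n) where
  atlas := (fun e => bundleHomeo.toOpenPartialHomeomorph.trans e) '' atlas (HU n) (TG n × Circle)
  chartAt p := bundleHomeo.toOpenPartialHomeomorph.trans (chartAt (HU n) (bundleHomeo p))
  mem_chart_source p := by simp
  chart_mem_atlas p := mem_image_of_mem _ (chart_mem_atlas _ _)

instance : IsManifold (IU n) ∞ (UT n) where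
  compatible := by
    rintro _ _ ⟨e, he, rfl⟩ ⟨e', he', rfl⟩
    have h := HasGroupoid.compatible (G := contDiffGroupoid ∞ (IU n)) he he'
    refine (contDiffGroupoid ∞ (IU n)).mem_of_eqOnSource h ?_
    refine ⟨?_, ?_⟩
    · ext x; simp
    · intro x hx; simp

/-! ### Geometry of the unit timelike bundle -/

/-- The inclusion of the unit timelike bundle in `ℝ^{2,n} × ℝ^{2,n}`. -/
def incl (p : UT n) : R2 n × R2 n := p.1

/-- The components `(ẋ, ẏ)` of a tangent vector of the unit timelike bundle. -/
def comps (p : UT n) : TangentSpace (IU n) p →L[ℝ] R2 n × R2 n :=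
  mfderiv (IU n) 𝓘(ℝ, R2 n × R2 n) incl p

variable (n) in
/-- The Liouville form `λ(ẋ, ẏ) = -⟨ẋ | y⟩`. -/
def liouville : DForm (IU n) (UT n) 1 := fun p =>
  ContinuousAlternatingMap.ofSubsingleton ℝ (TangentSpace (IU n) p) ℝ (0 : Fin 1)
    (-((ipL p.1.2).comp ((ContinuousLinearMap.fst ℝ (R2 n) (R2 n)).comp (comps p))))

/-- The pseudo-Riemannian metric `⟨ẋ | ẋ'⟩ + ⟨ẏ | ẏ'⟩` on the unit timelike bundle. -/
def metricU (p : UT n) (v w : TangentSpace (IU n) p) : ℝ :=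
  ip (comps p v).1 (comps p w).1 + ip (comps p v).2 (comps p w).2

/-- The vector field `Z` generating the geodesic flow: the velocity of `t ↦ Φ^t(p)` at `t = 0`
(a tangent vector at `Φ^0(p) = p`). -/
def flowField (p : UT n) : TangentSpace (IU n) p :=
  (mfderiv 𝓘(ℝ, ℝ) (IU n) (fun t : ℝ => flow t p) 0 (1 : ℝ) : TangentSpace (IU n) (flow 0 p))

/-- The differential of the projection onto the orbit space. -/
def dproj (p : UT n) : TangentSpace (IU n) p →L[ℝ] TangentSpace (IT n) (proj p) :=
  mfderiv (IU n) (IT n) proj p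

/-! ### Structures on the orbit space -/

/-- The differential of a map from the orbit space to `ℂ^n`. -/
def dC (f : TG n → EC n) (τ : TG n) : TangentSpace (IT n) τ →L[ℝ] EC n :=
  mfderiv (IT n) 𝓘(ℝ, EC n) f τ

/-- `J` is a complex structure: `J² = -1`, and around each point there are smooth coordinates with
values in `ℂ^n` in which `J` is the multiplication by `i`. -/
structure IsComplexStructure
    (J : ∀ τ : TG n, TangentSpace (IT n) τ →L[ℝ] TangentSpace (IT n) τ) : Prop where
  sq : ∀ τ ξ, J τ (J τ ξ) = -ξ
  integrable : ∀ τ₀ : TG n, ∃ e : OpenPartialHomeomorph (TG n) (EC n), τ₀ ∈ e.source ∧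
    ContMDiffOn (IT n) 𝓘(ℝ, EC n) ∞ e e.source ∧
    ContMDiffOn 𝓘(ℝ, EC n) (IT n) ∞ e.symm e.target ∧
    ∀ τ ∈ e.source, ∀ ξ : TangentSpace (IT n) τ, dC e τ (J τ ξ) = Complex.I • dC e τ ξ

section Maps

variable {S : Type*} [TopologicalSpace S] [ChartedSpace (EuclideanSpace ℝ (Fin n)) S]

/-- A Lagrangian immersion of an `n`-dimensional manifold in the orbit space. -/
structure IsLagrangianImmersion (Ω : DForm (IT n) (TG n) 2) (φ : S → TG n) : Prop where
  smooth : ContMDiff (𝓡 n) (IT n) ∞ φ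
  immersion : ∀ s : S, Function.Injective (mfderiv (𝓡 n) (IT n) φ s)
  lagrangian : DForm.pullback (𝓡 n) φ Ω = 0

/-- The map `x` from an `n`-dimensional manifold to `ℝ^{2,n}` takes its value at `s` in anti-de
Sitter space, is smooth near `s`, and is a spacelike immersion at `s`: its differential at `s` maps
nonzero vectors to spacelike vectors. -/
structure IsSpacelikeImmersionAt (x : S → R2 n) (s : S) : Prop where
  mem : x s ∈ AdS n
  smooth : ContMDiffAt (𝓡 n) 𝓘(ℝ, R2 n) ∞ x s
  spacelike : ∀ v : TangentSpace (𝓡 n) s, v ≠ 0 →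
    0 < ip (mfderiv (𝓡 n) 𝓘(ℝ, R2 n) x s v) (mfderiv (𝓡 n) 𝓘(ℝ, R2 n) x s v)

/-- `τ` is the timelike geodesic orthogonal to the hypersurface `x` at `x s`: it is the class of
`(x s, y)` where `y` is a future oriented unit timelike vector at `x s` orthogonal to the image of
the differential of `x`. -/
def IsGaussImageAt (x : S → R2 n) (s : S) (τ : TG n) : Prop :=
  ∃ p : UT n, p.1.1 = x s ∧ proj p = τ ∧
    ∀ v : TangentSpace (𝓡 n) s, ip (mfderiv (𝓡 n) 𝓘(ℝ, R2 n) x s v) p.1.2 = 0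

end Maps

end AdSGauss

end

universe u

open AdSGauss

open Set Filter Topology Complex
open scoped Manifold ContDiff
noncomputable section
namespace AdSGauss
variable {n : ℕ}

/-! ### The scalar product of signature `(2, n)` -/

/-! Put z = x - i y. The flow multiplies z by e^{it}. With ζ = z_u + i z_v and η = z_u - i z_v, the
equations of `unitSet` read ζη = Σ z_j² and |ζ|² + |η|² = 4 + 2 Σ |z_j|², and the time orientation
reads |η| < |ζ|. Hence the quotients z_j / ζ identify the orbit space with the Lie ball, and the
section `ambSec` (ζ > 0), rotated by the circle, trivialises the bundle. All the geometry is then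
computed in ℝ^{2,n} × ℝ^{2,n}: `comps` identifies each tangent space with the explicit subspace
`tanSpace` (`comps_injective`, `range_comps`). There dλ becomes the constant form `sympl`, the flow
field becomes `reeb`, and dπ becomes `dCoord`, whose kernel on `tanSpace` is the line of `reeb`
(`eq_smul_reeb`).

The form dλ is invariant under rotations and annihilates `reeb`, so it descends
(`sympl_fderiv_ambSec`). The descended form is the pullback of dλ by the section, hence closed. The
map (ẋ, ẏ) ↦ (ẏ, -ẋ) is multiplication of ż by i, so in the coordinates z_j / ζ it is again
multiplication by i, which gives integrability. For a horizontal vector both components are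
orthogonal to the negative plane spanned by x and y, so the metric is positive on it
(`ambMetric_pos`). Through `sympl_ambJ` this also gives the contact condition and the nondegeneracy
of ω.

The orthogonal of a spacelike n-plane is negative definite (`ip_self_neg_of_orthogonal`), so a
spacelike immersion has a unique future unit normal y. The lift s ↦ (x, y) is horizontal, that is,
it pulls λ back to 0. Therefore it pulls dλ back to 0, and since horizontal vectors meet ker dπ only
in 0, its projection is a Lagrangian immersion. Embeddedness and closedness rest on an open mapping
argument: geodesics close to one that meets the hypersurface at x(s) meet it close to x(s)
(`eventually_exists_mem_geodesicOf`).

Conversely, composing a Lagrangian immersion with the section gives a lift along which λ is closed.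
On a simply connected manifold λ is then exact (`exists_primitive`). Flowing for a time f adds df to
the pullback of λ (`ip_comps_mfderiv_flow_comp`), so a suitable f makes the lift horizontal. The
base point map of such a lift may be singular, but a small nonzero rotation repairs it, because
isotropy couples the two components of the differential (`eventually_injective_rotation`). -/

@[simp] lemma ipL_apply (a b : R2 n) : ipL b a = ip a b := rfl

lemma ip_add_left (a a' b : R2 n) : ip (a + a') b = ip a b + ip a' b := (ipL b).map_add a a'

lemma ip_smul_left (c : ℝ) (a b : R2 n) : ip (c • a) b = c * ip a b := (ipL b).map_smul c a

lemma ip_neg_left (a b : R2 n) : ip (-a) b = -ip a b := (ipL b).map_neg a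

lemma ip_sub_left (a a' b : R2 n) : ip (a - a') b = ip a b - ip a' b := (ipL b).map_sub a a'

lemma ip_zero_left (b : R2 n) : ip 0 b = 0 := (ipL b).map_zero

lemma ip_add_right (a b b' : R2 n) : ip a (b + b') = ip a b + ip a b' := by
  simp only [ip_comm a, ip_add_left]

lemma ip_smul_right (c : ℝ) (a b : R2 n) : ip a (c • b) = c * ip a b := by
  simp only [ip_comm a, ip_smul_left]

lemma ip_neg_right (a b : R2 n) : ip a (-b) = -ip a b := by
  simp only [ip_comm a, ip_neg_left]

lemma ip_sub_right (a b b' : R2 n) : ip a (b - b') = ip a b - ip a b' := by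
  simp only [ip_comm a, ip_sub_left]

lemma ip_zero_right (a : R2 n) : ip a 0 = 0 := by rw [ip_comm, ip_zero_left]

variable (n) in
/-- The scalar product as a continuous bilinear form. -/
def ipB : R2 n →L[ℝ] R2 n →L[ℝ] ℝ :=
  LinearMap.toContinuousLinearMap
    { toFun := ipL
      map_add' := fun b b' => ContinuousLinearMap.ext fun a => ip_add_right a b b'
      map_smul' := fun c b => ContinuousLinearMap.ext fun a => ip_smul_right c a b }

@[simp] lemma ipB_apply (a b : R2 n) : ipB n b a = ip a b := rfl

lemma ip_self_spatial {w : R2 n} (hu : w.1 = 0) (hv : w.2.1 = 0) :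
    ip w w = ‖w.2.2‖ ^ 2 := by
  rw [EuclideanSpace.norm_sq_eq]
  simp [ip, hu, hv, pow_two]

lemma ip_self_spatial_nonneg {w : R2 n} (hu : w.1 = 0) (hv : w.2.1 = 0) : 0 ≤ ip w w := by
  rw [ip_self_spatial hu hv]; positivity

/-- If the determinant vanished, some nontrivial combination of x and y would have no time
components and hence nonnegative square, whereas the span of x and y is negative definite. -/
lemma det_ne_zero {x y : R2 n} (hx : ip x x < 0) (hy : ip y y < 0) (hxy : ip x y = 0) :
    x.1 * y.2.1 - x.2.1 * y.1 ≠ 0 := by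
  intro hD
  have key : ∀ a b : ℝ, a * x.1 + b * y.1 = 0 → a * x.2.1 + b * y.2.1 = 0 → a = 0 := by
    intro a b h1 h2
    have h := ip_self_spatial_nonneg (w := a • x + b • y) (by simpa using h1) (by simpa using h2)
    rw [ip_comb, hxy] at h
    by_contra ha
    have : 0 < a ^ 2 := by positivity
    nlinarith [sq_nonneg b]
  -- When the determinant is zero, y₁x - x₁y and y₂x - x₂y (indices for the two time components) are
  -- purely spatial, so y₁ = y₂ = 0 and y itself would be spatial.
  have h1 := key y.1 (-x.1) (by ring) (by linarith)
  have h2 := key y.2.1 (-x.2.1) (by linarith) (by ring)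
  exact absurd (ip_self_spatial_nonneg h1 h2) (not_le.2 hy)

/-- Subtracting from w the combination a x + b y with the same time components leaves a spatial
vector s. By orthogonality q(w) = q(s) - a² q(x) - b² q(y), a sum of nonnegative terms that vanishes
only for w = 0. -/
lemma ip_self_pos {x y w : R2 n} (hx : ip x x < 0) (hy : ip y y < 0) (hxy : ip x y = 0)
    (hwx : ip w x = 0) (hwy : ip w y = 0) (hw : w ≠ 0) : 0 < ip w w := by
  have hD := det_ne_zero hx hy hxy
  set D := x.1 * y.2.1 - x.2.1 * y.1 with hDef
  -- Cramer's rule for the two time components of w = a x + b y.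
  set a := (w.1 * y.2.1 - w.2.1 * y.1) / D with ha
  set b := (x.1 * w.2.1 - x.2.1 * w.1) / D with hb
  have e1 : a * x.1 + b * y.1 = w.1 := by
    rw [ha, hb]; field_simp; rw [hDef]; ring
  have e2 : a * x.2.1 + b * y.2.1 = w.2.1 := by
    rw [ha, hb]; field_simp; rw [hDef]; ring
  set s := w - (a • x + b • y) with hs
  have s1 : s.1 = 0 := by simp [hs, e1]
  have s2 : s.2.1 = 0 := by simp [hs, e2]
  have h := ip_self_spatial s1 s2
  have h' : ip s s = ip w w + a ^ 2 * ip x x + b ^ 2 * ip y y := by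
    simp only [hs, ip_sub_left, ip_sub_right, ip_add_left, ip_add_right, ip_smul_left,
      ip_smul_right, hwx, hwy, hxy, ip_comm x w, ip_comm y w, ip_comm y x]
    ring
  rw [h'] at h
  by_contra hneg
  have p1 : a ^ 2 * ip x x ≤ 0 := mul_nonpos_of_nonneg_of_nonpos (sq_nonneg a) hx.le
  have p2 : b ^ 2 * ip y y ≤ 0 := mul_nonpos_of_nonneg_of_nonpos (sq_nonneg b) hy.le
  have p3 : 0 ≤ ‖s.2.2‖ ^ 2 := by positivity
  have a0 : a = 0 := by
    by_contra h0
    have : a ^ 2 * ip x x < 0 := mul_neg_of_pos_of_neg (by positivity) hx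
    linarith
  have b0 : b = 0 := by
    by_contra h0
    have : b ^ 2 * ip y y < 0 := mul_neg_of_pos_of_neg (by positivity) hy
    linarith
  have n0 : ‖s.2.2‖ = 0 := by
    have : ‖s.2.2‖ ^ 2 = 0 := by linarith
    simpa using this
  have hsw : s = w := by simp [hs, a0, b0]
  rw [hsw] at s1 s2 n0
  exact hw (Prod.ext s1 (Prod.ext s2 (norm_eq_zero.1 n0)))

lemma ip_self_nonneg {x y w : R2 n} (hx : ip x x < 0) (hy : ip y y < 0) (hxy : ip x y = 0)
    (hwx : ip w x = 0) (hwy : ip w y = 0) : 0 ≤ ip w w := by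
  rcases eq_or_ne w 0 with rfl | hw
  · rw [ip_zero_left]
  · exact (ip_self_pos hx hy hxy hwx hwy hw).le

lemma unitSet_fst {p : R2 n × R2 n} (hp : p ∈ unitSet n) : ip p.1 p.1 = -1 := hp.1

/-- Pairs satisfying the equations of the unit timelike bundle belong to it up to the sign of the
second vector. -/
lemma mem_unitSet_or {x y : R2 n} (hx : ip x x = -1) (hy : ip y y = -1) (hxy : ip x y = 0) :
    (x, y) ∈ unitSet n ∨ (x, -y) ∈ unitSet n := by
  have hD := det_ne_zero (by linarith) (by linarith) hxy
  rcases lt_or_gt_of_ne hD with h | h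
  · right
    refine ⟨hx, ?_, ?_, ?_⟩
    · simp [ip_neg_right, hxy]
    · simp [ip_neg_right, ip_neg_left, hy]
    · rw [ip_neg_left, ip_dtheta]; simpa using h
  · left
    exact ⟨hx, hxy, hy, by rw [ip_dtheta]; simpa using h⟩

/-! ### Tangent vectors of the unit timelike bundle -/

/-- The space of tangent vectors of the unit timelike bundle in the ambient space. -/
def tanSpace (p : R2 n × R2 n) : Submodule ℝ (R2 n × R2 n) where
  carrier := {a | ip a.1 p.1 = 0 ∧ ip a.2 p.2 = 0 ∧ ip a.1 p.2 + ip a.2 p.1 = 0}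
  add_mem' := by
    rintro a b ⟨h1, h2, h3⟩ ⟨h1', h2', h3'⟩
    refine ⟨?_, ?_, ?_⟩ <;> simp only [Prod.fst_add, Prod.snd_add, ip_add_left] <;> linarith
  zero_mem' := by simp [ip_zero_left]
  smul_mem' := by
    rintro c a ⟨h1, h2, h3⟩
    refine ⟨?_, ?_, ?_⟩ <;> simp only [Prod.smul_fst, Prod.smul_snd, ip_smul_left, h1, h2, mul_zero]
    rw [← mul_add, h3, mul_zero]

lemma mem_tanSpace {p a : R2 n × R2 n} : a ∈ tanSpace p ↔
    ip a.1 p.1 = 0 ∧ ip a.2 p.2 = 0 ∧ ip a.1 p.2 + ip a.2 p.1 = 0 := Iff.rfl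

/-- The generator `(y, -x)` of the flow in the ambient space. -/
def reeb (p : R2 n × R2 n) : R2 n × R2 n := (p.2, -p.1)

lemma reeb_mem {p : R2 n × R2 n} (hp : p ∈ unitSet n) : reeb p ∈ tanSpace p := by
  obtain ⟨h1, h2, h3, -⟩ := hp
  have h1 : ip p.1 p.1 = -1 := h1
  refine ⟨?_, ?_, ?_⟩ <;> simp [reeb, ip_neg_left, ip_comm p.2 p.1, h1, h2, h3]

/-- The symplectic form of the ambient space. -/
def sympl (a b : R2 n × R2 n) : ℝ := ip a.1 b.2 - ip a.2 b.1

lemma sympl_swap (a b : R2 n × R2 n) : sympl a b = -sympl b a := by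
  simp only [sympl, ip_comm b.1, ip_comm b.2]; ring

lemma sympl_add_left (a a' b : R2 n × R2 n) : sympl (a + a') b = sympl a b + sympl a' b := by
  simp only [sympl, Prod.fst_add, Prod.snd_add, ip_add_left]; ring

lemma sympl_smul_left (c : ℝ) (a b : R2 n × R2 n) : sympl (c • a) b = c * sympl a b := by
  simp only [sympl, Prod.smul_fst, Prod.smul_snd, ip_smul_left]; ring

lemma sympl_add_right (a b b' : R2 n × R2 n) : sympl a (b + b') = sympl a b + sympl a b' := by
  rw [sympl_swap, sympl_add_left, sympl_swap a b, sympl_swap a b']; ring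

lemma sympl_smul_right (c : ℝ) (a b : R2 n × R2 n) : sympl a (c • b) = c * sympl a b := by
  rw [sympl_swap, sympl_smul_left, sympl_swap a b]; ring

/-- The ambient form of i_Z dλ = 0: contracting `sympl` with (y, -x) gives half the differential of
⟨x|x⟩ + ⟨y|y⟩, which vanishes on tangent vectors. -/
lemma sympl_reeb {p a : R2 n × R2 n} (ha : a ∈ tanSpace p) : sympl (reeb p) a = 0 := by
  obtain ⟨h1, h2, -⟩ := ha
  simp only [sympl, reeb, ip_neg_left, ip_comm p.1, ip_comm p.2, h1, h2]; ring

/-- The pseudo-Riemannian metric of the ambient space. -/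
def ambMetric (a b : R2 n × R2 n) : ℝ := ip a.1 b.1 + ip a.2 b.2

/-- The complex structure `(ẋ, ẏ) ↦ (ẏ, -ẋ)` of the ambient space. -/
def ambJ (a : R2 n × R2 n) : R2 n × R2 n := (a.2, -a.1)

lemma sympl_ambJ (a b : R2 n × R2 n) : sympl a (ambJ b) = -ambMetric a b := by
  simp only [sympl, ambJ, ambMetric, ip_neg_right]; ring

lemma ambMetric_comm (a b : R2 n × R2 n) : ambMetric a b = ambMetric b a := by
  simp only [ambMetric, ip_comm b.1, ip_comm b.2]

lemma ip_snd_eq {p a : R2 n × R2 n} (ha : a ∈ tanSpace p) (h : ip a.1 p.2 = 0) :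
    ip a.2 p.1 = 0 := by
  have := ha.2.2; linarith

lemma ambJ_mem {p a : R2 n × R2 n} (ha : a ∈ tanSpace p) (h : ip a.1 p.2 = 0) :
    ambJ a ∈ tanSpace p ∧ ip (ambJ a).1 p.2 = 0 := by
  have h' := ip_snd_eq ha h
  obtain ⟨h1, h2, -⟩ := ha
  refine ⟨⟨h', ?_, ?_⟩, h2⟩ <;> simp [ambJ, ip_neg_left, h, h1, h2]

/-- Horizontality and the tangency equations make each component of a orthogonal to both x and y, so
`ip_self_pos` applies to each component separately. -/
lemma ambMetric_pos {p a : R2 n × R2 n} (hp : p ∈ unitSet n) (ha : a ∈ tanSpace p)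
    (h : ip a.1 p.2 = 0) (h0 : a ≠ 0) : 0 < ambMetric a a := by
  have h' := ip_snd_eq ha h
  have hx : ip p.1 p.1 < 0 := by rw [unitSet_fst hp]; norm_num
  have hy : ip p.2 p.2 < 0 := by rw [hp.2.2.1]; norm_num
  have n1 := ip_self_nonneg hx hy hp.2.1 ha.1 h
  have n2 := ip_self_nonneg hx hy hp.2.1 h' ha.2.1
  unfold ambMetric
  rcases eq_or_ne a.1 0 with h1 | h1
  · have h2 : a.2 ≠ 0 := fun h2 => h0 (Prod.ext h1 h2)
    linarith [ip_self_pos hx hy hp.2.1 h' ha.2.1 h2]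
  · linarith [ip_self_pos hx hy hp.2.1 ha.1 h h1]

/-- The component of a tangent vector orthogonal to the generator of the flow. -/
def hor (p a : R2 n × R2 n) : R2 n × R2 n := a + ip a.1 p.2 • reeb p

lemma hor_mem {p a : R2 n × R2 n} (hp : p ∈ unitSet n) (ha : a ∈ tanSpace p) :
    hor p a ∈ tanSpace p := add_mem ha (Submodule.smul_mem _ _ (reeb_mem hp))

lemma hor_orth {p : R2 n × R2 n} (hp : p ∈ unitSet n) (a : R2 n × R2 n) :
    ip (hor p a).1 p.2 = 0 := by
  simp only [hor, reeb, Prod.fst_add, Prod.smul_fst, ip_add_left, ip_smul_left, hp.2.2.1]; ring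

lemma hor_eq_self {p a : R2 n × R2 n} (h : ip a.1 p.2 = 0) : hor p a = a := by
  simp [hor, h]

/-- The vectors `hor p a` and a differ by a multiple of `reeb p`, which lies in the radical of
`sympl` on tangent vectors. -/
lemma sympl_hor {p a b : R2 n × R2 n} (hp : p ∈ unitSet n) (ha : a ∈ tanSpace p)
    (hb : b ∈ tanSpace p) : sympl (hor p a) (hor p b) = sympl a b := by
  have h1 := sympl_reeb (hor_mem hp hb)
  have h2 := sympl_reeb ha
  rw [hor, sympl_add_left, sympl_smul_left, h1, hor, sympl_add_right, sympl_smul_right,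
    sympl_swap a (reeb p), h2]
  ring

/-! ### Rotations -/

/-- Rotations as continuous linear maps. -/
def rotL (a b : ℝ) : (R2 n × R2 n) →L[ℝ] (R2 n × R2 n) :=
  ContinuousLinearMap.prod
    (a • ContinuousLinearMap.fst ℝ _ _ + b • ContinuousLinearMap.snd ℝ _ _)
    (-b • ContinuousLinearMap.fst ℝ _ _ + a • ContinuousLinearMap.snd ℝ _ _)

@[simp] lemma rotL_apply (a b : ℝ) (p : R2 n × R2 n) : rotL a b p = rotPair a b p := by
  simp [rotL, rotPair]

lemma rotPair_tanSpace {a b : ℝ} {p c : R2 n × R2 n} (hc : c ∈ tanSpace p) :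
    rotPair a b c ∈ tanSpace (rotPair a b p) := by
  obtain ⟨h1, h2, h3⟩ := hc
  simp only [mem_tanSpace, rotPair, ip_add_left, ip_add_right, ip_smul_left, ip_smul_right, h1, h2]
  refine ⟨?_, ?_, ?_⟩
  · linear_combination a * b * h3
  · linear_combination -(a * b) * h3
  · linear_combination (a ^ 2 - b ^ 2) * h3

lemma sympl_rotPair {a b : ℝ} (h : a ^ 2 + b ^ 2 = 1) (c d : R2 n × R2 n) :
    sympl (rotPair a b c) (rotPair a b d) = sympl c d := by
  simp only [sympl, rotPair, ip_add_left, ip_add_right, ip_smul_left, ip_smul_right]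
  linear_combination (ip c.1 d.2 - ip c.2 d.1) * h

/-- The term -b²⟨ẏ|x⟩ becomes b²⟨ẋ|y⟩ by the third tangency equation, and a² + b² = 1 concludes. -/
lemma liouville_rotPair {a b : ℝ} (h : a ^ 2 + b ^ 2 = 1) {p c : R2 n × R2 n}
    (hc : c ∈ tanSpace p) : ip (rotPair a b c).1 (rotPair a b p).2 = ip c.1 p.2 := by
  obtain ⟨h1, h2, h3⟩ := hc
  simp only [rotPair, ip_add_left, ip_add_right, ip_smul_left, ip_smul_right, h1, h2]
  linear_combination (ip c.1 p.2) * h - b ^ 2 * h3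

/-! ### The coordinates as functions on the ambient space -/

variable (n) in
/-- The function `zeta` as a continuous linear map. -/
def zetaL : (R2 n × R2 n) →L[ℝ] ℂ :=
  LinearMap.toContinuousLinearMap
    { toFun := zeta
      map_add' := fun p q => by apply Complex.ext <;> simp [zeta] <;> ring
      map_smul' := fun c p => by apply Complex.ext <;> simp [zeta] <;> ring }

variable (n) in
/-- The function `eta` as a continuous linear map. -/
def etaL : (R2 n × R2 n) →L[ℝ] ℂ :=
  LinearMap.toContinuousLinearMap
    { toFun := eta
      map_add' := fun p q => by apply Complex.ext <;> simp [eta] <;> ring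
      map_smul' := fun c p => by apply Complex.ext <;> simp [eta] <;> ring }

/-- The functions `zj` as continuous linear maps. -/
def zjL (j : Fin n) : (R2 n × R2 n) →L[ℝ] ℂ :=
  LinearMap.toContinuousLinearMap
    { toFun := fun p => zj p j
      map_add' := fun p q => by apply Complex.ext <;> simp [zj]; ring
      map_smul' := fun c p => by apply Complex.ext <;> simp [zj] }

@[simp] lemma zetaL_apply (p : R2 n × R2 n) : zetaL n p = zeta p := rfl

@[simp] lemma etaL_apply (p : R2 n × R2 n) : etaL n p = eta p := rfl

@[simp] lemma zjL_apply (j : Fin n) (p : R2 n × R2 n) : zjL j p = zj p j := rfl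

/-- The coordinates `z_j / (z_u + i z_v)` on the ambient space. -/
def ambCoord (p : R2 n × R2 n) : EC n := WithLp.toLp 2 fun j => zj p j / zeta p

lemma contDiffAt_ambCoord {p : R2 n × R2 n} (hp : zeta p ≠ 0) : ContDiffAt ℝ ∞ ambCoord p :=
  contDiffAt_piLp' 2 fun j => by
    change ContDiffAt ℝ ∞ (fun q => zjL j q / zetaL n q) p
    simp only [div_eq_mul_inv]
    exact (zjL j).contDiff.contDiffAt.mul
      (ContDiffAt.fun_comp p (contDiffAt_inv ℝ hp) (zetaL n).contDiff.contDiffAt)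

/-- The differential of the coordinates. -/
def dCoord (p : R2 n × R2 n) : (R2 n × R2 n) →L[ℝ] EC n := fderiv ℝ ambCoord p

lemma hasFDerivAt_ambCoord {p : R2 n × R2 n} (hp : zeta p ≠ 0) :
    HasFDerivAt ambCoord (dCoord p) p :=
  ((contDiffAt_ambCoord hp).differentiableAt (by simp)).hasFDerivAt

/-- The quotient rule in product form: the identity w_j ζ = z_j between a coordinate and two linear
functions is differentiated. -/
lemma dCoord_spec {p : R2 n × R2 n} (hp : zeta p ≠ 0) (a : R2 n × R2 n) (j : Fin n) :
    zj a j = dCoord p a j * zeta p + ambCoord p j * zeta a := by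
  have h1 : HasFDerivAt (fun q => ambCoord q j)
      (((EuclideanSpace.proj j : EC n →L[ℂ] ℂ).restrictScalars ℝ).comp (dCoord p)) p :=
    ((EuclideanSpace.proj j : EC n →L[ℂ] ℂ).restrictScalars ℝ).hasFDerivAt.comp p
      (hasFDerivAt_ambCoord hp)
  have h2 := h1.mul (zetaL n).hasFDerivAt
  have h3 : (fun q => ambCoord q j * zetaL n q) =ᶠ[𝓝 p] zjL j := by
    filter_upwards [continuous_zeta.continuousAt.eventually_ne hp] with q hq
    exact div_mul_cancel₀ _ hq
  have h4 := h2.unique ((zjL j).hasFDerivAt.congr_of_eventuallyEq h3)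
  have h5 := congrArg (fun L => L a) h4
  simp at h5
  rw [← h5]; ring

lemma dCoord_apply {p : R2 n × R2 n} (hp : zeta p ≠ 0) (a : R2 n × R2 n) (j : Fin n) :
    dCoord p a j = (zj a j - ambCoord p j * zeta a) / zeta p := by
  rw [dCoord_spec hp a j]; field_simp; ring

/-- The derivative of the complex equation ζη = Σ z_j²; its real and imaginary parts are
combinations of the three tangency equations. -/
lemma tanSpace_eta {p a : R2 n × R2 n} (ha : a ∈ tanSpace p) :
    zeta a * eta p + zeta p * eta a = 2 * ∑ j, zj p j * zj a j := by
  obtain ⟨h1, h2, h3⟩ := ha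
  simp only [ip] at h1 h2 h3
  apply Complex.ext
  · simp only [zeta, eta, zj, Complex.mul_re, Complex.re_sum, Complex.add_re, Complex.re_ofNat,
      Complex.im_ofNat, zero_mul, sub_zero]
    have : ∑ j, (p.1.2.2 j * a.1.2.2 j - -p.2.2.2 j * -a.2.2.2 j) =
        ∑ j, a.1.2.2 j * p.1.2.2 j - ∑ j, a.2.2.2 j * p.2.2.2 j := by
      rw [← Finset.sum_sub_distrib]; exact Finset.sum_congr rfl fun i _ => by ring
    rw [this]; linarith
  · simp only [zeta, eta, zj, Complex.mul_im, Complex.im_sum, Complex.add_im, Complex.re_ofNat,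
      Complex.im_ofNat, zero_mul, add_zero]
    have : ∑ j, (p.1.2.2 j * -a.2.2.2 j + -p.2.2.2 j * a.1.2.2 j) =
        -(∑ j, a.1.2.2 j * p.2.2.2 j + ∑ j, a.2.2.2 j * p.1.2.2 j) := by
      rw [← Finset.sum_add_distrib, ← Finset.sum_neg_distrib]
      exact Finset.sum_congr rfl fun i _ => by ring
    rw [this]; linarith

/-- The derivative, halved, of the normalization |ζ|² + |η|² = 4 + 2 Σ |z_j|². -/
lemma tanSpace_re {p a : R2 n × R2 n} (ha : a ∈ tanSpace p) :
    (zeta a * starRingEnd ℂ (zeta p)).re + (eta a * starRingEnd ℂ (eta p)).re =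
      2 * ∑ j, (zj a j * starRingEnd ℂ (zj p j)).re := by
  obtain ⟨h1, h2, h3⟩ := ha
  simp only [ip] at h1 h2 h3
  simp only [zeta, eta, zj, Complex.mul_re, Complex.conj_re, Complex.conj_im]
  have : ∑ j, (a.1.2.2 j * p.1.2.2 j - -a.2.2.2 j * - -p.2.2.2 j) =
      ∑ j, a.1.2.2 j * p.1.2.2 j + ∑ j, a.2.2.2 j * p.2.2.2 j := by
    rw [← Finset.sum_add_distrib]; exact Finset.sum_congr rfl fun i _ => by ring
  rw [this]; linarith

/-- The generator multiplies z by i, and the coordinates are homogeneous of degree 0 in z. -/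
lemma dCoord_reeb {p : R2 n × R2 n} (hp : zeta p ≠ 0) : dCoord p (reeb p) = 0 := by
  have e1 : zeta (reeb p) = Complex.I * zeta p := by
    apply Complex.ext <;> simp [zeta, reeb] <;> ring
  have e2 : ∀ j, zj (reeb p) j = Complex.I * zj p j := fun j => by
    apply Complex.ext <;> simp [zj, reeb]
  ext j
  rw [dCoord_apply hp, e1, e2]
  simp only [ambCoord, PiLp.zero_apply]
  field_simp; ring

/-- The kernel of the differential of the coordinates on tangent vectors is generated by the
generator of the flow. -/
lemma eq_smul_reeb {p a : R2 n × R2 n} (hp : p ∈ unitSet n) (ha : a ∈ tanSpace p)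
    (h : dCoord p a = 0) : ∃ t : ℝ, a = t • reeb p := by
  have hz := zeta_ne_zero hp
  -- The vanishing of `dCoord p a` says that the z_j are scaled by the same complex factor c as ζ.
  -- The quadric equation extends this to η, and the normalization forces c to be purely imaginary,
  -- that is, an infinitesimal rotation.
  set c := zeta a / zeta p with hc
  have ez : zeta a = c * zeta p := by rw [hc]; field_simp
  have ej : ∀ j, zj a j = c * zj p j := fun j => by
    rw [dCoord_spec hz a j, h, ez]
    simp only [ambCoord, PiLp.zero_apply]
    field_simp; ring
  have ee : eta a = c * eta p := by
    have h1 := zeta_mul_eta hp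
    have h2 := tanSpace_eta ha
    have h3 : ∑ j, zj p j * zj a j = c * ∑ j, zj p j ^ 2 := by
      rw [Finset.mul_sum]; exact Finset.sum_congr rfl fun j _ => by rw [ej]; ring
    rw [h3, ← h1, ez] at h2
    apply mul_left_cancel₀ hz
    linear_combination h2
  have hre : c.re = 0 := by
    have h1 := normSq_sum hp
    have h2 := tanSpace_re ha
    have key : ∀ z : ℂ, (c * z * starRingEnd ℂ z).re = c.re * normSq z := fun z => by
      rw [mul_assoc, Complex.mul_conj]; simp
    simp only [ez, ee, ej, key, ← Finset.mul_sum] at h2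
    have h3 : c.re * 4 = 0 := by linear_combination h2 - c.re * h1
    linarith
  refine ⟨c.im, ?_⟩
  have hcI : c = c.im * Complex.I := by apply Complex.ext <;> simp [hre]
  apply pair_ext
  · rw [ez, hcI]; apply Complex.ext <;> simp [zeta, reeb] <;> ring
  · rw [ee, hcI]; apply Complex.ext <;> simp [eta, reeb] <;> ring
  · intro j; rw [ej, hcI]; apply Complex.ext <;> simp [zj, reeb]

lemma dCoord_hor {p : R2 n × R2 n} (hp : zeta p ≠ 0) (a : R2 n × R2 n) :
    dCoord p (hor p a) = dCoord p a := by
  rw [hor, map_add, map_smul, dCoord_reeb hp, smul_zero, add_zero]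

/-- On z = x - i y the map (ẋ, ẏ) ↦ (ẏ, -ẋ) is multiplication by i, and the coordinates are
holomorphic in z, so their differential commutes with i. -/
lemma dCoord_ambJ {p : R2 n × R2 n} (hp : zeta p ≠ 0) (a : R2 n × R2 n) :
    dCoord p (ambJ a) = Complex.I • dCoord p a := by
  have e1 : zeta (ambJ a) = Complex.I * zeta a := by
    apply Complex.ext <;> simp [zeta, ambJ] <;> ring
  have e2 : ∀ j, zj (ambJ a) j = Complex.I * zj a j := fun j => by
    apply Complex.ext <;> simp [zj, ambJ]
  ext j
  rw [PiLp.smul_apply, dCoord_apply hp, dCoord_apply hp, e1, e2, smul_eq_mul]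
  ring

/-- Tangent vectors with the same image under the differential of the coordinates have the same
horizontal component. -/
lemma hor_eq_hor {p a b : R2 n × R2 n} (hp : p ∈ unitSet n) (ha : a ∈ tanSpace p)
    (hb : b ∈ tanSpace p) (h : dCoord p a = dCoord p b) : hor p a = hor p b := by
  obtain ⟨t, ht⟩ := eq_smul_reeb hp (sub_mem ha hb) (by rw [map_sub, h, sub_self])
  have hab : a = b + t • reeb p := by rw [← ht]; abel
  have : ip (reeb p).1 p.2 = -1 := hp.2.2.1
  rw [hab]
  simp only [hor, Prod.fst_add, Prod.smul_fst, ip_add_left, ip_smul_left, this]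
  module

lemma ambCoord_rotPair {a b : ℝ} (h : a ^ 2 + b ^ 2 = 1) (p : R2 n × R2 n) :
    ambCoord (rotPair a b p) = ambCoord p := by
  have h0 : (⟨a, b⟩ : ℂ) ≠ 0 := by
    intro h0
    have h1 : a = 0 := congrArg Complex.re h0
    have h2 : b = 0 := congrArg Complex.im h0
    rw [h1, h2] at h; norm_num at h
  ext j
  simp only [ambCoord, zeta_rot, zj_rot]
  exact mul_div_mul_left _ _ h0

lemma dCoord_rotPair {a b : ℝ} (h : a ^ 2 + b ^ 2 = 1) {p : R2 n × R2 n} (hp : zeta p ≠ 0)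
    (c : R2 n × R2 n) : dCoord (rotPair a b p) (rotPair a b c) = dCoord p c := by
  have h0 : zeta (rotPair a b p) ≠ 0 := by
    rw [zeta_rot]
    refine mul_ne_zero (fun h0 => ?_) hp
    have h1 : a = 0 := congrArg Complex.re h0
    have h2 : b = 0 := congrArg Complex.im h0
    rw [h1, h2] at h; norm_num at h
  have h1 : HasFDerivAt (fun q : R2 n × R2 n => ambCoord (rotL a b q))
      ((dCoord (rotPair a b p)).comp (rotL a b)) p :=
    HasFDerivAt.comp (g := ambCoord) p (by rw [rotL_apply]; exact hasFDerivAt_ambCoord h0)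
      (rotL a b).hasFDerivAt
  simp only [rotL_apply, ambCoord_rotPair h] at h1
  rw [← h1.unique (hasFDerivAt_ambCoord hp)]
  simp

/-! ### Smoothness of maps to and from the orbit space and the unit timelike bundle -/

lemma contMDiff_coord : ContMDiff (IT n) 𝓘(ℝ, EC n) ∞ (coord (n := n)) :=
  contMDiff_isOpenEmbedding isOpenEmbedding_coord

lemma extChartAt_TG_coe (τ : TG n) : (extChartAt (IT n) τ : TG n → EC n) = coord := by
  funext τ'
  simp only [mfld_simps]

lemma range_coord : range (coord (n := n)) = lieBall n := by
  ext w
  refine ⟨?_, fun hw => ⟨proj (sec ⟨w, hw⟩), preCoord_sec ⟨w, hw⟩⟩⟩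
  rintro ⟨τ, rfl⟩
  exact coord_mem τ

lemma extChartAt_TG_target (τ : TG n) : (extChartAt (IT n) τ).target = lieBall n := by
  simp only [mfld_simps]
  rw [← range_coord]

lemma coord_extChartAt_symm (τ : TG n) {w : EC n} (hw : w ∈ lieBall n) :
    coord ((extChartAt (IT n) τ).symm w) = w := by
  rw [← extChartAt_TG_coe τ]
  exact (extChartAt (IT n) τ).right_inv (by rwa [extChartAt_TG_target])

/-- The orbit space has the single chart `coord`, so its tangent spaces are `EC n` itself and the
differential of `coord` is the identity. This lets tangent vectors be used directly as elements of
`EC n`. -/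
lemma mfderiv_coord (τ : TG n) (ξ : TangentSpace (IT n) τ) :
    mfderiv (IT n) 𝓘(ℝ, EC n) coord τ ξ = ξ := by
  have h := mfderiv_chartAt_eq_tangentCoordChange (I := IT n) (mem_chart_source (EC n) τ)
  have h2 := tangentCoordChange_self (I := IT n) (x := τ) (z := τ) (v := ξ)
    (mem_extChartAt_source τ)
  rw [← h] at h2
  exact h2

/-- The charts of the bundle are those of the product transported by `bundleHomeo`, so this map
reads as the identity in charts. -/
lemma contMDiff_bundleHomeo :
    ContMDiff (IU n) ((IT n).prod (𝓡 1)) ∞ (bundleHomeo (n := n)) := by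
  intro p
  rw [contMDiffAt_iff_target]
  exact ⟨bundleHomeo.continuous.continuousAt, contMDiffAt_extChartAt (I := IU n) (x := p)⟩

lemma contMDiff_bundleHomeo_symm :
    ContMDiff ((IT n).prod (𝓡 1)) (IU n) ∞ (bundleHomeo (n := n)).symm := by
  intro a
  rw [contMDiffAt_iff_target]
  refine ⟨bundleHomeo.symm.continuous.continuousAt, ?_⟩
  have h : (extChartAt (IU n) (bundleHomeo.symm a) ∘ bundleHomeo.symm : TG n × Circle → _) =
      extChartAt ((IT n).prod (𝓡 1)) a := by
    funext b
    change extChartAt ((IT n).prod (𝓡 1)) (bundleHomeo (bundleHomeo.symm a))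
      (bundleHomeo (bundleHomeo.symm b)) = _
    rw [Homeomorph.apply_symm_apply, Homeomorph.apply_symm_apply]
  rw [h]
  exact contMDiffAt_extChartAt

/-- The section of the unit timelike bundle as a map to the ambient space. -/
def ambSec (w : EC n) : R2 n × R2 n := secPair (secR w) w

lemma contDiffAt_ambSec {w : EC n} (hw : w ∈ lieBall n) : ContDiffAt ℝ ∞ ambSec w := by
  have hq : ContDiff ℝ ∞ fun w : EC n => ∑ j, w j ^ 2 := by fun_prop
  have hre : ContDiff ℝ ∞ fun w : EC n => (∑ j, w j ^ 2).re :=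
    Complex.reCLM.contDiff.comp hq
  have him : ContDiff ℝ ∞ fun w : EC n => (∑ j, w j ^ 2).im :=
    Complex.imCLM.contDiff.comp hq
  have hrej : ∀ j, ContDiff ℝ ∞ fun w : EC n => (w j).re := fun j =>
    Complex.reCLM.contDiff.comp (by fun_prop)
  have himj : ∀ j, ContDiff ℝ ∞ fun w : EC n => (w j).im := fun j =>
    Complex.imCLM.contDiff.comp (by fun_prop)
  have hK : ContDiff ℝ ∞ fun w : EC n => 1 + ‖∑ j, w j ^ 2‖ ^ 2 - 2 * ∑ j, ‖w j‖ ^ 2 := by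
    have h2 : ContDiff ℝ ∞ fun w : EC n => ‖∑ j, w j ^ 2‖ ^ 2 := hq.norm_sq ℝ
    have h3 : ∀ j, ContDiff ℝ ∞ fun w : EC n => ‖w j‖ ^ 2 := fun j =>
      ContDiff.norm_sq ℝ (by fun_prop)
    have h4 : ContDiff ℝ ∞ fun w : EC n => ∑ j, ‖w j‖ ^ 2 := ContDiff.sum fun j _ => h3 j
    exact (contDiff_const.add h2).sub (contDiff_const.mul h4)
  have hR : ContDiffAt ℝ ∞ (secR : EC n → ℝ) w := by
    unfold secR
    exact contDiffAt_const.div (hK.contDiffAt.sqrt hw.2.ne') (Real.sqrt_pos.2 hw.2).ne'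
  unfold ambSec secPair
  refine ContDiffAt.prodMk (.prodMk ?_ (.prodMk ?_ ?_)) (.prodMk ?_ (.prodMk ?_ ?_))
  · exact (hR.mul (contDiffAt_const.add hre.contDiffAt)).div_const 2
  · exact (hR.mul him.contDiffAt).neg.div_const 2
  · exact contDiffAt_piLp' 2 fun j => hR.mul (hrej j).contDiffAt
  · exact (hR.mul him.contDiffAt).neg.div_const 2
  · exact (hR.mul (contDiffAt_const.sub hre.contDiffAt)).div_const 2
  · exact contDiffAt_piLp' 2 fun j => (hR.mul (himj j).contDiffAt).neg

lemma ambSec_mem {w : EC n} (hw : w ∈ lieBall n) : ambSec w ∈ unitSet n := secPair_mem hw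

lemma ambCoord_ambSec {w : EC n} (hw : w ∈ lieBall n) : ambCoord (ambSec w) = w :=
  preCoord_sec ⟨w, hw⟩

lemma contDiff_rotPair : ContDiff ℝ ∞ fun a : (ℝ × ℝ) × (R2 n × R2 n) =>
    rotPair a.1.1 a.1.2 a.2 := by
  unfold rotPair
  fun_prop

/-- Through `bundleHomeo` the inclusion becomes (τ, c) ↦ the rotation by c of `ambSec (coord τ)`, an
explicit smooth expression. -/
lemma contMDiff_incl : ContMDiff (IU n) 𝓘(ℝ, R2 n × R2 n) ∞ (incl (n := n)) := by
  have h : incl (n := n) = (fun a : TG n × Circle =>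
      rotPair (a.2 : ℂ).re (a.2 : ℂ).im (ambSec (coord a.1))) ∘ bundleHomeo := by
    funext p
    exact congrArg Subtype.val (bundleHomeo.symm_apply_apply p).symm
  rw [h]
  refine ContMDiff.comp (I' := (IT n).prod (𝓡 1)) ?_ contMDiff_bundleHomeo
  have hs : ContMDiff ((IT n).prod (𝓡 1)) 𝓘(ℝ, R2 n × R2 n) ∞
      fun a : TG n × Circle => ambSec (coord a.1) := fun a =>
    (contDiffAt_ambSec (coord_mem a.1)).contMDiffAt.comp a
      (contMDiff_coord.comp contMDiff_fst a)
  have hc : ContMDiff ((IT n).prod (𝓡 1)) 𝓘(ℝ, ℂ) ∞ fun a : TG n × Circle => (a.2 : ℂ) := by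
    have : Fact (Module.finrank ℝ ℂ = 1 + 1) := finrank_real_complex_fact'
    have h1 : ContMDiff (𝓡 1) 𝓘(ℝ, ℂ) ∞ (fun c : Circle => (c : ℂ)) :=
      contMDiff_coe_sphere (E := ℂ) (n := 1)
    exact h1.comp contMDiff_snd
  have hre := Complex.reCLM.contDiff.contMDiff.comp hc
  have him := Complex.imCLM.contDiff.contMDiff.comp hc
  exact contDiff_rotPair.contMDiff.comp ((hre.prodMk_space him).prodMk_space hs)

lemma isEmbedding_incl : IsEmbedding (incl (n := n)) := IsEmbedding.subtypeVal

section Maps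

variable {E : Type*} [NormedAddCommGroup E] [NormedSpace ℝ E]
  {H : Type*} [TopologicalSpace H] {I : ModelWithCorners ℝ E H}
  {M : Type*} [TopologicalSpace M] [ChartedSpace H M]

lemma contMDiff_TG {f : M → TG n} (hf : ContMDiff I 𝓘(ℝ, EC n) ∞ (coord ∘ f)) :
    ContMDiff I (IT n) ∞ f :=
  ContMDiff.of_comp_isOpenEmbedding isOpenEmbedding_coord hf

/-- A map to the unit timelike bundle is smooth if it is smooth as a map to the ambient space. -/
lemma contMDiff_UT [IsManifold I ∞ M] {f : M → UT n}
    (hf : ContMDiff I 𝓘(ℝ, R2 n × R2 n) ∞ (incl ∘ f)) : ContMDiff I (IU n) ∞ f := by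
  have h1 : ContMDiff I (IT n) ∞ fun m => proj (f m) := by
    refine contMDiff_TG (f := fun m => proj (f m)) fun m => ?_
    exact ContMDiffAt.comp (g := ambCoord) (f := incl ∘ f) m
      (contDiffAt_ambCoord (zeta_ne_zero (f m).2)).contMDiffAt (hf m)
  have hz : ContMDiff I 𝓘(ℝ, ℂ) ∞ fun m => zeta (incl (f m)) :=
    (zetaL n).contDiff.contMDiff.comp hf
  have h2 : ContMDiff I (𝓡 1) ∞ fun m => phase (f m) := by
    have : Fact (Module.finrank ℝ ℂ = 1 + 1) := finrank_real_complex_fact'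
    have h3 : ContMDiff I 𝓘(ℝ, ℂ) ∞ fun m => (phase (f m) : ℂ) := fun m => by
      have h0 : zeta (incl (f m)) ≠ 0 := zeta_ne_zero (f m).2
      -- The phase is z ↦ z / |z| evaluated at ζ, which never vanishes on the bundle.
      have h4 : ContDiffAt ℝ ∞ (fun z : ℂ => z * ((‖z‖ : ℂ))⁻¹) (zeta (incl (f m))) :=
        contDiffAt_id.mul ((Complex.ofRealCLM.contDiff.contDiffAt.comp _
          (contDiffAt_norm ℝ h0)).inv (by simpa using h0))
      exact ContMDiffAt.comp (f := fun m => zeta (incl (f m))) m h4.contMDiffAt (hz m)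
    exact ContMDiff.codRestrict_sphere (n := 1) h3 fun m => (phase (f m)).2
  have h3 := contMDiff_bundleHomeo_symm.comp (h1.prodMk h2)
  have h4 : f = bundleHomeo.symm ∘ fun m => (proj (f m), phase (f m)) :=
    funext fun m => (bundleHomeo.symm_apply_apply (f m)).symm
  rw [h4]
  exact h3

end Maps

lemma contMDiff_proj : ContMDiff (IU n) (IT n) ∞ (proj (n := n)) := contMDiff_TG fun p =>
  ((contDiffAt_ambCoord (zeta_ne_zero p.2)).contMDiffAt (x := incl p)).comp p (contMDiff_incl p)

lemma contMDiff_gsec : ContMDiff (IT n) (IU n) ∞ (gsec (n := n)) := contMDiff_UT fun τ =>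
  (contDiffAt_ambSec (coord_mem τ)).contMDiffAt.comp τ (contMDiff_coord τ)

lemma contMDiff_flow : ContMDiff (𝓘(ℝ, ℝ).prod (IU n)) (IU n) ∞
    fun a : ℝ × UT n => flow a.1 a.2 := by
  apply contMDiff_UT
  have h1 : ContMDiff (𝓘(ℝ, ℝ).prod (IU n)) 𝓘(ℝ, ℝ) ∞ fun a : ℝ × UT n => Real.cos a.1 :=
    Real.contDiff_cos.contMDiff.comp contMDiff_fst
  have h2 : ContMDiff (𝓘(ℝ, ℝ).prod (IU n)) 𝓘(ℝ, ℝ) ∞ fun a : ℝ × UT n => Real.sin a.1 :=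
    Real.contDiff_sin.contMDiff.comp contMDiff_fst
  exact contDiff_rotPair.contMDiff.comp
    ((h1.prodMk_space h2).prodMk_space (contMDiff_incl.comp contMDiff_snd))

/-! ### Tangent spaces -/

lemma mdifferentiableAt_incl (p : UT n) :
    MDifferentiableAt (IU n) 𝓘(ℝ, R2 n × R2 n) incl p :=
  contMDiff_incl.mdifferentiableAt (by simp)

lemma hasMFDerivAt_incl (p : UT n) :
    HasMFDerivAt (IU n) 𝓘(ℝ, R2 n × R2 n) incl p (comps p) :=
  (mdifferentiableAt_incl p).hasMFDerivAt

section Constraints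

variable {E : Type*} [NormedAddCommGroup E] [NormedSpace ℝ E]

lemma hasFDerivAt_ip {f g : E → R2 n} {f' g' : E →L[ℝ] R2 n} {u : E}
    (hf : HasFDerivAt f f' u) (hg : HasFDerivAt g g' u) :
    HasFDerivAt (fun u => ip (f u) (g u)) ((ipL (g u)).comp f' + (ipL (f u)).comp g') u := by
  have h := (ipB n).hasFDerivAt_of_bilinear hg hf
  refine h.congr_fderiv (ContinuousLinearMap.ext fun a => ?_)
  change ip (f' a) (g u) + ip (f u) (g' a) = ip (f' a) (g u) + ip (g' a) (f u)
  rw [ip_comm (f u)]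

lemma contDiff_ip : ContDiff ℝ ∞ fun q : R2 n × R2 n => ip q.1 q.2 :=
  ((ipB n).contDiff.comp contDiff_snd).clm_apply contDiff_fst

variable {H : Type*} [TopologicalSpace H] {I : ModelWithCorners ℝ E H}
  {M : Type*} [TopologicalSpace M] [ChartedSpace H M]

/-- The derivative of a map to the unit timelike bundle is tangent to it. -/
lemma mem_tanSpace_of_hasMFDerivAt {F : M → R2 n × R2 n} {m : M}
    {F' : TangentSpace I m →L[ℝ] R2 n × R2 n}
    (hF : HasMFDerivAt I 𝓘(ℝ, R2 n × R2 n) F m F') (h : ∀ᶠ m' in 𝓝 m, F m' ∈ unitSet n)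
    (v : TangentSpace I m) : F' v ∈ tanSpace (F m) := by
  -- Each defining equation says that ⟨f(F) | g(F)⟩ is locally constant, with f and g among the two
  -- projections; its derivative along v is then 0. The open condition on time orientation imposes
  -- nothing.
  have key : ∀ (f g : (R2 n × R2 n) →L[ℝ] R2 n) (c : ℝ),
      (∀ᶠ m' in 𝓝 m, ip (f (F m')) (g (F m')) = c) →
      ip (f (F' v)) (g (F m)) + ip (g (F' v)) (f (F m)) = 0 := by
    intro f g c hc
    have h1 := (hasFDerivAt_ip (f.hasFDerivAt (x := F m)) g.hasFDerivAt).hasMFDerivAt.comp m hF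
    have h2 : HasMFDerivAt I 𝓘(ℝ, ℝ) ((fun q => ip (f q) (g q)) ∘ F) m 0 :=
      (hasMFDerivAt_const c m).congr_of_eventuallyEq hc
    have h3 := congrArg (fun L => L v) (hasMFDerivAt_unique h1 h2)
    exact h3
  have h1 := key (.fst ℝ _ _) (.fst ℝ _ _) (-1) (h.mono fun m' h => h.1)
  have h2 := key (.snd ℝ _ _) (.snd ℝ _ _) (-1) (h.mono fun m' h => h.2.2.1)
  have h3 := key (.fst ℝ _ _) (.snd ℝ _ _) 0 (h.mono fun m' h => h.2.1)
  simp only [ContinuousLinearMap.coe_fst', ContinuousLinearMap.coe_snd'] at h1 h2 h3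
  refine ⟨?_, ?_, ?_⟩ <;> linarith

lemma mem_tanSpace_of_hasFDerivAt {F : E → R2 n × R2 n} {F' : E →L[ℝ] R2 n × R2 n} {u : E}
    (hF : HasFDerivAt F F' u) (h : ∀ᶠ u' in 𝓝 u, F u' ∈ unitSet n) (v : E) :
    F' v ∈ tanSpace (F u) :=
  mem_tanSpace_of_hasMFDerivAt hF.hasMFDerivAt h v

end Constraints

lemma comps_mem (p : UT n) (v : TangentSpace (IU n) p) : comps p v ∈ tanSpace p.1 :=
  mem_tanSpace_of_hasMFDerivAt (hasMFDerivAt_incl p) (Eventually.of_forall fun q => q.2) v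

/-- The differential of `coord ∘ proj = ambCoord ∘ incl`, where the differential of `coord` is the
identity. -/
lemma dproj_eq (p : UT n) (v : TangentSpace (IU n) p) :
    dproj p v = dCoord p.1 (comps p v) := by
  have h1 : HasMFDerivAt (IU n) 𝓘(ℝ, EC n) (coord ∘ proj) p
      ((mfderiv (IT n) 𝓘(ℝ, EC n) coord (proj p)).comp (dproj p)) :=
    (contMDiff_coord.mdifferentiableAt (by simp)).hasMFDerivAt.comp p
      (contMDiff_proj.mdifferentiableAt (by simp)).hasMFDerivAt
  have h2 : HasMFDerivAt (IU n) 𝓘(ℝ, EC n) (ambCoord ∘ incl) p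
      ((dCoord p.1).comp (comps p)) :=
    (hasFDerivAt_ambCoord (zeta_ne_zero p.2)).hasMFDerivAt.comp p (hasMFDerivAt_incl p)
  have h3 := congrArg (fun L => L v) (hasMFDerivAt_unique h1 h2)
  exact (mfderiv_coord _ _).symm.trans h3

section Maps

variable {E : Type*} [NormedAddCommGroup E] [NormedSpace ℝ E]
  {H : Type*} [TopologicalSpace H] {I : ModelWithCorners ℝ E H}
  {M : Type*} [TopologicalSpace M] [ChartedSpace H M]

lemma comps_mfderiv {f : M → UT n} {m : M} (hf : MDifferentiableAt I (IU n) f m)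
    (v : TangentSpace I m) :
    comps (f m) (mfderiv I (IU n) f m v) = mfderiv I 𝓘(ℝ, R2 n × R2 n) (incl ∘ f) m v := by
  rw [mfderiv_comp m (mdifferentiableAt_incl _) hf]
  rfl

lemma dproj_mfderiv {f : M → UT n} {m : M} (hf : MDifferentiableAt I (IU n) f m)
    (v : TangentSpace I m) :
    dproj (f m) (mfderiv I (IU n) f m v) = mfderiv I (IT n) (proj ∘ f) m v := by
  rw [mfderiv_comp m (contMDiff_proj.mdifferentiableAt (by simp)) hf]
  rfl

end Maps

lemma hasDerivAt_rotPair (p : R2 n × R2 n) (t : ℝ) :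
    HasDerivAt (fun s : ℝ => rotPair (Real.cos s) (Real.sin s) p)
      (reeb (rotPair (Real.cos t) (Real.sin t) p)) t := by
  have h1 := (Real.hasDerivAt_cos t).smul_const p.1
  have h2 := (Real.hasDerivAt_sin t).smul_const p.2
  have h3 := (Real.hasDerivAt_sin t).neg.smul_const p.1
  have h4 := (Real.hasDerivAt_cos t).smul_const p.2
  refine ((h1.add h2).prodMk (h3.add h4)).congr_deriv ?_
  simp only [reeb, rotPair]
  ext <;> simp <;> ring

lemma fderiv_ambSec_mem {w : EC n} (hw : w ∈ lieBall n) (ξ : EC n) :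
    fderiv ℝ ambSec w ξ ∈ tanSpace (ambSec w) :=
  mem_tanSpace_of_hasFDerivAt ((contDiffAt_ambSec hw).differentiableAt (by simp)).hasFDerivAt
    (mem_of_superset (isOpen_lieBall.mem_nhds hw) fun _ h => ambSec_mem h) ξ

lemma dCoord_fderiv_ambSec {w : EC n} (hw : w ∈ lieBall n) (ξ : EC n) :
    dCoord (ambSec w) (fderiv ℝ ambSec w ξ) = ξ := by
  have h1 := (hasFDerivAt_ambCoord (zeta_ne_zero (ambSec_mem hw))).comp w
    ((contDiffAt_ambSec hw).differentiableAt (by simp)).hasFDerivAt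
  have h2 : ambCoord ∘ ambSec =ᶠ[𝓝 w] (id : EC n → EC n) := by
    filter_upwards [isOpen_lieBall.mem_nhds hw] with w' hw' using ambCoord_ambSec hw'
  exact congrArg (fun L => L ξ) (h1.unique ((hasFDerivAt_id w).congr_of_eventuallyEq h2))

lemma exists_flow_gsec (p : UT n) : ∃ t : ℝ, flow t (gsec (proj p)) = p :=
  Quotient.exact (proj_gsec (proj p))

lemma incl_flow (t : ℝ) :
    incl ∘ flow t = rotL (Real.cos t) (Real.sin t) ∘ incl (n := n) := by
  funext q; simp [incl, flow]

lemma contMDiff_flow_right (t : ℝ) : ContMDiff (IU n) (IU n) ∞ (flow (n := n) t) := by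
  apply contMDiff_UT
  rw [incl_flow]
  exact (rotL _ _).contDiff.contMDiff.comp contMDiff_incl

lemma contMDiff_flow_left (p : UT n) : ContMDiff 𝓘(ℝ, ℝ) (IU n) ∞ fun t => flow t p := by
  apply contMDiff_UT
  exact (contDiff_rotPair.comp ((Real.contDiff_cos.prodMk Real.contDiff_sin).prodMk
    contDiff_const)).contMDiff

lemma comps_mfderiv_flow_left (p : UT n) (t : ℝ) :
    comps (flow t p) (mfderiv 𝓘(ℝ, ℝ) (IU n) (fun t => flow t p) t (1 : ℝ)) =
      reeb (flow t p).1 := by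
  refine (comps_mfderiv (f := fun t => flow t p)
    ((contMDiff_flow_left p).mdifferentiableAt (by simp)) _).trans ?_
  rw [mfderiv_eq_fderiv]
  exact (hasDerivAt_rotPair p.1 t).deriv

lemma comps_flowField (p : UT n) : comps p (flowField p) = reeb p.1 := by
  -- The velocity at time 0 lives at `flow 0 p`, which equals p only propositionally, so the base
  -- point is generalized before substitution.
  have key : ∀ q (h : q = p) (v : TangentSpace (IU n) q), comps q v = reeb q.1 →
      comps p v = reeb p.1 := by
    rintro q rfl v h; exact h
  exact key _ (flow_zero p) _ (comps_mfderiv_flow_left p 0)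

lemma comps_mfderiv_flow (t : ℝ) (p : UT n) (v : TangentSpace (IU n) p) :
    comps (flow t p) (mfderiv (IU n) (IU n) (flow t) p v) =
      rotPair (Real.cos t) (Real.sin t) (comps p v) := by
  rw [comps_mfderiv ((contMDiff_flow_right t).mdifferentiableAt (by simp))]
  have h1 : HasMFDerivAt (IU n) 𝓘(ℝ, R2 n × R2 n) (rotL (Real.cos t) (Real.sin t) ∘ incl) p
      ((rotL (Real.cos t) (Real.sin t)).comp (comps p)) :=
    (rotL _ _).hasFDerivAt.hasMFDerivAt.comp p (hasMFDerivAt_incl p)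
  rw [incl_flow, h1.mfderiv]
  exact rotL_apply _ _ _

lemma comps_mfderiv_gsec (τ : TG n) (ξ : TangentSpace (IT n) τ) :
    comps (gsec τ) (mfderiv (IT n) (IU n) gsec τ ξ) = fderiv ℝ ambSec (coord τ) ξ := by
  rw [comps_mfderiv (contMDiff_gsec.mdifferentiableAt (by simp))]
  have h1 : HasMFDerivAt (IT n) 𝓘(ℝ, R2 n × R2 n) (ambSec ∘ coord) τ
      ((fderiv ℝ ambSec (coord τ)).comp (mfderiv (IT n) 𝓘(ℝ, EC n) coord τ)) :=
    ((contDiffAt_ambSec (coord_mem τ)).differentiableAt (by simp)).hasFDerivAt.hasMFDerivAt.comp τ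
      (contMDiff_coord.mdifferentiableAt (by simp)).hasMFDerivAt
  have h2 : incl ∘ gsec = ambSec ∘ coord (n := n) := rfl
  rw [h2, h1.mfderiv]
  exact congrArg _ (mfderiv_coord τ ξ)

/-- Up to the flow, p lies on the global section. The image of a under `dCoord` is realized by a
tangent vector of the rotated section; what remains of a is killed by `dCoord`, hence is a multiple
of the flow field. -/
lemma exists_comps_eq (p : UT n) {a : R2 n × R2 n} (ha : a ∈ tanSpace p.1) :
    ∃ v : TangentSpace (IU n) p, comps p v = a := by
  obtain ⟨t, ht⟩ := exists_flow_gsec p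
  generalize proj p = τ at ht
  subst ht
  have h1 := Real.cos_sq_add_sin_sq t
  let ξ : TangentSpace (IT n) τ := dCoord (flow t (gsec τ)).1 a
  set v := mfderiv (IU n) (IU n) (flow t) (gsec τ) (mfderiv (IT n) (IU n) gsec τ ξ) with hv
  have e1 : comps (flow t (gsec τ)) v = rotPair (Real.cos t) (Real.sin t)
      (fderiv ℝ ambSec (coord τ) (dCoord (flow t (gsec τ)).1 a)) := by
    rw [hv, comps_mfderiv_flow, comps_mfderiv_gsec τ ξ]
  have e2 : dCoord (flow t (gsec τ)).1 (comps (flow t (gsec τ)) v) =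
      dCoord (flow t (gsec τ)).1 a := by
    rw [e1]
    refine (dCoord_rotPair h1 (zeta_ne_zero (gsec τ).2) _).trans ?_
    exact dCoord_fderiv_ambSec (coord_mem τ) _
  obtain ⟨c, hc⟩ := eq_smul_reeb (flow t (gsec τ)).2 (sub_mem ha (comps_mem _ v))
    (by rw [map_sub, e2, sub_self])
  refine ⟨v + c • flowField _, ?_⟩
  rw [map_add, map_smul, comps_flowField, ← hc]
  abel

lemma exists_tanSpace_eq {p : R2 n × R2 n} (hp : p ∈ unitSet n) (ξ : EC n) :
    ∃ a ∈ tanSpace p, ip a.1 p.2 = 0 ∧ dCoord p a = ξ := by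
  obtain ⟨t, ht⟩ := exists_flow_gsec ⟨p, hp⟩
  have h1 := Real.cos_sq_add_sin_sq t
  set τ := proj ⟨p, hp⟩
  have e1 : rotPair (Real.cos t) (Real.sin t) (gsec τ).1 = p := congrArg Subtype.val ht
  set a := rotPair (Real.cos t) (Real.sin t) (fderiv ℝ ambSec (coord τ) ξ)
  have ha : a ∈ tanSpace p := by
    rw [← e1]; exact rotPair_tanSpace (fderiv_ambSec_mem (coord_mem τ) ξ)
  refine ⟨hor p a, hor_mem hp ha, hor_orth hp a, ?_⟩
  rw [dCoord_hor (zeta_ne_zero hp), ← e1]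
  exact (dCoord_rotPair h1 (zeta_ne_zero (gsec τ).2) _).trans (dCoord_fderiv_ambSec (coord_mem τ) ξ)

/-- A dimension count replaces a computation in charts. The map v ↦ (dπ v, ⟨ẋ|y⟩) factors through
`comps` and is onto a space of dimension 2n + 1, the dimension of the tangent space, so it is
injective. -/
lemma comps_injective (p : UT n) : Function.Injective (comps p) := by
  let L : TangentSpace (IU n) p →ₗ[ℝ] EC n × ℝ := LinearMap.prod
    ((dCoord p.1).comp (comps p)).toLinearMap
    ((ipL p.1.2).comp ((ContinuousLinearMap.fst ℝ (R2 n) (R2 n)).comp (comps p))).toLinearMap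
  have hfr : Module.finrank ℝ (TangentSpace (IU n) p) = Module.finrank ℝ (EC n × ℝ) := by
    change Module.finrank ℝ (EC n × EuclideanSpace ℝ (Fin 1)) = _
    simp [Module.finrank_prod]
  have hfin : FiniteDimensional ℝ (TangentSpace (IU n) p) :=
    inferInstanceAs (FiniteDimensional ℝ (EC n × EuclideanSpace ℝ (Fin 1)))
  have hs : Function.Surjective L := by
    rintro ⟨ξ, c⟩
    obtain ⟨a, ha, ha1, ha2⟩ := exists_tanSpace_eq p.2 ξ
    obtain ⟨v, hv⟩ := exists_comps_eq p ha
    refine ⟨v - c • flowField p, ?_⟩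
    have h1 : comps p (v - c • flowField p) = a - c • reeb p.1 := by
      rw [map_sub, map_smul, hv, comps_flowField]
    refine Prod.ext ?_ ?_
    · change dCoord p.1 (comps p (v - c • flowField p)) = ξ
      rw [h1, map_sub, map_smul, dCoord_reeb (zeta_ne_zero p.2), ha2, smul_zero, sub_zero]
    · change ip (comps p (v - c • flowField p)).1 p.1.2 = c
      rw [h1]
      have : ip (reeb p.1).1 p.1.2 = -1 := p.2.2.2.1
      simp only [Prod.fst_sub, Prod.smul_fst, ip_sub_left, ip_smul_left, ha1, this]
      ring
  have hi := (LinearMap.injective_iff_surjective_of_finrank_eq_finrank hfr).2 hs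
  intro v w hvw
  apply hi
  change ((dCoord p.1 (comps p v), ip (comps p v).1 p.1.2) : EC n × ℝ) =
    (dCoord p.1 (comps p w), ip (comps p w).1 p.1.2)
  rw [hvw]

lemma range_comps (p : UT n) : range (comps p) = tanSpace p.1 := by
  ext a
  refine ⟨?_, fun ha => exists_comps_eq p ha⟩
  rintro ⟨v, rfl⟩
  exact comps_mem p v

/-! ### Orbits and timelike geodesics -/

lemma exists_cos_sin {a b : ℝ} (h : a ^ 2 + b ^ 2 = 1) :
    ∃ t : ℝ, Real.cos t = a ∧ Real.sin t = b := by
  have hn : ‖(⟨a, b⟩ : ℂ)‖ = 1 := by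
    have h1 : ‖(⟨a, b⟩ : ℂ)‖ ^ 2 = 1 := by
      rw [← Complex.normSq_eq_norm_sq, Complex.normSq_mk, ← h]; ring
    nlinarith [norm_nonneg (⟨a, b⟩ : ℂ)]
  have h0 : (⟨a, b⟩ : ℂ) ≠ 0 := by
    intro h0; rw [h0, norm_zero] at hn; norm_num at hn
  exact ⟨Complex.arg ⟨a, b⟩, by rw [Complex.cos_arg h0, hn, div_one],
    by rw [Complex.sin_arg, hn, div_one]⟩

lemma proj_eq_proj_iff {p q : UT n} : proj p = proj q ↔ ∃ t, flow t p = q := Quotient.eq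

lemma proj_flow (t : ℝ) (p : UT n) : proj (flow t p) = proj p :=
  (proj_eq_proj_iff.2 ⟨t, rfl⟩).symm

lemma mem_geodesicOf_proj {p : UT n} {x : R2 n} :
    x ∈ geodesicOf (proj p) ↔ ∃ t, (flow t p).1.1 = x := by
  constructor
  · rintro ⟨q, hq, rfl⟩
    obtain ⟨t, rfl⟩ := proj_eq_proj_iff.1 hq.symm
    exact ⟨t, rfl⟩
  · rintro ⟨t, rfl⟩
    exact ⟨flow t p, proj_flow t p, rfl⟩

lemma exists_proj_eq (τ : TG n) : ∃ p : UT n, proj p = τ := ⟨_, proj_gsec τ⟩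

/-- Since x, y are orthogonal of square -1, a x + b y lies in anti-de Sitter space exactly when a² +
b² = 1, that is, when it is the base point of a rotated pair. -/
lemma geodesicOf_proj (p : UT n) :
    geodesicOf (proj p) = AdS n ∩ (Submodule.span ℝ {p.1.1, p.1.2} : Submodule ℝ (R2 n)) := by
  ext x
  rw [mem_geodesicOf_proj]
  constructor
  · rintro ⟨t, rfl⟩
    exact ⟨(flow t p).2.1, Submodule.mem_span_pair.2 ⟨_, _, rfl⟩⟩
  · rintro ⟨hx, hx2⟩
    obtain ⟨a, b, rfl⟩ := Submodule.mem_span_pair.1 hx2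
    have hx : ip (a • p.1.1 + b • p.1.2) (a • p.1.1 + b • p.1.2) = -1 := hx
    rw [ip_comb, unitSet_fst p.2, p.2.2.1, p.2.2.2.1] at hx
    obtain ⟨t, rfl, rfl⟩ := exists_cos_sin (a := a) (b := b) (by linarith)
    exact ⟨t, rfl⟩

/-- After moving p along its orbit the two pairs share their base point x. The second vectors are
then unit vectors orthogonal to x in the same plane, hence equal up to sign, and the time
orientation fixes the sign. -/
lemma geodesicOf_injective : Function.Injective (geodesicOf (n := n)) := by
  intro τ τ' h
  obtain ⟨p, rfl⟩ := exists_proj_eq τ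
  obtain ⟨p', rfl⟩ := exists_proj_eq τ'
  obtain ⟨t, ht⟩ : ∃ t, (flow t p).1.1 = p'.1.1 := by
    rw [← mem_geodesicOf_proj, h]; exact ⟨p', rfl, rfl⟩
  rw [← proj_flow t p] at h ⊢
  set q := flow t p
  have h2 : p'.1.2 ∈ geodesicOf (proj q) := by
    rw [h, mem_geodesicOf_proj]
    -- A quarter turn brings y to the base point.
    exact ⟨Real.pi / 2, by simp [flow, rotPair]⟩
  rw [geodesicOf_proj] at h2
  obtain ⟨a, b, hab⟩ := Submodule.mem_span_pair.1 h2.2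
  have o1 := unitSet_fst q.2
  have o2 := q.2.2.1
  have o3 := q.2.2.2.1
  have o4 := q.2.2.2.2
  have q2 := p'.2.2.1
  have q3 := p'.2.2.2.1
  have q4 := p'.2.2.2.2
  rw [← ht, ← hab, ip_add_right, ip_smul_right, ip_smul_right, o1, o2] at q2
  have a0 : a = 0 := by linarith
  rw [a0, zero_smul, zero_add] at hab
  rw [← hab, ip_smul_left, ip_smul_right, o3] at q3
  rw [← hab, ← ht, ip_smul_left] at q4
  -- The norm gives b² = 1, and b = -1 would reverse the time orientation.
  have b1 : b = 1 := by nlinarith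
  rw [b1, one_smul] at hab
  congr 1
  exact Subtype.ext (Prod.ext ht hab)

lemma exists_normalize {v : R2 n} (hv : ip v v < 0) : ∃ c : ℝ, 0 < c ∧ ip (c • v) (c • v) = -1 := by
  have h : 0 < √(-ip v v) := Real.sqrt_pos.2 (by linarith)
  refine ⟨(√(-ip v v))⁻¹, inv_pos.2 h, ?_⟩
  have h2 : √(-ip v v) ^ 2 = -ip v v := Real.sq_sqrt (by linarith)
  rw [ip_smul_left, ip_smul_right]
  field_simp
  rw [h2]; ring

lemma linearIndependent_pair {p : R2 n × R2 n} (hp : p ∈ unitSet n) :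
    LinearIndependent ℝ ![p.1, p.2] := by
  rw [LinearIndependent.pair_iff]
  intro s t h
  have h1 := congrArg (fun v => ip v p.1) h
  have h2 := congrArg (fun v => ip v p.2) h
  simp only [ip_add_left, ip_smul_left, unitSet_fst hp, hp.2.1, ip_comm p.2 p.1, hp.2.2.1,
    ip_zero_left] at h1 h2
  constructor <;> linarith

lemma finrank_span_pair {p : R2 n × R2 n} (hp : p ∈ unitSet n) :
    Module.finrank ℝ (Submodule.span ℝ {p.1, p.2} : Submodule ℝ (R2 n)) = 2 := by
  have h := finrank_span_eq_card (linearIndependent_pair hp)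
  rwa [Matrix.range_cons, Matrix.range_cons, Matrix.range_empty, union_empty,
    singleton_union, Fintype.card_fin] at h

lemma isTimelikeGeodesic_geodesicOf (τ : TG n) : IsTimelikeGeodesic (geodesicOf τ) := by
  obtain ⟨p, rfl⟩ := exists_proj_eq τ
  refine ⟨Submodule.span ℝ {p.1.1, p.1.2}, finrank_span_pair p.2, ?_, geodesicOf_proj p⟩
  intro v hv hv0
  obtain ⟨a, b, rfl⟩ := Submodule.mem_span_pair.1 hv
  rw [ip_comb, unitSet_fst p.2, p.2.2.1, p.2.2.2.1]
  by_contra hneg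
  have ha : a = 0 := by nlinarith [sq_nonneg a, sq_nonneg b]
  have hb : b = 0 := by nlinarith [sq_nonneg a, sq_nonneg b]
  simp [ha, hb] at hv0

/-- Gram–Schmidt in the negative plane gives an orthogonal pair of square -1, and replacing y by -y
if needed makes it future oriented. -/
lemma exists_geodesicOf_eq {γ : Set (R2 n)} (hγ : IsTimelikeGeodesic γ) :
    ∃ τ : TG n, geodesicOf τ = γ := by
  obtain ⟨P, hP, hneg, rfl⟩ := hγ
  have hne : P ≠ ⊥ := by rintro rfl; simp at hP
  obtain ⟨v, hv, hv0⟩ := P.ne_bot_iff.1 hne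
  obtain ⟨c, hc, hx⟩ := exists_normalize (hneg v hv hv0)
  set x := c • v
  have hxP : x ∈ P := P.smul_mem _ hv
  obtain ⟨w, hw, hwx⟩ : ∃ w ∈ P, w ∉ Submodule.span ℝ {x} := by
    by_contra! hcon
    have h1 : P ≤ Submodule.span ℝ {x} := hcon
    have h2 := Submodule.finrank_mono h1
    have h3 := finrank_span_le_card (R := ℝ) ({x} : Set (R2 n))
    simp at h3
    omega
  -- The orthogonal projection has a plus sign because ⟨x|x⟩ = -1.
  have hw2 : w + ip w x • x ∈ P := P.add_mem hw (P.smul_mem _ hxP)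
  have hw0 : w + ip w x • x ≠ 0 := by
    intro h0
    apply hwx
    rw [eq_neg_of_add_eq_zero_left h0]
    exact neg_mem (Submodule.smul_mem _ _ (Submodule.mem_span_singleton_self x))
  obtain ⟨d, hd, hy⟩ := exists_normalize (hneg _ hw2 hw0)
  set y := d • (w + ip w x • x)
  have hyP : y ∈ P := P.smul_mem _ hw2
  have hxy : ip x y = 0 := by
    simp only [y, ip_smul_right, ip_add_right, hx, ip_comm x w]; ring
  have key : ∀ y' ∈ P, (x, y') ∈ unitSet n → ∃ τ : TG n, geodesicOf τ = AdS n ∩ P := by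
    intro y' hy' hm
    refine ⟨proj ⟨(x, y'), hm⟩, ?_⟩
    rw [geodesicOf_proj]
    congr 2
    apply Submodule.eq_of_le_of_finrank_eq
    · rw [Submodule.span_le]
      rintro z (rfl | rfl)
      exacts [hxP, hy']
    · rw [hP]; exact finrank_span_pair hm
  rcases mem_unitSet_or hx hy hxy with h | h
  exacts [key y hyP h, key _ (P.neg_mem hyP) h]

lemma range_geodesicOf :
    range (geodesicOf (n := n)) = {γ : Set (R2 n) | IsTimelikeGeodesic γ} := by
  ext γ
  constructor
  · rintro ⟨τ, rfl⟩; exact isTimelikeGeodesic_geodesicOf τ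
  · exact fun h => exists_geodesicOf_eq h

/-! ### The Liouville form and the symplectic form -/

/-- The Liouville form on the ambient space. -/
def ambLiouville (q : R2 n × R2 n) : (R2 n × R2 n) [⋀^Fin 1]→L[ℝ] ℝ :=
  ContinuousAlternatingMap.ofSubsingleton ℝ (R2 n × R2 n) ℝ (0 : Fin 1)
    (-((ipL q.2).comp (ContinuousLinearMap.fst ℝ (R2 n) (R2 n))))

lemma ambLiouville_apply (q : R2 n × R2 n) (v : Fin 1 → R2 n × R2 n) :
    ambLiouville q v = -ip (v 0).1 q.2 := rfl

lemma contDiff_ambLiouville : ContDiff ℝ ∞ (ambLiouville (n := n)) := by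
  have h1 : ContDiff ℝ ∞ fun q : R2 n × R2 n =>
      -((ipB n q.2).comp (ContinuousLinearMap.fst ℝ (R2 n) (R2 n))) :=
    (((ipB n).contDiff.comp contDiff_snd).clm_comp contDiff_const).neg
  exact (ContinuousAlternatingMap.ofSubsingletonLIE (𝕜 := ℝ) (E := R2 n × R2 n) (F := ℝ)
    (0 : Fin 1)).toContinuousLinearEquiv.contDiff.comp h1

lemma extDeriv_ambLiouville (q a b : R2 n × R2 n) :
    extDeriv ambLiouville q ![a, b] = sympl a b := by
  rw [extDeriv_apply (contDiff_ambLiouville.differentiable (by simp) q)]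
  have key : ∀ c d : R2 n × R2 n,
      fderiv ℝ (fun q : R2 n × R2 n => -ip c.1 q.2) q d = -ip c.1 d.2 := by
    intro c d
    have h : HasFDerivAt (fun q : R2 n × R2 n => -ip c.1 q.2) _ q :=
      (hasFDerivAt_ip (hasFDerivAt_const c.1 q) (hasFDerivAt_snd (p := q))).neg
    rw [h.fderiv]
    simp [ip_comm]
  refine (Fin.sum_univ_two _).trans ?_
  have e0 : Fin.removeNth (0 : Fin 2) ![a, b] 0 = b := rfl
  have e1 : Fin.removeNth (1 : Fin 2) ![a, b] 0 = a := rfl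
  simp only [ambLiouville_apply, e0, e1, key]
  simp [sympl, ip_comm b.1]
  ring

lemma minSmoothness_two_le : minSmoothness ℝ 2 ≤ ∞ := by
  simpa using (ENat.LEInfty.out : (2 : ℕ∞ω) ≤ ∞)

section Pullback

variable {E : Type*} [NormedAddCommGroup E] [NormedSpace ℝ E]

/-- The pullback of the Liouville form by a map from a vector space to the ambient space. -/
def pullLiouville (F : E → R2 n × R2 n) (u : E) : E [⋀^Fin 1]→L[ℝ] ℝ :=
  (ambLiouville (F u)).compContinuousLinearMap (fderiv ℝ F u)

lemma contDiffAt_pullLiouville {F : E → R2 n × R2 n} {u : E} (hF : ContDiffAt ℝ ∞ F u) :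
    ContDiffAt ℝ ∞ (pullLiouville F) u := by
  have h1 : ContDiffAt ℝ ∞ (fun u => -((ipB n (F u).2).comp
      ((ContinuousLinearMap.fst ℝ (R2 n) (R2 n)).comp (fderiv ℝ F u)))) u :=
    (((ipB n).contDiff.contDiffAt.comp u hF.snd).clm_comp
      (contDiffAt_const.clm_comp (hF.fderiv_right (by simp)))).neg
  exact (ContinuousAlternatingMap.ofSubsingletonLIE (𝕜 := ℝ) (E := E) (F := ℝ)
    (0 : Fin 1)).toContinuousLinearEquiv.contDiff.contDiffAt.comp u h1

/-- The exterior derivative commutes with pullback, so derivatives of λ in any parametrization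
reduce to the constant form `sympl`. -/
lemma extDeriv_pullLiouville {F : E → R2 n × R2 n} {u : E} (hF : ContDiffAt ℝ ∞ F u) (v w : E) :
    extDeriv (pullLiouville F) u ![v, w] = sympl (fderiv ℝ F u v) (fderiv ℝ F u w) := by
  rw [← extDeriv_ambLiouville]
  have h := extDeriv_pullback (contDiff_ambLiouville.differentiable (by simp) (F u)) hF
    minSmoothness_two_le
  refine (congrArg (fun L => L ![v, w]) h).trans ?_
  change extDeriv ambLiouville (F u) (fderiv ℝ F u ∘ ![v, w]) = _
  congr 1
  ext1 i
  fin_cases i <;> rfl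

end Pullback

lemma liouville_apply (p : UT n) (v : TangentSpace (IU n) p) :
    liouville n p ![v] = -ip (comps p v).1 p.1.2 := rfl

lemma contDiffOn_incl_extChartAt_symm (p : UT n) :
    ContDiffOn ℝ ∞ (incl ∘ (extChartAt (IU n) p).symm) (extChartAt (IU n) p).target :=
  (contMDiff_incl.comp_contMDiffOn (contMDiffOn_extChartAt_symm p)).contDiffOn

lemma isOpen_extChartAt_UT_target (p : UT n) : IsOpen (extChartAt (IU n) p).target :=
  isOpen_extChartAt_target p

lemma fderiv_incl_extChartAt_symm (p : UT n) {u : EC n × EuclideanSpace ℝ (Fin 1)}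
    (hu : u ∈ (extChartAt (IU n) p).target) :
    fderiv ℝ (incl ∘ (extChartAt (IU n) p).symm) u =
      (comps ((extChartAt (IU n) p).symm u)).comp
        (mfderiv 𝓘(ℝ, EC n × EuclideanSpace ℝ (Fin 1)) (IU n) (extChartAt (IU n) p).symm u) := by
  have h1 : MDifferentiableAt 𝓘(ℝ, EC n × EuclideanSpace ℝ (Fin 1)) (IU n)
      (extChartAt (IU n) p).symm u :=
    ((contMDiffOn_extChartAt_symm (n := ∞) p).contMDiffAt
      ((isOpen_extChartAt_UT_target p).mem_nhds hu)).mdifferentiableAt (by simp)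
  rw [← mfderiv_eq_fderiv, mfderiv_comp u (mdifferentiableAt_incl _) h1]
  rfl

lemma liouville_inChart (p : UT n) {u : EC n × EuclideanSpace ℝ (Fin 1)}
    (hu : u ∈ (extChartAt (IU n) p).target) :
    (liouville n).inChart p u = pullLiouville (incl ∘ (extChartAt (IU n) p).symm) u := by
  rw [pullLiouville, fderiv_incl_extChartAt_symm p hu]
  rfl

lemma isSmooth_liouville : (liouville n).IsSmooth := by
  intro p
  have h : ContDiffOn ℝ ∞ (pullLiouville (incl ∘ (extChartAt (IU n) p).symm))
      (extChartAt (IU n) p).target := fun u hu =>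
    (contDiffAt_pullLiouville ((contDiffOn_incl_extChartAt_symm p).contDiffAt
      ((isOpen_extChartAt_UT_target p).mem_nhds hu))).contDiffWithinAt
  exact h.congr fun u hu => liouville_inChart p hu

/-- In a chart λ is the ambient form pulled back by the parametrization F = incl ∘ chart⁻¹, and dF
composed with the differential of the chart is `comps`. -/
lemma d_liouville_apply (p : UT n) (v w : TangentSpace (IU n) p) :
    (liouville n).d p ![v, w] = sympl (comps p v) (comps p w) := by
  set F := incl ∘ (extChartAt (IU n) p).symm with hF
  set u := extChartAt (IU n) p p with hu
  set D : TangentSpace (IU n) p →L[ℝ] EC n × EuclideanSpace ℝ (Fin 1) :=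
    mfderiv (IU n) 𝓘(ℝ, EC n × EuclideanSpace ℝ (Fin 1)) (extChartAt (IU n) p) p with hD
  have hmem : u ∈ (extChartAt (IU n) p).target := mem_extChartAt_target p
  have hnhds := (isOpen_extChartAt_UT_target p).mem_nhds hmem
  have h1 : (liouville n).inChart p =ᶠ[𝓝 u] pullLiouville F := by
    filter_upwards [hnhds] with u' hu' using liouville_inChart p hu'
  have hFs : ContDiffAt ℝ ∞ F u := (contDiffOn_incl_extChartAt_symm p).contDiffAt hnhds
  have h2 : ∀ v, fderiv ℝ F u (D v) = comps p v := by
    intro v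
    have h3 : HasMFDerivAt (IU n) 𝓘(ℝ, R2 n × R2 n) (F ∘ extChartAt (IU n) p) p
        ((fderiv ℝ F u).comp D) :=
      (hFs.differentiableAt (by simp)).hasFDerivAt.hasMFDerivAt.comp p
        (mdifferentiableAt_extChartAt (mem_chart_source _ p)).hasMFDerivAt
    have h4 : F ∘ extChartAt (IU n) p =ᶠ[𝓝 p] incl := by
      filter_upwards [extChartAt_source_mem_nhds (I := IU n) p] with q hq
      exact congrArg incl ((extChartAt (IU n) p).left_inv hq)
    exact congrArg (fun L => L v)
      (hasMFDerivAt_unique (h3.congr_of_eventuallyEq h4.symm) (hasMFDerivAt_incl p))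
  rw [← h2 v, ← h2 w, ← extDeriv_pullLiouville hFs, ← h1.extDeriv_eq]
  change extDeriv ((liouville n).inChart p) u (D ∘ ![v, w]) = _
  congr 1
  ext1 i
  fin_cases i <;> rfl

variable (n) in
/-- The symplectic form of the orbit space. -/
def symplTG : DForm (IT n) (TG n) 2 := fun τ => extDeriv (pullLiouville ambSec) (coord τ)

lemma symplTG_apply (τ : TG n) (ξ ξ' : TangentSpace (IT n) τ) :
    symplTG n τ ![ξ, ξ'] =
      sympl (fderiv ℝ ambSec (coord τ) ξ) (fderiv ℝ ambSec (coord τ) ξ') :=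
  extDeriv_pullLiouville (contDiffAt_ambSec (coord_mem τ)) ξ ξ'

lemma mfderiv_extChartAt_TG_symm (τ : TG n) {w : EC n} (hw : w ∈ lieBall n) (ξ : EC n) :
    mfderiv 𝓘(ℝ, EC n) (IT n) (extChartAt (IT n) τ).symm w ξ = ξ := by
  have hw' : w ∈ (extChartAt (IT n) τ).target := by rwa [extChartAt_TG_target]
  have h1 : MDifferentiableAt 𝓘(ℝ, EC n) (IT n) (extChartAt (IT n) τ).symm w :=
    ((contMDiffOn_extChartAt_symm (n := ∞) τ).contMDiffAt
      ((isOpen_extChartAt_target τ).mem_nhds hw')).mdifferentiableAt (by simp)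
  have h2 := (contMDiff_coord.mdifferentiableAt (by simp)).hasMFDerivAt.comp w h1.hasMFDerivAt
  have h3 : coord ∘ (extChartAt (IT n) τ).symm =ᶠ[𝓝 w] id := by
    filter_upwards [isOpen_lieBall.mem_nhds hw] with w' hw' using coord_extChartAt_symm τ hw'
  have h4 := hasMFDerivAt_unique h2 ((hasMFDerivAt_id w).congr_of_eventuallyEq h3)
  exact (mfderiv_coord _ _).symm.trans (congrArg (fun L => L ξ) h4)

lemma symplTG_inChart (τ : TG n) {w : EC n} (hw : w ∈ lieBall n) :
    (symplTG n).inChart τ w = extDeriv (pullLiouville ambSec) w := by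
  ext v
  have h1 : (symplTG n).inChart τ w v =
      extDeriv (pullLiouville ambSec) (coord ((extChartAt (IT n) τ).symm w))
        (fun i => mfderiv 𝓘(ℝ, EC n) (IT n) (extChartAt (IT n) τ).symm w (v i)) := rfl
  rw [h1, coord_extChartAt_symm τ hw]
  congr 1
  ext1 i
  exact mfderiv_extChartAt_TG_symm τ hw (v i)

lemma contDiffAt_extDeriv_pullLiouville {w : EC n} (hw : w ∈ lieBall n) :
    ContDiffAt ℝ ∞ (extDeriv (pullLiouville (n := n) ambSec)) w :=
  (ContinuousAlternatingMap.alternatizeUncurryFinCLM ℝ (EC n) ℝ).contDiff.contDiffAt.comp w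
    ((contDiffAt_pullLiouville (contDiffAt_ambSec hw)).fderiv_right (by simp))

lemma isSmooth_symplTG : (symplTG n).IsSmooth := by
  intro τ
  rw [extChartAt_TG_target]
  have h : ContDiffOn ℝ ∞ (extDeriv (pullLiouville (n := n) ambSec)) (lieBall n) := fun w hw =>
    (contDiffAt_extDeriv_pullLiouville hw).contDiffWithinAt
  exact h.congr fun w hw => symplTG_inChart τ hw

/-- In the single chart the form is the exterior derivative of the pullback of λ by the section, so
d² = 0 applies. -/
lemma d_symplTG : (symplTG n).d = 0 := by
  funext τ
  have hc : extChartAt (IT n) τ τ = coord τ := congrFun (extChartAt_TG_coe τ) τ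
  have h1 : (symplTG n).inChart τ =ᶠ[𝓝 (coord τ)] extDeriv (pullLiouville ambSec) := by
    filter_upwards [isOpen_lieBall.mem_nhds (coord_mem τ)] with w hw using symplTG_inChart τ hw
  have h2 : extDeriv ((symplTG n).inChart τ) (extChartAt (IT n) τ τ) = 0 := by
    rw [hc, h1.extDeriv_eq]
    exact extDeriv_extDeriv_apply (contDiffAt_pullLiouville (contDiffAt_ambSec (coord_mem τ)))
      minSmoothness_two_le
  rw [DForm.d, h2]
  rfl

/-- Both vectors project to the same vector of the orbit space, since rotations preserve `dCoord`
and the section is a right inverse; hence their horizontal parts agree. -/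
lemma hor_rotPair_fderiv_ambSec {w : EC n} (hw : w ∈ lieBall n) {a b : ℝ}
    (h : a ^ 2 + b ^ 2 = 1) {c : R2 n × R2 n} (hc : c ∈ tanSpace (rotPair a b (ambSec w))) :
    rotPair a b (fderiv ℝ ambSec w (dCoord (rotPair a b (ambSec w)) c)) ∈
        tanSpace (rotPair a b (ambSec w)) ∧
      hor (rotPair a b (ambSec w)) c = hor (rotPair a b (ambSec w))
        (rotPair a b (fderiv ℝ ambSec w (dCoord (rotPair a b (ambSec w)) c))) := by
  have hm := rotPair_tanSpace (a := a) (b := b)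
    (fderiv_ambSec_mem hw (dCoord (rotPair a b (ambSec w)) c))
  refine ⟨hm, hor_eq_hor (rotPair_mem h (ambSec_mem hw)) hc hm ?_⟩
  rw [dCoord_rotPair h (zeta_ne_zero (ambSec_mem hw)), dCoord_fderiv_ambSec hw]

/-- The reason why dλ descends: it sees only horizontal parts and is invariant under rotation, so
its value may be computed at the point of the section on the same orbit. -/
lemma sympl_fderiv_ambSec {w : EC n} (hw : w ∈ lieBall n) {a b : ℝ}
    (h : a ^ 2 + b ^ 2 = 1) {c d : R2 n × R2 n} (hc : c ∈ tanSpace (rotPair a b (ambSec w)))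
    (hd : d ∈ tanSpace (rotPair a b (ambSec w))) :
    sympl (fderiv ℝ ambSec w (dCoord (rotPair a b (ambSec w)) c))
      (fderiv ℝ ambSec w (dCoord (rotPair a b (ambSec w)) d)) = sympl c d := by
  have hp := rotPair_mem h (ambSec_mem hw)
  obtain ⟨c1, c2⟩ := hor_rotPair_fderiv_ambSec hw h hc
  obtain ⟨d1, d2⟩ := hor_rotPair_fderiv_ambSec hw h hd
  rw [← sympl_rotPair h, ← sympl_hor hp c1 d1, ← c2, ← d2, sympl_hor hp hc hd]

/-- The pullback of the symplectic form to the unit timelike bundle. -/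
lemma symplTG_dproj (p : UT n) (v w : TangentSpace (IU n) p) :
    symplTG n (proj p) ![dproj p v, dproj p w] = sympl (comps p v) (comps p w) := by
  obtain ⟨t, ht⟩ := exists_flow_gsec p
  have e1 : rotPair (Real.cos t) (Real.sin t) (ambSec (coord (proj p))) = p.1 :=
    congrArg Subtype.val ht
  rw [symplTG_apply, dproj_eq, dproj_eq]
  have h := sympl_fderiv_ambSec (coord_mem (proj p)) (Real.cos_sq_add_sin_sq t)
    (c := comps p v) (d := comps p w) (by rw [e1]; exact comps_mem p v)
    (by rw [e1]; exact comps_mem p w)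
  rwa [e1] at h

lemma dproj_surjective (p : UT n) : Function.Surjective (dproj p) := by
  intro ξ
  obtain ⟨a, ha, -, h⟩ := exists_tanSpace_eq p.2 ξ
  obtain ⟨v, rfl⟩ := exists_comps_eq p ha
  exact ⟨v, (dproj_eq p v).trans h⟩

lemma dproj_eq_zero_iff (p : UT n) (v : TangentSpace (IU n) p) :
    dproj p v = 0 ↔ ∃ c : ℝ, v = c • flowField p := by
  constructor
  · intro h
    obtain ⟨c, hc⟩ := eq_smul_reeb p.2 (comps_mem p v) ((dproj_eq p v).symm.trans h)
    refine ⟨c, comps_injective p ?_⟩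
    rw [hc, map_smul, comps_flowField]
  · rintro ⟨c, rfl⟩
    refine (dproj_eq p _).trans ?_
    rw [map_smul, comps_flowField, map_smul, dCoord_reeb (zeta_ne_zero p.2), smul_zero]
    rfl

lemma pullback_proj_symplTG :
    DForm.pullback (IU n) proj (symplTG n) = (liouville n).d := by
  funext p
  ext v
  have hv : v = ![v 0, v 1] := by ext1 i; fin_cases i <;> rfl
  have h := (symplTG_dproj p (v 0) (v 1)).trans (d_liouville_apply p (v 0) (v 1)).symm
  rw [hv]
  refine Eq.trans ?_ h
  change symplTG n (proj p) (dproj p ∘ ![v 0, v 1]) = _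
  congr 1
  ext1 i
  fin_cases i <;> rfl

/-- Both `proj` and its differentials are surjective, so a form below is determined by its pullback.
-/
lemma pullback_proj_injective {Ω Ω' : DForm (IT n) (TG n) 2}
    (h : DForm.pullback (IU n) proj Ω = DForm.pullback (IU n) proj Ω') : Ω = Ω' := by
  funext τ
  obtain ⟨p, rfl⟩ := exists_proj_eq τ
  ext v
  choose w hw using fun i => dproj_surjective p (v i)
  have h1 := congrArg (fun L => L w) (congrFun h p)
  have hv : v = fun i => dproj p (w i) := funext fun i => (hw i).symm
  rw [hv]
  exact h1

/-! ### The complex structure and the metric of the orbit space -/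

/-- The metric of the orbit space in coordinates. -/
def metricForm (w : EC n) : EC n →L[ℝ] EC n →L[ℝ] ℝ :=
  LinearMap.toContinuousLinearMap (LinearMap.toContinuousLinearMap.toLinearMap ∘ₗ
    LinearMap.mk₂ ℝ
      (fun ξ ξ' => -sympl (fderiv ℝ ambSec w ξ) (fderiv ℝ ambSec w (Complex.I • ξ')))
      (fun ξ₁ ξ₂ ξ' => by rw [map_add, sympl_add_left]; ring)
      (fun c ξ ξ' => by rw [map_smul, sympl_smul_left, smul_eq_mul]; ring)
      (fun ξ ξ₁ ξ₂ => by rw [smul_add, map_add, sympl_add_right]; ring)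
      (fun c ξ ξ' => by rw [smul_comm, map_smul, sympl_smul_right, smul_eq_mul]; ring))

lemma metricForm_apply (w ξ ξ' : EC n) : metricForm w ξ ξ' =
    -sympl (fderiv ℝ ambSec w ξ) (fderiv ℝ ambSec w (Complex.I • ξ')) := rfl

/-- The horizontal lift of a tangent vector of the orbit space. -/
def horLift (w ξ : EC n) : R2 n × R2 n := hor (ambSec w) (fderiv ℝ ambSec w ξ)

lemma horLift_mem {w : EC n} (hw : w ∈ lieBall n) (ξ : EC n) :
    horLift w ξ ∈ tanSpace (ambSec w) :=
  hor_mem (ambSec_mem hw) (fderiv_ambSec_mem hw ξ)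

lemma horLift_orth {w : EC n} (hw : w ∈ lieBall n) (ξ : EC n) :
    ip (horLift w ξ).1 (ambSec w).2 = 0 := hor_orth (ambSec_mem hw) _

lemma dCoord_horLift {w : EC n} (hw : w ∈ lieBall n) (ξ : EC n) :
    dCoord (ambSec w) (horLift w ξ) = ξ := by
  rw [horLift, dCoord_hor (zeta_ne_zero (ambSec_mem hw)), dCoord_fderiv_ambSec hw]

lemma horLift_I_smul {w : EC n} (hw : w ∈ lieBall n) (ξ : EC n) :
    horLift w (Complex.I • ξ) = ambJ (horLift w ξ) := by
  have h0 := zeta_ne_zero (ambSec_mem hw)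
  obtain ⟨h1, h2⟩ := ambJ_mem (horLift_mem hw ξ) (horLift_orth hw ξ)
  rw [← hor_eq_self h2, ← hor_eq_self (horLift_orth hw (Complex.I • ξ))]
  refine hor_eq_hor (ambSec_mem hw) (horLift_mem hw _) h1 ?_
  rw [dCoord_horLift hw, dCoord_ambJ h0, dCoord_horLift hw]

/-- The metric is defined as -ω(·, i·), which makes its smoothness evident; read on horizontal lifts
it is the ambient metric, from which symmetry and positivity follow. -/
lemma metricForm_eq {w : EC n} (hw : w ∈ lieBall n) (ξ ξ' : EC n) :
    metricForm w ξ ξ' = ambMetric (horLift w ξ) (horLift w ξ') := by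
  rw [metricForm_apply, ← sympl_hor (ambSec_mem hw) (fderiv_ambSec_mem hw _)
    (fderiv_ambSec_mem hw _)]
  change -sympl (horLift w ξ) (horLift w (Complex.I • ξ')) = _
  rw [horLift_I_smul hw, sympl_ambJ, neg_neg]

lemma metricForm_pos {w : EC n} (hw : w ∈ lieBall n) {ξ : EC n} (hξ : ξ ≠ 0) :
    0 < metricForm w ξ ξ := by
  rw [metricForm_eq hw]
  refine ambMetric_pos (ambSec_mem hw) (horLift_mem hw ξ) (horLift_orth hw ξ) fun h => hξ ?_
  rw [← dCoord_horLift hw ξ, h, map_zero]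

/-- The minimum of B(v, v) on the compact unit sphere bounds it below by a positive multiple of
‖v‖². -/
lemma isBounded_of_pos {V : Type*} [NormedAddCommGroup V] [NormedSpace ℝ V]
    [FiniteDimensional ℝ V] (B : V →L[ℝ] V →L[ℝ] ℝ) (hB : ∀ v, v ≠ 0 → 0 < B v v) :
    Bornology.IsBounded {v | B v v < 1} := by
  rcases (Metric.sphere (0 : V) 1).eq_empty_or_nonempty with h | h
  -- The unit sphere is empty exactly when the space is trivial, as happens for n = 0.
  · refine (Bornology.isBounded_singleton (x := (0 : V))).subset fun v _ => ?_
    by_contra hv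
    have : ‖v‖⁻¹ • v ∈ Metric.sphere (0 : V) 1 := by
      rw [mem_sphere_zero_iff_norm, norm_smul, norm_inv, norm_norm,
        inv_mul_cancel₀ (norm_ne_zero_iff.2 hv)]
    rw [h] at this
    exact this
  · have : ProperSpace V := FiniteDimensional.proper_real V
    obtain ⟨u, hu, hmin⟩ := (isCompact_sphere (0 : V) 1).exists_isMinOn h
      (f := fun v => B v v) (by fun_prop)
    have hu0 : u ≠ 0 := by
      rintro rfl; simp at hu
    have hm := hB u hu0
    -- From ‖v‖² ≤ (B u u)⁻¹ this radius suffices without a square root, since ‖v‖ ≤ 1 + ‖v‖².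
    refine (Metric.isBounded_closedBall (x := (0 : V)) (r := 1 + (B u u)⁻¹)).subset fun v hv => ?_
    rw [mem_closedBall_zero_iff]
    rcases eq_or_ne v 0 with rfl | hv0
    · rw [norm_zero]; positivity
    have hn : 0 < ‖v‖ := norm_pos_iff.2 hv0
    have hs : ‖v‖⁻¹ • v ∈ Metric.sphere (0 : V) 1 := by
      rw [mem_sphere_zero_iff_norm, norm_smul, norm_inv, norm_norm, inv_mul_cancel₀ hn.ne']
    have h1 : B u u ≤ B (‖v‖⁻¹ • v) (‖v‖⁻¹ • v) := hmin hs
    simp only [map_smul, smul_apply, smul_eq_mul] at h1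
    have h2 : B u u * ‖v‖ ^ 2 ≤ B v v := by
      have h3 : ‖v‖⁻¹ * (‖v‖⁻¹ * B v v) * ‖v‖ ^ 2 = B v v := by field_simp
      rw [← h3]; gcongr
    have hv : B v v < 1 := hv
    have h4 : ‖v‖ ^ 2 ≤ (B u u)⁻¹ := by
      rw [← one_div, le_div_iff₀ hm]; linarith
    nlinarith

lemma contDiffOn_metricForm : ContDiffOn ℝ ∞ (metricForm (n := n)) (lieBall n) := by
  rw [contDiffOn_clm_apply]
  intro ξ
  rw [contDiffOn_clm_apply]
  intro ξ' w hw
  have h1 : ContDiffAt ℝ ∞ (fderiv ℝ (ambSec (n := n))) w :=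
    (contDiffAt_ambSec hw).fderiv_right (by simp)
  have h2 : ∀ ξ, ContDiffAt ℝ ∞ (fun w => fderiv ℝ (ambSec (n := n)) w ξ) w := fun ξ =>
    h1.clm_apply contDiffAt_const
  have h3 : ContDiffAt ℝ ∞ (fun w => metricForm w ξ ξ') w := by
    simp only [metricForm_apply, sympl]
    exact ((contDiff_ip.contDiffAt.comp w ((h2 ξ).fst.prodMk (h2 (Complex.I • ξ')).snd)).sub
      (contDiff_ip.contDiffAt.comp w ((h2 ξ).snd.prodMk (h2 (Complex.I • ξ')).fst))).neg
  exact h3.contDiffWithinAt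

/-- With a single chart, all coordinate changes of the tangent bundle are the identity. -/
lemma trivializationAt_TG_symm (τ₀ τ : TG n) (ξ : EC n) :
    (trivializationAt (EC n) (TangentSpace (IT n)) τ₀).symm τ ξ = ξ := by
  have hτ : τ ∈ (chartAt (EC n) τ₀).source := mem_chart_source (EC n) τ
  have h := TangentBundle.symmL_trivializationAt_eq_core (I := IT n) (𝕜 := ℝ) hτ
  have h2 := tangentCoordChange_self (I := IT n) (x := τ) (z := τ) (v := ξ)
    (mem_extChartAt_source τ)
  rw [← Bundle.Trivialization.symmL_apply (R := ℝ) (hb := by simp)]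
  exact (congrArg (fun L => L ξ) h).trans h2

/-- The scalar product of tangent vectors of the orbit space. -/
def metricInner (τ : TG n) : TangentSpace (IT n) τ →L[ℝ] TangentSpace (IT n) τ →L[ℝ] ℝ :=
  (metricForm (coord τ) : EC n →L[ℝ] EC n →L[ℝ] ℝ)

lemma contMDiff_metricInner : ContMDiff (IT n) ((IT n).prod 𝓘(ℝ, EC n →L[ℝ] EC n →L[ℝ] ℝ)) ∞
    (fun τ : TG n => Bundle.TotalSpace.mk' (EC n →L[ℝ] EC n →L[ℝ] ℝ)
      (E := fun τ : TG n => TangentSpace (IT n) τ →L[ℝ] TangentSpace (IT n) τ →L[ℝ] ℝ)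
      τ (metricInner τ)) := by
  intro τ
  rw [Bundle.contMDiffAt_section]
  have h1 : ContMDiffAt (IT n) 𝓘(ℝ, EC n →L[ℝ] EC n →L[ℝ] ℝ) ∞
      (fun τ : TG n => metricForm (coord τ)) τ :=
    ((contDiffOn_metricForm.contDiffAt
      (isOpen_lieBall.mem_nhds (coord_mem τ))).contMDiffAt).comp τ (contMDiff_coord τ)
  convert! h1 using 1
  funext τ'
  ext v w
  rw [hom_trivializationAt_apply]
  have hb : τ' ∈ (trivializationAt (EC n) (TangentSpace (IT n)) τ).baseSet := by simp
  refine (inCoordinates_apply_eq₂ (E₃ := fun _ => ℝ) (F₃ := ℝ) hb hb (by simp)).trans ?_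
  rw [trivializationAt_TG_symm, trivializationAt_TG_symm]
  simp
  rfl

variable (n) in
/-- The Riemannian metric of the orbit space. -/
def metricTG : Bundle.ContMDiffRiemannianMetric (IT n) ∞ (EC n)
    (fun τ : TG n => TangentSpace (IT n) τ) where
  inner := metricInner
  symm τ ξ ξ' := by
    refine (metricForm_eq (coord_mem τ) ξ ξ').trans ?_
    rw [ambMetric_comm]
    exact (metricForm_eq (coord_mem τ) ξ' ξ).symm
  pos τ ξ hξ := metricForm_pos (coord_mem τ) hξ
  isVonNBounded τ := by
    change Bornology.IsVonNBounded ℝ {v : EC n | metricForm (coord τ) v v < 1}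
    rw [NormedSpace.isVonNBounded_iff]
    exact isBounded_of_pos _ fun v hv => metricForm_pos (coord_mem τ) hv
  contMDiff := contMDiff_metricInner

/-- The complex structure of the orbit space. -/
def complexTG (τ : TG n) : TangentSpace (IT n) τ →L[ℝ] TangentSpace (IT n) τ :=
  ((Complex.I • ContinuousLinearMap.id ℂ (EC n)).restrictScalars ℝ : EC n →L[ℝ] EC n)

lemma metricTG_apply (τ : TG n) (ξ ξ' : TangentSpace (IT n) τ) :
    (metricTG n).inner τ ξ ξ' = -symplTG n τ ![ξ, complexTG τ ξ'] := by
  rw [symplTG_apply]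
  rfl

lemma complexTG_complexTG (τ : TG n) (ξ : TangentSpace (IT n) τ) :
    complexTG τ (complexTG τ ξ) = -ξ := by
  have h : ∀ η : EC n, Complex.I • (Complex.I • η) = -η := fun η => by
    rw [smul_smul, Complex.I_mul_I, neg_one_smul]
  exact h ξ

lemma symplTG_swap (τ : TG n) (ξ ξ' : TangentSpace (IT n) τ) :
    symplTG n τ ![ξ, ξ'] = -symplTG n τ ![ξ', ξ] := by
  rw [symplTG_apply, symplTG_apply, sympl_swap]

lemma symplTG_neg_right (τ : TG n) (ξ ξ' : TangentSpace (IT n) τ) :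
    symplTG n τ ![ξ, -ξ'] = -symplTG n τ ![ξ, ξ'] := by
  rw [symplTG_apply, symplTG_apply]
  have h : ∀ (a : R2 n × R2 n) (η : EC n), sympl a (fderiv ℝ ambSec (coord τ) (-η)) =
      -sympl a (fderiv ℝ ambSec (coord τ) η) := fun a η => by
    rw [← neg_one_smul ℝ η, map_smul, sympl_smul_right, neg_one_mul]
  exact h _ ξ'

lemma symplTG_eq_metric (τ : TG n) (ξ ξ' : TangentSpace (IT n) τ) :
    symplTG n τ ![ξ, ξ'] = (metricTG n).inner τ ξ (complexTG τ ξ') := by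
  rw [metricTG_apply, complexTG_complexTG, symplTG_neg_right, neg_neg]

lemma metricTG_complexTG (τ : TG n) (ξ ξ' : TangentSpace (IT n) τ) :
    (metricTG n).inner τ (complexTG τ ξ) (complexTG τ ξ') = (metricTG n).inner τ ξ ξ' := by
  rw [← symplTG_eq_metric, symplTG_swap, ← metricTG_apply, (metricTG n).symm]

/-- The global coordinates are themselves holomorphic coordinates for this structure. -/
lemma isComplexStructure_complexTG : IsComplexStructure (complexTG (n := n)) where
  sq := complexTG_complexTG
  integrable τ₀ := by
    refine ⟨isOpenEmbedding_coord.toOpenPartialHomeomorph coord, by simp, ?_, ?_, ?_⟩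
    · exact contMDiff_coord.contMDiffOn
    · have h := contMDiffOn_isOpenEmbedding_symm (I := IT n) (n := ∞)
        (isOpenEmbedding_coord (n := n))
      simpa using h
    · intro τ _ ξ
      have h : ∀ ξ : TangentSpace (IT n) τ, dC
          (isOpenEmbedding_coord.toOpenPartialHomeomorph coord : TG n → EC n) τ ξ = ξ := fun ξ =>
        mfderiv_coord τ ξ
      rw [h, h]
      rfl

lemma isSymplectic_symplTG : IsSymplectic (symplTG n) where
  smooth := isSmooth_symplTG
  closed := d_symplTG
  nondegenerate τ ξ h := by
    by_contra hξ
    -- A vector in the radical pairs to zero with its own image under J, so its g-norm would vanish.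
    have h1 := (metricTG n).pos τ ξ hξ
    rw [metricTG_apply, h, neg_zero] at h1
    exact lt_irrefl _ h1

/-! ### The contact structure -/

lemma liouville_flowField (p : UT n) : liouville n p ![flowField p] = 1 := by
  rw [liouville_apply, comps_flowField]
  have : ip (reeb p.1).1 p.1.2 = -1 := p.2.2.2.1
  rw [this, neg_neg]

lemma liouville_eq_zero_iff (p : UT n) (v : TangentSpace (IU n) p) :
    liouville n p ![v] = 0 ↔ ip (comps p v).1 p.1.2 = 0 := by
  rw [liouville_apply, neg_eq_zero]

lemma exists_comps_ambJ (p : UT n) (v : TangentSpace (IU n) p) (hv : liouville n p ![v] = 0) :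
    ∃ w : TangentSpace (IU n) p, liouville n p ![w] = 0 ∧ comps p w = ambJ (comps p v) := by
  rw [liouville_eq_zero_iff] at hv
  obtain ⟨h1, h2⟩ := ambJ_mem (comps_mem p v) hv
  obtain ⟨w, hw⟩ := exists_comps_eq p h1
  refine ⟨w, ?_, hw⟩
  rw [liouville_eq_zero_iff, hw]
  exact h2

lemma isContactForm_liouville : IsContactForm (liouville n) where
  smooth := isSmooth_liouville
  ne_zero p h := by
    have h1 := liouville_flowField p
    rw [h] at h1
    exact zero_ne_one h1
  nondegenerate p v hv h := by
    -- Testing dλ(v, ·) against the horizontal vector (ẏ, -ẋ) yields minus the metric norm of v.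
    obtain ⟨w, hw1, hw2⟩ := exists_comps_ambJ p v hv
    have h1 := h w hw1
    rw [d_liouville_apply, hw2, sympl_ambJ, neg_eq_zero] at h1
    by_contra hv0
    have h2 := ambMetric_pos p.2 (comps_mem p v) ((liouville_eq_zero_iff p v).1 hv) fun h0 =>
      hv0 (comps_injective p (h0.trans (map_zero _).symm))
    exact h2.ne' h1

lemma isReebField_flowField : IsReebField (liouville n) flowField := fun p =>
  ⟨liouville_flowField p, fun w => by
    rw [d_liouville_apply, comps_flowField, sympl_reeb (comps_mem p w)]⟩

lemma isMIntegralCurve_flow (p : UT n) :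
    IsMIntegralCurve (I := IU n) (fun t : ℝ => flow t p) flowField := by
  intro t
  have h1 := ((contMDiff_flow_left p).mdifferentiableAt (by simp) :
    MDifferentiableAt 𝓘(ℝ, ℝ) (IU n) (fun t : ℝ => flow t p) t).hasMFDerivAt
  have e : mfderiv 𝓘(ℝ, ℝ) (IU n) (fun t : ℝ => flow t p) t =
      ContinuousLinearMap.smulRight (1 : ℝ →L[ℝ] ℝ) (flowField (flow t p)) := by
    apply ContinuousLinearMap.ext_ring
    apply comps_injective (flow t p)
    refine (comps_mfderiv_flow_left p t).trans ?_
    exact (comps_flowField _).symm.trans (congrArg _ (one_smul ℝ _).symm)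
  rw [e] at h1
  exact h1

lemma pullback_flow_liouville (t : ℝ) :
    DForm.pullback (IU n) (flow t) (liouville n) = liouville n := by
  funext p
  ext v
  have h : ∀ v : TangentSpace (IU n) p,
      liouville n (flow t p) ![mfderiv (IU n) (IU n) (flow t) p v] = liouville n p ![v] := by
    intro v
    rw [liouville_apply, comps_mfderiv_flow, liouville_apply]
    congr 1
    exact liouville_rotPair (Real.cos_sq_add_sin_sq t) (comps_mem p v)
  have hv : v = ![v 0] := by ext1 i; fin_cases i; rfl
  rw [hv]
  refine Eq.trans ?_ (h (v 0))
  change liouville n (flow t p) (mfderiv (IU n) (IU n) (flow t) p ∘ ![v 0]) = _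
  congr 1
  ext1 i
  fin_cases i
  rfl

lemma metricU_eq (p : UT n) (v w : TangentSpace (IU n) p) :
    metricU p v w = ambMetric (comps p v) (comps p w) := rfl

/-- The two terms ⟨ẋ|y⟩ and -⟨ẏ|x⟩ coincide by the third tangency equation; this is why Z^⊥ = ker λ.
-/
lemma metricU_flowField (p : UT n) (v : TangentSpace (IU n) p) :
    metricU p v (flowField p) = 2 * ip (comps p v).1 p.1.2 := by
  rw [metricU_eq, comps_flowField]
  have h := (comps_mem p v).2.2
  simp only [ambMetric, reeb, ip_neg_right]
  linarith

lemma liouville_eq_zero_iff_metricU (p : UT n) (v : TangentSpace (IU n) p) :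
    liouville n p ![v] = 0 ↔ metricU p v (flowField p) = 0 := by
  rw [liouville_eq_zero_iff, metricU_flowField]
  simp

lemma complexTG_dproj (p : UT n) (v w : TangentSpace (IU n) p)
    (h : comps p w = ambJ (comps p v)) : complexTG (proj p) (dproj p v) = dproj p w := by
  have h1 : dproj p w = (Complex.I • dCoord p.1 (comps p v) : EC n) := by
    rw [dproj_eq, h, dCoord_ambJ (zeta_ne_zero p.2)]
  rw [h1]
  exact congrArg (fun ξ : EC n => Complex.I • ξ) (dproj_eq p v)

lemma metricTG_dproj (p : UT n) (v w : TangentSpace (IU n) p)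
    (hw : liouville n p ![w] = 0) :
    (metricTG n).inner (proj p) (dproj p v) (dproj p w) = metricU p v w := by
  obtain ⟨w', -, hw'⟩ := exists_comps_ambJ p w hw
  rw [metricTG_apply, complexTG_dproj p w w' hw', symplTG_dproj, hw', sympl_ambJ, neg_neg,
    metricU_eq]

/-! ### The normal of a spacelike hyperplane -/

section Normal

variable {V : Type*} [NormedAddCommGroup V] [NormedSpace ℝ V]

/-- A spacelike linear map: nonzero vectors have spacelike images. -/
def IsSpacelikeMap (A : V →L[ℝ] R2 n) : Prop := ∀ v, v ≠ 0 → 0 < ip (A v) (A v)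

lemma finrank_R2 : Module.finrank ℝ (R2 n) = n + 2 := by
  simp [Module.finrank_prod]; ring

lemma IsSpacelikeMap.injective {A : V →L[ℝ] R2 n} (hA : IsSpacelikeMap A) :
    Function.Injective A := by
  refine (injective_iff_map_eq_zero A).2 fun v hv => by_contra fun h => ?_
  have := hA v h
  rw [hv, ip_zero_left] at this
  exact lt_irrefl _ this

variable [FiniteDimensional ℝ V]

/-- The image of A together with x and y is independent, by orthogonality, and has dimension n + 2.
-/
lemma exists_decomp (hV : Module.finrank ℝ V = n) {A : V →L[ℝ] R2 n} (hA : IsSpacelikeMap A)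
    {x y : R2 n} (hp : (x, y) ∈ unitSet n) (hx : ∀ v, ip (A v) x = 0) (hy : ∀ v, ip (A v) y = 0)
    (w : R2 n) : ∃ (v : V) (a b : ℝ), w = A v + a • x + b • y := by
  let L : V × ℝ × ℝ →ₗ[ℝ] R2 n := LinearMap.coprod A.toLinearMap
    (LinearMap.coprod (LinearMap.toSpanSingleton ℝ _ x) (LinearMap.toSpanSingleton ℝ _ y))
  have hL : ∀ v a b, L (v, a, b) = A v + (a • x + b • y) := fun v a b => rfl
  have h1 : ip x x = -1 := hp.1
  have h2 : ip x y = 0 := hp.2.1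
  have h3 : ip y y = -1 := hp.2.2.1
  have hi : Function.Injective L := by
    refine (injective_iff_map_eq_zero L).2 ?_
    rintro ⟨v, a, b⟩ h
    rw [hL] at h
    have ha := congrArg (fun z => ip z x) h
    have hb := congrArg (fun z => ip z y) h
    simp only [ip_add_left, ip_smul_left, ip_zero_left, hx, hy, h1, h2, h3, ip_comm y x] at ha hb
    have ha' : a = 0 := by linarith
    have hb' : b = 0 := by linarith
    subst ha' hb'
    have hv : v = 0 := hA.injective (by simpa using h)
    rw [hv]; rfl
  have hfr : Module.finrank ℝ (V × ℝ × ℝ) = Module.finrank ℝ (R2 n) := by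
    rw [finrank_R2]; simp [Module.finrank_prod, hV]
  obtain ⟨⟨v, a, b⟩, h⟩ := (LinearMap.injective_iff_surjective_of_finrank_eq_finrank hfr).1 hi w
  exact ⟨v, a, b, by rw [← h, hL, add_assoc]⟩

/-- If q(w) ≥ 0, then q is nonnegative on the image of A plus the line of w. Having dimension n + 1,
this space contains a nonzero vector without spatial part, whose square is negative. -/
lemma ip_self_neg_of_orthogonal (hV : Module.finrank ℝ V = n) {A : V →L[ℝ] R2 n}
    (hA : IsSpacelikeMap A) {w : R2 n} (hw : w ≠ 0) (h : ∀ v, ip (A v) w = 0) : ip w w < 0 := by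
  by_contra! hn
  let T : V × ℝ →ₗ[ℝ] R2 n := LinearMap.coprod A.toLinearMap (LinearMap.toSpanSingleton ℝ _ w)
  have hT : ∀ v c, T (v, c) = A v + c • w := fun v c => rfl
  let L : V × ℝ →ₗ[ℝ] EuclideanSpace ℝ (Fin n) :=
    (LinearMap.snd ℝ ℝ (EuclideanSpace ℝ (Fin n))).comp
      ((LinearMap.snd ℝ ℝ (ℝ × EuclideanSpace ℝ (Fin n))).comp T)
  -- There are n + 1 parameters for n spatial components.
  have hk : LinearMap.ker L ≠ ⊥ := LinearMap.ker_ne_bot_of_finrank_lt (by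
    simp [Module.finrank_prod, hV])
  obtain ⟨⟨v, c⟩, hvc, h0⟩ := (Submodule.ne_bot_iff _).1 hk
  have hz : (A v + c • w).2.2 = 0 := hvc
  set z := A v + c • w with hzd
  have h1 : ip z z = -(z.1 * z.1) - z.2.1 * z.2.1 := by simp [ip, hz]
  have h2 : ip z z = ip (A v) (A v) + c ^ 2 * ip w w := by
    simp only [hzd, ip_add_left, ip_add_right, ip_smul_left, ip_smul_right, h, ip_comm w (A v)]
    ring
  have h3 : 0 ≤ c ^ 2 * ip w w := by positivity
  by_cases hv : v = 0
  · subst hv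
    have hc : c ≠ 0 := by rintro rfl; exact h0 rfl
    simp only [map_zero, ip_zero_left, zero_add] at h2
    have e1 : z.1 = 0 := by nlinarith [mul_self_nonneg z.1, mul_self_nonneg z.2.1]
    have e2 : z.2.1 = 0 := by nlinarith [mul_self_nonneg z.1, mul_self_nonneg z.2.1]
    have hz0 : z = 0 := Prod.ext e1 (Prod.ext e2 hz)
    rw [hzd, map_zero, zero_add, smul_eq_zero] at hz0
    exact hz0.elim hc hw
  · nlinarith [hA v hv, mul_self_nonneg z.1, mul_self_nonneg z.2.1]

/-- The future unit normal of a spacelike hyperplane tangent to anti-de Sitter space. -/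
lemma exists_normal (hV : Module.finrank ℝ V = n) {A : V →L[ℝ] R2 n} (hA : IsSpacelikeMap A)
    {x : R2 n} (hx : ip x x = -1) :
    ∃ y, (x, y) ∈ unitSet n ∧ ∀ v, ip (A v) y = 0 := by
  let L : R2 n →ₗ[ℝ] (Module.Dual ℝ V) × ℝ := LinearMap.prod
    { toFun := fun w => (ipB n w).toLinearMap.comp A.toLinearMap
      map_add' := fun a b => by ext v; simp
      map_smul' := fun c a => by ext v; simp }
    (ipL x).toLinearMap
  -- Orthogonality to the image of A and to x amounts to n + 1 linear conditions on a space of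
  -- dimension n + 2.
  have hk : LinearMap.ker L ≠ ⊥ := LinearMap.ker_ne_bot_of_finrank_lt (by
    rw [finrank_R2, Module.finrank_prod, Subspace.dual_finrank_eq, hV]; simp)
  obtain ⟨w, hwL, h0⟩ := (Submodule.ne_bot_iff _).1 hk
  have h1 : ∀ v, ip (A v) w = 0 := fun v =>
    congrArg (fun l : (Module.Dual ℝ V) × ℝ => l.1 v) hwL
  have h2 : ip w x = 0 := congrArg Prod.snd hwL
  obtain ⟨c, hc, hcc⟩ := exists_normalize (ip_self_neg_of_orthogonal hV hA h0 h1)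
  rcases mem_unitSet_or hx hcc (by rw [ip_smul_right, ip_comm, h2, mul_zero]) with h | h
  · exact ⟨_, h, fun v => by rw [ip_smul_right, h1, mul_zero]⟩
  · exact ⟨_, h, fun v => by rw [ip_neg_right, ip_smul_right, h1, mul_zero, neg_zero]⟩

/-- In the decomposition of y' along the image of A, x and y, orthogonality removes the first two
parts, the norm gives y' = ±y, and the time orientation excludes the minus sign. -/
lemma normal_unique (hV : Module.finrank ℝ V = n) {A : V →L[ℝ] R2 n} (hA : IsSpacelikeMap A)
    {x y y' : R2 n} (hp : (x, y) ∈ unitSet n) (hp' : (x, y') ∈ unitSet n)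
    (hx : ∀ v, ip (A v) x = 0) (hy : ∀ v, ip (A v) y = 0) (hy' : ∀ v, ip (A v) y' = 0) :
    y' = y := by
  obtain ⟨v, a, b, h⟩ := exists_decomp hV hA hp hx hy y'
  have h1 : ip x x = -1 := hp.1
  have h2 : ip x y = 0 := hp.2.1
  have h4 : ip x y' = 0 := hp'.2.1
  have ha : a = 0 := by
    rw [h, ip_add_right, ip_add_right, ip_smul_right, ip_smul_right, ip_comm x, hx, h1, h2] at h4
    linarith
  have hv : v = 0 := by
    by_contra hv
    have h5 := hy' v
    rw [h, ip_add_right, ip_add_right, ip_smul_right, ip_smul_right, hx, hy] at h5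
    have := hA v hv
    linarith
  subst ha hv
  simp only [map_zero, zero_smul, zero_add] at h
  subst h
  have e1 : b ^ 2 = 1 := by
    have h5 : ip (b • y) (b • y) = -1 := hp'.2.2.1
    have h6 : ip y y = -1 := hp.2.2.1
    rw [ip_smul_left, ip_smul_right, h6] at h5
    linarith
  have e2 : ip y (dtheta x) < 0 := hp.2.2.2
  have e3 : ip (b • y) (dtheta x) < 0 := hp'.2.2.2
  rw [ip_smul_left] at e3
  have e4 : b = 1 := by
    rcases eq_or_eq_neg_of_sq_eq_sq b 1 (by rw [e1, one_pow]) with h | h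
    · exact h
    · rw [h] at e3; linarith
  rw [e4, one_smul]

end Normal

/-! ### Smoothness of the normal -/

section SmoothNormal

variable {V : Type*} [NormedAddCommGroup V] [NormedSpace ℝ V]

/-- The linear map `w ↦ (⟨A · | w⟩, ⟨x | w⟩, ⟨y | w⟩)`. -/
def pairingL (A : V →L[ℝ] R2 n) (x y : R2 n) : R2 n →L[ℝ] (V →L[ℝ] ℝ) × ℝ × ℝ :=
  (ContinuousLinearMap.inl ℝ (V →L[ℝ] ℝ) (ℝ × ℝ)).comp
      (((ContinuousLinearMap.compL ℝ V (R2 n) ℝ).flip A).comp (ipB n)) +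
    (ContinuousLinearMap.inr ℝ (V →L[ℝ] ℝ) (ℝ × ℝ)).comp
      ((ContinuousLinearMap.inl ℝ ℝ ℝ).comp (ipL x) + (ContinuousLinearMap.inr ℝ ℝ ℝ).comp (ipL y))

lemma pairingL_fst (A : V →L[ℝ] R2 n) (x y w : R2 n) (v : V) :
    (pairingL A x y w).1 v = ip (A v) w := by
  simp [pairingL]

lemma pairingL_snd (A : V →L[ℝ] R2 n) (x y w : R2 n) :
    (pairingL A x y w).2 = (ip w x, ip w y) := by
  simp [pairingL, ipL_apply]

lemma contDiffAt_pairingL {E : Type*} [NormedAddCommGroup E] [NormedSpace ℝ E]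
    {A : E → V →L[ℝ] R2 n} {x : E → R2 n} {u : E}
    (hA : ContDiffAt ℝ ∞ A u) (hx : ContDiffAt ℝ ∞ x u) (y : R2 n) :
    ContDiffAt ℝ ∞ (fun u => pairingL (A u) (x u) y) u := by
  have h1 : ContDiffAt ℝ ∞ (fun u => ipL (x u)) u := (ipB n).contDiff.contDiffAt.comp u hx
  have h2 : ContDiffAt ℝ ∞ (fun u => (ContinuousLinearMap.compL ℝ V (R2 n) ℝ).flip (A u)) u :=
    contDiffAt_const.clm_apply hA
  exact (contDiffAt_const.clm_comp (h2.clm_comp contDiffAt_const)).add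
    (contDiffAt_const.clm_comp ((contDiffAt_const.clm_comp h1).add contDiffAt_const))

variable [FiniteDimensional ℝ V]

/-- A vector of the kernel is orthogonal to a spanning set, hence to itself, but `ip_self_pos` makes
a nonzero vector orthogonal to x and y spacelike. The dimensions agree. -/
lemma isInvertible_pairingL (hV : Module.finrank ℝ V = n) {A : V →L[ℝ] R2 n}
    (hA : IsSpacelikeMap A) {x y : R2 n} (hp : (x, y) ∈ unitSet n)
    (hx : ∀ v, ip (A v) x = 0) (hy : ∀ v, ip (A v) y = 0) :
    (pairingL A x y).IsInvertible := by
  have hi : Function.Injective (pairingL A x y).toLinearMap := by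
    refine (injective_iff_map_eq_zero _).2 fun w hw => ?_
    have h1 : ∀ v, ip (A v) w = 0 := fun v => by
      rw [← pairingL_fst A x y w v]
      exact congrArg (fun l : (V →L[ℝ] ℝ) × ℝ × ℝ => l.1 v) hw
    have h2 : (ip w x, ip w y) = (0, 0) := by
      rw [← pairingL_snd A x y w]
      exact congrArg (fun l : (V →L[ℝ] ℝ) × ℝ × ℝ => l.2) hw
    rw [Prod.mk.injEq] at h2
    by_contra h0
    have h3 := ip_self_pos (by rw [show ip x x = -1 from hp.1]; norm_num)
      (by rw [show ip y y = -1 from hp.2.2.1]; norm_num) hp.2.1 h2.1 h2.2 h0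
    obtain ⟨v, a, b, h⟩ := exists_decomp hV hA hp hx hy w
    have h4 : ip w w = ip (A v + a • x + b • y) w := by rw [← h]
    rw [ip_add_left, ip_add_left, ip_smul_left, ip_smul_left, h1, ip_comm x, ip_comm y, h2.1,
      h2.2] at h4
    simp only [mul_zero, add_zero] at h4
    exact h3.ne' h4
  have hfr : Module.finrank ℝ (R2 n) = Module.finrank ℝ ((V →L[ℝ] ℝ) × ℝ × ℝ) := by
    have : Module.finrank ℝ (V →L[ℝ] ℝ) = n := by
      rw [← (LinearMap.toContinuousLinearMap : (V →ₗ[ℝ] ℝ) ≃ₗ[ℝ] (V →L[ℝ] ℝ)).finrank_eq]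
      exact (Subspace.dual_finrank_eq).trans hV
    rw [finrank_R2, Module.finrank_prod, this]
    simp
  exact ⟨(LinearEquiv.ofInjectiveOfFinrankEq _ hi hfr).toContinuousLinearEquiv, by
    ext w <;> rfl⟩

/-- The future unit normal of a spacelike hypersurface is smooth. -/
lemma contDiffAt_normal (hV : Module.finrank ℝ V = n) {F Y : V → R2 n} {u₀ : V}
    (hF : ContDiffAt ℝ ∞ F u₀) (hs : ∀ᶠ u in 𝓝 u₀, IsSpacelikeMap (fderiv ℝ F u))
    (hY : ∀ᶠ u in 𝓝 u₀, (F u, Y u) ∈ unitSet n)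
    (hx : ∀ᶠ u in 𝓝 u₀, ∀ v, ip (fderiv ℝ F u v) (F u) = 0)
    (hy : ∀ᶠ u in 𝓝 u₀, ∀ v, ip (fderiv ℝ F u v) (Y u) = 0) :
    ContDiffAt ℝ ∞ Y u₀ := by
  -- The third condition pairs with the frozen vector Y u₀, so that M is smooth in u without any
  -- regularity of Y.
  set M : V → R2 n →L[ℝ] (V →L[ℝ] ℝ) × ℝ × ℝ := fun u => pairingL (fderiv ℝ F u) (F u) (Y u₀)
    with hM
  have hMs : ContDiffAt ℝ ∞ M u₀ := contDiffAt_pairingL (hF.fderiv_right (by simp)) hF _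
  have hinv : (M u₀).IsInvertible := isInvertible_pairingL hV hs.self_of_nhds hY.self_of_nhds
    hx.self_of_nhds hy.self_of_nhds
  -- The right-hand side is the value of M u₀ at Y u₀, so N u₀ = Y u₀. Elsewhere N u is an
  -- unnormalized normal; near u₀ it stays timelike and future oriented, so by uniqueness its
  -- normalization is Y.
  set N : V → R2 n := fun u => (M u).inverse (0, 0, -1) with hN
  have hNs : ContDiffAt ℝ ∞ N u₀ :=
    ((hinv.contDiffAt_map_inverse).comp u₀ hMs).clm_apply contDiffAt_const
  have hN0 : N u₀ = Y u₀ := by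
    have h1 : M u₀ (Y u₀) = (0, 0, -1) := by
      refine Prod.ext (ContinuousLinearMap.ext fun v => ?_) ?_
      · rw [pairingL_fst]; exact hy.self_of_nhds v
      · rw [pairingL_snd, ip_comm]
        exact Prod.ext hY.self_of_nhds.2.1 hY.self_of_nhds.2.2.1
    rw [hN]
    simp only
    rw [← h1, hinv.inverse_apply_self]
  have hev : ∀ᶠ u in 𝓝 u₀, (M u).IsInvertible := by
    obtain ⟨e, he⟩ := hinv
    have := e.nhds
    rw [he] at this
    exact hMs.continuousAt this
  have hq : ContDiffAt ℝ ∞ (fun u => ip (N u) (N u)) u₀ :=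
    contDiff_ip.contDiffAt.comp u₀ (hNs.prodMk hNs)
  have hd : Continuous fun q : R2 n × R2 n => ip q.2 (dtheta q.1) := by
    simp only [ip_dtheta]; fun_prop
  have hfut : ∀ᶠ u in 𝓝 u₀, ip (N u) (dtheta (F u)) < 0 := by
    have h1 : ContinuousAt (fun u => ip (N u) (dtheta (F u))) u₀ :=
      hd.continuousAt.comp (f := fun u => (F u, N u)) (hF.continuousAt.prodMk hNs.continuousAt)
    refine h1.eventually_lt continuousAt_const ?_
    rw [hN0]; exact hY.self_of_nhds.2.2.2
  have hneg : ip (N u₀) (N u₀) < 0 := by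
    rw [hN0, show ip (Y u₀) (Y u₀) = -1 from hY.self_of_nhds.2.2.1]; norm_num
  have hneg' := hq.continuousAt.eventually_lt continuousAt_const hneg
  have hres : ContDiffAt ℝ ∞ (fun u => (√(-ip (N u) (N u)))⁻¹ • N u) u₀ := by
    have h0 : 0 < -ip (N u₀) (N u₀) := neg_pos.2 hneg
    exact ((hq.neg.sqrt h0.ne').inv (Real.sqrt_pos.2 h0).ne').smul hNs
  refine hres.congr_of_eventuallyEq ?_
  filter_upwards [hev, hfut, hneg', hs, hY, hx, hy] with u e1 e2 e3 e4 e5 e6 e7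
  have h0 : 0 < √(-ip (N u) (N u)) := Real.sqrt_pos.2 (neg_pos.2 e3)
  have hMN : M u (N u) = (0, 0, -1) := e1.self_apply_inverse _
  have o1 : ∀ v, ip (fderiv ℝ F u v) (N u) = 0 := fun v => by
    rw [← pairingL_fst (fderiv ℝ F u) (F u) (Y u₀)]
    exact congrArg (fun l : (V →L[ℝ] ℝ) × ℝ × ℝ => l.1 v) hMN
  have o2 : ip (N u) (F u) = 0 := by
    have h1 := pairingL_snd (fderiv ℝ F u) (F u) (Y u₀) (N u)
    exact (congrArg Prod.fst h1).symm.trans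
      (congrArg (fun l : (V →L[ℝ] ℝ) × ℝ × ℝ => l.2.1) hMN)
  refine (normal_unique (y' := (√(-ip (N u) (N u)))⁻¹ • N u) hV e4 e5 ⟨e5.1, ?_, ?_, ?_⟩ e6 e7 fun v => ?_).symm
  · change ip (F u) _ = 0
    rw [ip_smul_right, ip_comm (F u), o2, mul_zero]
  · change ip (_ • N u) (_ • N u) = -1
    rw [ip_smul_left, ip_smul_right, ← mul_assoc, ← mul_inv, Real.mul_self_sqrt (by linarith),
      inv_mul_eq_div, div_eq_iff (by linarith)]
    ring
  · rw [ip_smul_left]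
    exact mul_neg_of_pos_of_neg (inv_pos.2 h0) e2
  · rw [ip_smul_right, o1, mul_zero]

end SmoothNormal

/-! ### Maps in charts -/

section Charts

variable {S : Type*} [TopologicalSpace S] [ChartedSpace (EuclideanSpace ℝ (Fin n)) S]
  {W : Type*} [NormedAddCommGroup W] [NormedSpace ℝ W]

lemma contMDiffAt_of_comp_extChartAt_symm {H : S → W} (s₀ : S)
    (hH : ContDiffAt ℝ ∞ (H ∘ (extChartAt (𝓡 n) s₀).symm) (extChartAt (𝓡 n) s₀ s₀)) :
    ContMDiffAt (𝓡 n) 𝓘(ℝ, W) ∞ H s₀ := by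
  have h1 := hH.contMDiffAt.comp s₀ (contMDiffAt_extChartAt (n := ∞))
  refine h1.congr_of_eventuallyEq ?_
  filter_upwards [extChartAt_source_mem_nhds (I := 𝓡 n) s₀] with q hq
  exact (congrArg H ((extChartAt (𝓡 n) s₀).left_inv hq)).symm

lemma eventually_extChartAt_symm (s₀ : S) {P : S → Prop} (h : ∀ᶠ s in 𝓝 s₀, P s) :
    ∀ᶠ u in 𝓝 (extChartAt (𝓡 n) s₀ s₀), P ((extChartAt (𝓡 n) s₀).symm u) := by
  have h1 := continuousAt_extChartAt_symm (I := 𝓡 n) s₀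
  rw [ContinuousAt, extChartAt_to_inv] at h1
  exact h1.eventually h

variable [IsManifold (𝓡 n) ∞ S]

lemma mdifferentiableAt_extChartAt_symm' (s₀ : S) {u : EuclideanSpace ℝ (Fin n)}
    (hu : u ∈ (extChartAt (𝓡 n) s₀).target) :
    MDifferentiableAt 𝓘(ℝ, EuclideanSpace ℝ (Fin n)) (𝓡 n) (extChartAt (𝓡 n) s₀).symm u :=
  ((contMDiffOn_extChartAt_symm (n := ∞) s₀).contMDiffAt
    ((isOpen_extChartAt_target s₀).mem_nhds hu)).mdifferentiableAt (by simp)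

lemma fderiv_comp_extChartAt_symm {H : S → W} (s₀ : S) {u : EuclideanSpace ℝ (Fin n)}
    (hu : u ∈ (extChartAt (𝓡 n) s₀).target)
    (hH : MDifferentiableAt (𝓡 n) 𝓘(ℝ, W) H ((extChartAt (𝓡 n) s₀).symm u))
    (v : EuclideanSpace ℝ (Fin n)) :
    fderiv ℝ (H ∘ (extChartAt (𝓡 n) s₀).symm) u v =
      mfderiv (𝓡 n) 𝓘(ℝ, W) H ((extChartAt (𝓡 n) s₀).symm u)
        (mfderiv 𝓘(ℝ, EuclideanSpace ℝ (Fin n)) (𝓡 n) (extChartAt (𝓡 n) s₀).symm u v) := by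
  rw [← mfderiv_eq_fderiv, mfderiv_comp u hH (mdifferentiableAt_extChartAt_symm' s₀ hu)]
  rfl

lemma mfderiv_eq_fderiv_extChartAt_symm {H : S → W} (s₀ : S) {s : S}
    (hs : s ∈ (extChartAt (𝓡 n) s₀).source) (hH : MDifferentiableAt (𝓡 n) 𝓘(ℝ, W) H s)
    (v : TangentSpace (𝓡 n) s) :
    mfderiv (𝓡 n) 𝓘(ℝ, W) H s v =
      fderiv ℝ (H ∘ (extChartAt (𝓡 n) s₀).symm) (extChartAt (𝓡 n) s₀ s)
        (mfderiv (𝓡 n) 𝓘(ℝ, EuclideanSpace ℝ (Fin n)) (extChartAt (𝓡 n) s₀) s v) := by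
  have hu := (extChartAt (𝓡 n) s₀).map_source hs
  have hl := (extChartAt (𝓡 n) s₀).left_inv hs
  have h1 : MDifferentiableAt 𝓘(ℝ, EuclideanSpace ℝ (Fin n)) 𝓘(ℝ, W)
      (H ∘ (extChartAt (𝓡 n) s₀).symm) (extChartAt (𝓡 n) s₀ s) := by
    refine MDifferentiableAt.comp _ ?_ (mdifferentiableAt_extChartAt_symm' s₀ hu)
    rwa [hl]
  have h3 := h1.hasMFDerivAt.comp s
    (mdifferentiableAt_extChartAt (by rwa [extChartAt_source] at hs)).hasMFDerivAt
  have h4 : (H ∘ (extChartAt (𝓡 n) s₀).symm) ∘ extChartAt (𝓡 n) s₀ =ᶠ[𝓝 s] H := by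
    filter_upwards [extChartAt_source_mem_nhds' (I := 𝓡 n) hs] with q hq
    exact congrArg H ((extChartAt (𝓡 n) s₀).left_inv hq)
  have h5 := hasMFDerivAt_unique (h3.congr_of_eventuallyEq h4.symm) hH.hasMFDerivAt
  rw [mfderiv_eq_fderiv] at h5
  exact (congrArg (fun L => L v) h5).symm

lemma mfderiv_extChartAt_symm_injective (s₀ : S) {u : EuclideanSpace ℝ (Fin n)}
    (hu : u ∈ (extChartAt (𝓡 n) s₀).target) :
    Function.Injective
      (mfderiv 𝓘(ℝ, EuclideanSpace ℝ (Fin n)) (𝓡 n) (extChartAt (𝓡 n) s₀).symm u) := by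
  have hs := (extChartAt (𝓡 n) s₀).map_target hu
  have h1 := (mdifferentiableAt_extChartAt (I := 𝓡 n) (x := s₀)
    (by rwa [extChartAt_source] at hs)).hasMFDerivAt.comp u
    (mdifferentiableAt_extChartAt_symm' s₀ hu).hasMFDerivAt
  have h2 : extChartAt (𝓡 n) s₀ ∘ (extChartAt (𝓡 n) s₀).symm =ᶠ[𝓝 u] id := by
    filter_upwards [(isOpen_extChartAt_target s₀).mem_nhds hu] with q hq
    exact (extChartAt (𝓡 n) s₀).right_inv hq
  have h3 := hasMFDerivAt_unique h1 ((hasMFDerivAt_id u).congr_of_eventuallyEq h2)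
  exact Function.LeftInverse.injective fun v => congrArg (fun L => L v) h3

lemma contDiffAt_comp_extChartAt_symm {H : S → W} (s₀ : S) {u : EuclideanSpace ℝ (Fin n)}
    (hu : u ∈ (extChartAt (𝓡 n) s₀).target)
    (hH : ContMDiffAt (𝓡 n) 𝓘(ℝ, W) ∞ H ((extChartAt (𝓡 n) s₀).symm u)) :
    ContDiffAt ℝ ∞ (H ∘ (extChartAt (𝓡 n) s₀).symm) u :=
  (hH.comp u ((contMDiffOn_extChartAt_symm (n := ∞) s₀).contMDiffAt
    ((isOpen_extChartAt_target s₀).mem_nhds hu))).contDiffAt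

end Charts

/-! ### The Gauss map -/

section Gauss

variable {S : Type*} [TopologicalSpace S] [ChartedSpace (EuclideanSpace ℝ (Fin n)) S]

/-- The normal of a spacelike immersion at a point. -/
lemma IsSpacelikeImmersionAt.exists_normal {x : S → R2 n} {s : S}
    (hx : IsSpacelikeImmersionAt x s) : ∃ p : UT n, p.1.1 = x s ∧
      ∀ v : TangentSpace (𝓡 n) s, ip (mfderiv (𝓡 n) 𝓘(ℝ, R2 n) x s v) p.1.2 = 0 := by
  obtain ⟨y, hy, h⟩ := AdSGauss.exists_normal (V := EuclideanSpace ℝ (Fin n))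
    (A := mfderiv (𝓡 n) 𝓘(ℝ, R2 n) x s) (by simp) hx.spacelike hx.mem
  exact ⟨⟨_, hy⟩, rfl, h⟩

lemma ip_mfderiv_eq_zero {x : S → R2 n} {s : S} (hx : MDifferentiableAt (𝓡 n) 𝓘(ℝ, R2 n) x s)
    (h : ∀ᶠ s' in 𝓝 s, x s' ∈ AdS n) (v : TangentSpace (𝓡 n) s) :
    ip (mfderiv (𝓡 n) 𝓘(ℝ, R2 n) x s v) (x s) = 0 := by
  have h1 := (hasFDerivAt_ip (hasFDerivAt_id (x s)) (hasFDerivAt_id (x s))).hasMFDerivAt.comp s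
    hx.hasMFDerivAt
  have h2 := hasMFDerivAt_unique h1
    ((hasMFDerivAt_const (-1) s).congr_of_eventuallyEq (f₁ := _) h)
  have h3 : ip (mfderiv (𝓡 n) 𝓘(ℝ, R2 n) x s v) (x s) +
      ip (mfderiv (𝓡 n) 𝓘(ℝ, R2 n) x s v) (x s) = 0 := congrArg (fun L => L v) h2
  linarith

lemma gaussNormal_unique {x : S → R2 n} {s : S} (hx : IsSpacelikeImmersionAt x s)
    (h : ∀ᶠ s' in 𝓝 s, x s' ∈ AdS n) {p q : UT n} (hp : p.1.1 = x s) (hq : q.1.1 = x s)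
    (hp' : ∀ v : TangentSpace (𝓡 n) s, ip (mfderiv (𝓡 n) 𝓘(ℝ, R2 n) x s v) p.1.2 = 0)
    (hq' : ∀ v : TangentSpace (𝓡 n) s, ip (mfderiv (𝓡 n) 𝓘(ℝ, R2 n) x s v) q.1.2 = 0) :
    q = p := by
  obtain ⟨⟨a, b⟩, hab⟩ := p
  obtain ⟨⟨c, d⟩, hcd⟩ := q
  simp only at hp hq hp' hq'
  subst hp hq
  have := normal_unique (V := EuclideanSpace ℝ (Fin n)) (A := mfderiv (𝓡 n) 𝓘(ℝ, R2 n) x s)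
    (by simp) hx.spacelike hab hcd
    (ip_mfderiv_eq_zero (hx.smooth.mdifferentiableAt (by simp)) h) hp' hq'
  subst this
  rfl

variable [IsManifold (𝓡 n) ∞ S]

/-- The future unit normal along a spacelike immersion is smooth. -/
lemma contMDiff_gaussNormal {x : S → R2 n} (hx : ∀ s, IsSpacelikeImmersionAt x s)
    {G : S → UT n} (hG : ∀ s, (G s).1.1 = x s)
    (hG' : ∀ s, ∀ v : TangentSpace (𝓡 n) s, ip (mfderiv (𝓡 n) 𝓘(ℝ, R2 n) x s v) (G s).1.2 = 0) :
    ContMDiff (𝓡 n) (IU n) ∞ G := by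
  apply contMDiff_UT
  have h1 : incl ∘ G = fun s => (x s, (G s).1.2) := funext fun s => Prod.ext (hG s) rfl
  rw [h1]
  intro s₀
  refine (hx s₀).smooth.prodMk_space (contMDiffAt_of_comp_extChartAt_symm s₀ ?_)
  have ht := (isOpen_extChartAt_target (I := 𝓡 n) s₀).mem_nhds (mem_extChartAt_target s₀)
  have hmd : ∀ s, MDifferentiableAt (𝓡 n) 𝓘(ℝ, R2 n) x s := fun s =>
    (hx s).smooth.mdifferentiableAt (by simp)
  refine contDiffAt_normal (F := x ∘ (extChartAt (𝓡 n) s₀).symm) (by simp)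
    (contDiffAt_comp_extChartAt_symm s₀ (mem_extChartAt_target s₀) (hx _).smooth) ?_ ?_ ?_ ?_
  · filter_upwards [ht] with u hu v hv
    rw [fderiv_comp_extChartAt_symm s₀ hu (hmd _)]
    exact (hx _).spacelike _ fun h0 =>
      hv (mfderiv_extChartAt_symm_injective s₀ hu (h0.trans (map_zero _).symm))
  · refine Eventually.of_forall fun u => ?_
    change (x _, _) ∈ _
    rw [← hG]
    exact (G _).2
  · filter_upwards [ht] with u hu v
    rw [fderiv_comp_extChartAt_symm s₀ hu (hmd _)]
    exact ip_mfderiv_eq_zero (hmd _) (Eventually.of_forall fun s => (hx s).mem) _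
  · filter_upwards [ht] with u hu v
    rw [fderiv_comp_extChartAt_symm s₀ hu (hmd _)]
    exact hG' _ _

end Gauss

/-! ### Horizontal maps into the unit timelike bundle and their projections -/

section HorizontalMaps

variable {S : Type*} [TopologicalSpace S] [ChartedSpace (EuclideanSpace ℝ (Fin n)) S]
  {G : S → UT n}

lemma comps_mfderiv_fst {s : S} (hG : MDifferentiableAt (𝓡 n) (IU n) G s)
    (v : TangentSpace (𝓡 n) s) :
    (comps (G s) (mfderiv (𝓡 n) (IU n) G s v)).1 =
      mfderiv (𝓡 n) 𝓘(ℝ, R2 n) (fun s => (G s).1.1) s v := by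
  rw [comps_mfderiv hG]
  have h1 := (ContinuousLinearMap.fst ℝ (R2 n) (R2 n)).hasFDerivAt.hasMFDerivAt.comp s
    ((mdifferentiableAt_incl (G s)).comp s hG).hasMFDerivAt
  exact congrArg (fun L => L v) h1.mfderiv.symm

/-- The kernel of dπ is the line of Z, and λ(Z) = 1, so it contains no nonzero horizontal vector. -/
lemma mfderiv_proj_comp_eq_zero {s : S} (hG : MDifferentiableAt (𝓡 n) (IU n) G s)
    {v : TangentSpace (𝓡 n) s} (h : mfderiv (𝓡 n) (IT n) (fun s => proj (G s)) s v = 0)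
    (hh : ip (comps (G s) (mfderiv (𝓡 n) (IU n) G s v)).1 (G s).1.2 = 0) :
    comps (G s) (mfderiv (𝓡 n) (IU n) G s v) = 0 := by
  have h1 : dproj (G s) (mfderiv (𝓡 n) (IU n) G s v) = 0 := (dproj_mfderiv hG v).trans h
  obtain ⟨c, hc⟩ := (dproj_eq_zero_iff _ _).1 h1
  rw [hc, map_smul, comps_flowField] at hh ⊢
  have h2 : ip (c • reeb (G s).1).1 (G s).1.2 = c * ip (G s).1.2 (G s).1.2 := by
    rw [← ip_smul_left]; rfl
  rw [h2, show ip (G s).1.2 (G s).1.2 = -1 from (G s).2.2.2.1] at hh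
  rw [show c = 0 by linarith, zero_smul]

variable [IsManifold (𝓡 n) ∞ S]

/-- A map orthogonal to the geodesic flow is isotropic for the differential of the Liouville
form. -/
lemma sympl_comps_eq_zero (hG : ContMDiff (𝓡 n) (IU n) ∞ G)
    (hh : ∀ (s : S) (v : TangentSpace (𝓡 n) s),
      ip (comps (G s) (mfderiv (𝓡 n) (IU n) G s v)).1 (G s).1.2 = 0)
    (s : S) (v w : TangentSpace (𝓡 n) s) :
    sympl (comps (G s) (mfderiv (𝓡 n) (IU n) G s v))
      (comps (G s) (mfderiv (𝓡 n) (IU n) G s w)) = 0 := by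
  have hH : ContMDiff (𝓡 n) 𝓘(ℝ, R2 n × R2 n) ∞ (incl ∘ G) := contMDiff_incl.comp hG
  have hmd : ∀ s, MDifferentiableAt (𝓡 n) (IU n) G s := fun s =>
    hG.mdifferentiableAt (by simp)
  have hHd : ∀ s, MDifferentiableAt (𝓡 n) 𝓘(ℝ, R2 n × R2 n) (incl ∘ G) s :=
    fun s => hH.mdifferentiableAt (by simp)
  -- Horizontality makes the pullback of λ vanish on a whole neighbourhood in the chart, so its
  -- exterior derivative vanishes too.
  have h0 : pullLiouville ((incl ∘ G) ∘ (extChartAt (𝓡 n) s).symm) =ᶠ[𝓝 (extChartAt (𝓡 n) s s)]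
      0 := by
    filter_upwards [(isOpen_extChartAt_target (I := 𝓡 n) s).mem_nhds (mem_extChartAt_target s)]
      with u hu
    ext a
    change -ip (fderiv ℝ ((incl ∘ G) ∘ (extChartAt (𝓡 n) s).symm) u (a 0)).1
      (G ((extChartAt (𝓡 n) s).symm u)).1.2 = 0
    rw [fderiv_comp_extChartAt_symm s hu (hHd _), ← comps_mfderiv (hmd _), hh, neg_zero]
  rw [comps_mfderiv (hmd s), comps_mfderiv (hmd s)]
  have hch := mfderiv_eq_fderiv_extChartAt_symm s (mem_extChartAt_source s) (hHd s)
  refine (congrArg₂ sympl (hch v) (hch w)).trans ((extDeriv_pullLiouville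
    (contDiffAt_comp_extChartAt_symm s (mem_extChartAt_target s) (hH _)) _ _).symm.trans ?_)
  have hz : extDeriv (0 : EuclideanSpace ℝ (Fin n) →
      EuclideanSpace ℝ (Fin n) [⋀^Fin 1]→L[ℝ] ℝ) (extChartAt (𝓡 n) s s) = 0 := by
    rw [extDeriv, fderiv_zero]
    exact map_zero (ContinuousAlternatingMap.alternatizeUncurryFinCLM ℝ
      (EuclideanSpace ℝ (Fin n)) ℝ)
  rw [h0.extDeriv_eq, hz]
  rfl

lemma pullback_proj_comp_symplTG (hG : ContMDiff (𝓡 n) (IU n) ∞ G)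
    (hh : ∀ (s : S) (v : TangentSpace (𝓡 n) s),
      ip (comps (G s) (mfderiv (𝓡 n) (IU n) G s v)).1 (G s).1.2 = 0) :
    DForm.pullback (𝓡 n) (fun s => proj (G s)) (symplTG n) = 0 := by
  funext s
  ext v
  have h := (symplTG_dproj (G s) (mfderiv (𝓡 n) (IU n) G s (v 0))
    (mfderiv (𝓡 n) (IU n) G s (v 1))).trans (sympl_comps_eq_zero hG hh s (v 0) (v 1))
  have hmd : MDifferentiableAt (𝓡 n) (IU n) G s := hG.mdifferentiableAt (by simp)
  rw [dproj_mfderiv hmd, dproj_mfderiv hmd] at h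
  refine Eq.trans ?_ h
  change symplTG n (proj (G s)) (mfderiv (𝓡 n) (IT n) (fun s => proj (G s)) s ∘ v) = _
  congr 1
  ext1 i
  fin_cases i <;> rfl

end HorizontalMaps

/-! ### Timelike geodesics close to one that meets a spacelike hypersurface -/

section OpenMapping

/-- A retraction of a neighbourhood of the unit timelike bundle in the space of pairs `(x, y)` with
`x` in anti-de Sitter space. -/
def unitize (q : R2 n × R2 n) : R2 n × R2 n :=
  (q.1, (√(-ip (q.2 + ip q.2 q.1 • q.1) (q.2 + ip q.2 q.1 • q.1)))⁻¹ • (q.2 + ip q.2 q.1 • q.1))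

lemma unitize_eq_self {p : R2 n × R2 n} (hp : p ∈ unitSet n) : unitize p = p := by
  have h1 : ip p.2 p.1 = 0 := by rw [ip_comm]; exact hp.2.1
  simp [unitize, h1, show ip p.2 p.2 = -1 from hp.2.2.1]

lemma contDiffAt_unitize {p : R2 n × R2 n} (hp : p ∈ unitSet n) : ContDiffAt ℝ ∞ unitize p := by
  have h1 : ContDiff ℝ ∞ fun q : R2 n × R2 n => q.2 + ip q.2 q.1 • q.1 :=
    contDiff_snd.add ((contDiff_ip.comp (contDiff_snd.prodMk contDiff_fst)).smul contDiff_fst)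
  have h2 : ContDiff ℝ ∞ fun q : R2 n × R2 n =>
      -ip (q.2 + ip q.2 q.1 • q.1) (q.2 + ip q.2 q.1 • q.1) :=
    (contDiff_ip.comp (h1.prodMk h1)).neg
  have h3 : -ip (p.2 + ip p.2 p.1 • p.1) (p.2 + ip p.2 p.1 • p.1) = 1 := by
    have h1 : ip p.2 p.1 = 0 := by rw [ip_comm]; exact hp.2.1
    simp [h1, show ip p.2 p.2 = -1 from hp.2.2.1]
  exact contDiffAt_fst.prodMk (((h2.contDiffAt.sqrt (by simp [h3])).inv
    (by simp [h3])).smul h1.contDiffAt)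

lemma eventually_unitize_mem {p : R2 n × R2 n} (hp : p ∈ unitSet n) :
    ∀ᶠ q in 𝓝 p, q.1 ∈ AdS n → unitize q ∈ unitSet n := by
  have hc := (contDiffAt_unitize hp).continuousAt
  have hd : Continuous fun q : R2 n × R2 n => ip q.2 (dtheta q.1) := by
    simp only [ip_dtheta]; fun_prop
  have h1 : ∀ᶠ q in 𝓝 p, ip (unitize q).2 (dtheta (unitize q).1) < 0 := by
    refine (hd.continuousAt.comp hc).eventually_lt continuousAt_const ?_
    simp only [Function.comp, unitize_eq_self hp]
    exact hp.2.2.2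
  have hm : Continuous fun q : R2 n × R2 n =>
      ip (q.2 + ip q.2 q.1 • q.1) (q.2 + ip q.2 q.1 • q.1) := by
    have hi : Continuous fun q : R2 n × R2 n => ip q.1 q.2 := contDiff_ip.continuous
    have h1 : Continuous fun q : R2 n × R2 n => q.2 + ip q.2 q.1 • q.1 :=
      continuous_snd.add ((hi.comp (continuous_snd.prodMk continuous_fst)).smul continuous_fst)
    exact hi.comp (h1.prodMk h1)
  have h2 : ∀ᶠ q in 𝓝 p, ip (q.2 + ip q.2 q.1 • q.1) (q.2 + ip q.2 q.1 • q.1) < 0 := by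
    refine hm.continuousAt.eventually_lt continuousAt_const ?_
    have h1 : ip p.2 p.1 = 0 := by rw [ip_comm]; exact hp.2.1
    simp [h1, show ip p.2 p.2 = -1 from hp.2.2.1]
  filter_upwards [h1, h2] with q e1 e2 hq
  have hq' : ip q.1 q.1 = -1 := hq
  refine ⟨hq, ?_, ?_, e1⟩
  · simp only [unitize]
    rw [ip_smul_right, ip_add_right q.1, ip_smul_right, hq', ip_comm q.2 q.1]
    ring
  · have h0 : 0 < √(-ip (q.2 + ip q.2 q.1 • q.1) (q.2 + ip q.2 q.1 • q.1)) :=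
      Real.sqrt_pos.2 (neg_pos.2 e2)
    simp only [unitize]
    rw [ip_smul_left, ip_smul_right, ← mul_assoc, ← mul_inv, Real.mul_self_sqrt (by linarith),
      inv_mul_eq_div, div_eq_iff (by linarith)]
    ring

/-- The map fixes the bundle pointwise, so its differential fixes every tangent vector. -/
lemma fderiv_unitize (p : UT n) {a : R2 n × R2 n} (ha : a ∈ tanSpace p.1) :
    fderiv ℝ unitize p.1 a = a := by
  obtain ⟨v, rfl⟩ := exists_comps_eq p ha
  have h1 := ((contDiffAt_unitize p.2).differentiableAt (by simp)).hasFDerivAt.hasMFDerivAt.comp p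
    (hasMFDerivAt_incl p)
  have h2 : unitize ∘ incl = incl (n := n) := funext fun q => unitize_eq_self q.2
  exact congrArg (fun L => L v) (hasMFDerivAt_unique
    (h1.congr_of_eventuallyEq (Eventually.of_forall fun q => (congrFun h2 q).symm))
    (hasMFDerivAt_incl p))

/-- The timelike geodesics close to one that meets a spacelike hypersurface meet it as well. -/
lemma eventually_exists_mem_geodesicOf {V : Type*} [NormedAddCommGroup V] [NormedSpace ℝ V]
    [FiniteDimensional ℝ V] (hV : Module.finrank ℝ V = n) {F : V → R2 n} {u₀ : V}
    (hF : ContDiffAt ℝ ∞ F u₀) (hs : IsSpacelikeMap (fderiv ℝ F u₀))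
    (hx : ∀ v, ip (fderiv ℝ F u₀ v) (F u₀) = 0) (hA : ∀ᶠ u in 𝓝 u₀, F u ∈ AdS n)
    (p : UT n) (hp : p.1.1 = F u₀) {U : Set V} (hU : U ∈ 𝓝 u₀) :
    ∀ᶠ τ in 𝓝 (proj p), ∃ u ∈ U, F u ∈ geodesicOf τ := by
  -- The normal Y only serves to decompose vectors; the given geodesic p need not be orthogonal to
  -- the hypersurface.
  obtain ⟨Y, hY, hY'⟩ := exists_normal hV hs (x := F u₀) hA.self_of_nhds
  -- A geodesic is produced from a point of the hypersurface and a free direction, which `unitize`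
  -- turns into a unit tangent vector. The open mapping theorem applies once the differential of (u,
  -- y) ↦ coordinates of this geodesic is onto.
  set Q₁ : V × R2 n → R2 n × R2 n := fun a => (F a.1, a.2) with hQ₁
  have e0 : Q₁ (u₀, p.1.2) = p.1 := Prod.ext hp.symm rfl
  have d1 : HasStrictFDerivAt Q₁
      (((fderiv ℝ F u₀).comp (ContinuousLinearMap.fst ℝ V (R2 n))).prod
        (ContinuousLinearMap.snd ℝ V (R2 n))) (u₀, p.1.2) :=
    ((hF.hasStrictFDerivAt (by simp)).comp (u₀, p.1.2) hasStrictFDerivAt_fst).prodMk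
      hasStrictFDerivAt_snd
  have d2 : HasStrictFDerivAt unitize (fderiv ℝ unitize p.1) (Q₁ (u₀, p.1.2)) := by
    rw [e0]; exact (contDiffAt_unitize p.2).hasStrictFDerivAt (by simp)
  have e1 : unitize (Q₁ (u₀, p.1.2)) = p.1 := by rw [e0, unitize_eq_self p.2]
  have d3 : HasStrictFDerivAt ambCoord (dCoord p.1) (unitize (Q₁ (u₀, p.1.2))) := by
    rw [e1]
    exact (contDiffAt_ambCoord (zeta_ne_zero p.2)).hasStrictFDerivAt'
      (hasFDerivAt_ambCoord (zeta_ne_zero p.2)) (by simp)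
  have d4 := d3.comp (u₀, p.1.2) (d2.comp (u₀, p.1.2) d1)
  have hsurj := d4.map_nhds_eq_of_surj (LinearMap.range_eq_top.2 ?_)
  · have e2 : ambCoord (unitize (Q₁ (u₀, p.1.2))) = coord (proj p) := by
      rw [e1]; rfl
    have hev : ∀ᶠ a in 𝓝 (u₀, p.1.2), a.1 ∈ U ∧ unitize (Q₁ a) ∈ unitSet n := by
      have h1 : ∀ᶠ a in 𝓝 (u₀, p.1.2), a.1 ∈ U := continuousAt_fst hU
      have h2 : ∀ᶠ a in 𝓝 (u₀, p.1.2), F a.1 ∈ AdS n :=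
        (continuousAt_fst (p := (u₀, p.1.2))).eventually hA
      have h3 : ∀ᶠ a in 𝓝 (u₀, p.1.2), (Q₁ a).1 ∈ AdS n → unitize (Q₁ a) ∈ unitSet n := by
        have := d1.continuousAt
        rw [ContinuousAt, e0] at this
        exact this.eventually (eventually_unitize_mem p.2)
      filter_upwards [h1, h2, h3] with a a1 a2 a3 using ⟨a1, a3 a2⟩
    have him := image_mem_map (m := fun a => ambCoord (unitize (Q₁ a))) hev
    rw [hsurj, e2] at him
    filter_upwards [continuous_coord.continuousAt him] with τ hτ
    obtain ⟨a, ⟨ha, ha'⟩, haτ⟩ := hτ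
    exact ⟨a.1, ha, ⟨_, ha'⟩, coord_injective haτ, rfl⟩
  · intro ξ
    obtain ⟨a, ha, -, rfl⟩ := exists_tanSpace_eq p.2 ξ
    obtain ⟨v, α, β, h1⟩ := exists_decomp hV hs hY hx hY' a.1
    obtain ⟨v', α', β', h2⟩ := exists_decomp hV hs hY hx hY' p.1.2
    have i1 : ip (F u₀) (F u₀) = -1 := hY.1
    have i2 : ip Y (F u₀) = 0 := by rw [ip_comm]; exact hY.2.1
    have i3 : ip Y Y = -1 := hY.2.2.1
    have hα : α = 0 := by
      have := ha.1
      rw [hp, h1, ip_add_left, ip_add_left, ip_smul_left, ip_smul_left, hx, i1, i2] at this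
      linarith
    have hα' : α' = 0 := by
      have : ip p.1.1 p.1.2 = 0 := p.2.2.1
      rw [ip_comm, hp, h2, ip_add_left, ip_add_left, ip_smul_left, ip_smul_left, hx, i1, i2] at this
      linarith
    subst hα hα'
    -- The timelike velocity of p is transverse to the spacelike hypersurface.
    have hβ : β' ≠ 0 := by
      rintro rfl
      have h3 : ip p.1.2 p.1.2 = -1 := p.2.2.2.1
      simp only [zero_smul, add_zero] at h2
      rw [h2] at h3
      by_cases hv : v' = 0
      · rw [hv, map_zero, ip_zero_left] at h3; norm_num at h3
      · have := hs v' hv; linarith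
    -- Subtracting this multiple of the flow field, invisible to `dCoord`, cancels the normal
    -- component of a.1, so the moved base point stays on the hypersurface to first order.
    have hb : a - (β / β') • reeb p.1 ∈ tanSpace p.1 :=
      sub_mem ha (Submodule.smul_mem _ _ (reeb_mem p.2))
    have hb1 : (a - (β / β') • reeb p.1).1 = fderiv ℝ F u₀ (v - (β / β') • v') := by
      have : (reeb p.1).1 = p.1.2 := rfl
      rw [Prod.fst_sub, Prod.smul_fst, this, h1, h2, map_sub, map_smul]
      simp only [zero_smul, add_zero, smul_add, smul_smul, div_mul_cancel₀ β hβ]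
      abel
    refine ⟨(v - (β / β') • v', (a - (β / β') • reeb p.1).2), ?_⟩
    have e3 : ((fderiv ℝ F u₀) (v - (β / β') • v'), (a - (β / β') • reeb p.1).2) =
        a - (β / β') • reeb p.1 := Prod.ext hb1.symm rfl
    change dCoord p.1 (fderiv ℝ unitize p.1
      ((fderiv ℝ F u₀) (v - (β / β') • v'), (a - (β / β') • reeb p.1).2)) = _
    rw [e3, fderiv_unitize p hb, map_sub, map_smul, dCoord_reeb (zeta_ne_zero p.2), smul_zero,
      sub_zero]

end OpenMapping

/-! ### The Gauss map of a spacelike hypersurface -/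

section GaussMap

variable {S : Type*} [TopologicalSpace S] [ChartedSpace (EuclideanSpace ℝ (Fin n)) S]
  [IsManifold (𝓡 n) ∞ S]

instance : T2Space (TG n) := isOpenEmbedding_coord.isEmbedding.t2Space

/-- The timelike geodesics close to one that meets a spacelike hypersurface at a given point meet
it close to that point. -/
lemma eventually_exists_mem_geodesicOf_image {x : S → R2 n} (hx : ∀ s, IsSpacelikeImmersionAt x s)
    {s₀ : S} {τ₀ : TG n} (h : x s₀ ∈ geodesicOf τ₀) {U : Set S} (hU : U ∈ 𝓝 s₀) :
    ∀ᶠ τ in 𝓝 τ₀, ∃ s ∈ U, x s ∈ geodesicOf τ := by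
  obtain ⟨p, rfl, hp⟩ := h
  have hmd : ∀ s, MDifferentiableAt (𝓡 n) 𝓘(ℝ, R2 n) x s := fun s =>
    (hx s).smooth.mdifferentiableAt (by simp)
  have ht := mem_extChartAt_target (I := 𝓡 n) s₀
  have hU' : ∀ᶠ u in 𝓝 (extChartAt (𝓡 n) s₀ s₀), (extChartAt (𝓡 n) s₀).symm u ∈ U :=
    eventually_extChartAt_symm s₀ (P := (· ∈ U)) hU
  have key := eventually_exists_mem_geodesicOf (F := x ∘ (extChartAt (𝓡 n) s₀).symm) (by simp)
    (contDiffAt_comp_extChartAt_symm s₀ ht (hx _).smooth) ?_ ?_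
    (Eventually.of_forall fun u => (hx _).mem) p ?_ hU'
  · filter_upwards [key] with τ hτ
    obtain ⟨u, hu, hu'⟩ := hτ
    exact ⟨_, hu, hu'⟩
  · intro v hv
    rw [fderiv_comp_extChartAt_symm s₀ ht (hmd _)]
    exact (hx _).spacelike _ fun h0 =>
      hv (mfderiv_extChartAt_symm_injective s₀ ht (h0.trans (map_zero _).symm))
  · intro v
    rw [fderiv_comp_extChartAt_symm s₀ ht (hmd _)]
    exact ip_mfderiv_eq_zero (hmd _) (Eventually.of_forall fun s => (hx s).mem) _
  · rw [hp, Function.comp_apply, extChartAt_to_inv]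

/-- The Gauss map is the projection of the horizontal lift G by the future normal. The topological
claims follow from `hnhds`. -/
theorem exists_gaussMap (x : S → R2 n) (hx : ∀ s, IsSpacelikeImmersionAt x s) :
    ∃ ν : S → TG n,
      (∀ s τ, IsGaussImageAt x s τ ↔ τ = ν s) ∧
      IsLagrangianImmersion (symplTG n) ν ∧
      (IsEmbedding x →
        (∀ τ, (geodesicOf τ ∩ Set.range x).Subsingleton) →
          IsEmbedding ν ∧
          ((∀ τ, (geodesicOf τ ∩ Set.range x).Nonempty) → IsClosed (Set.range ν))) := by
  choose G hG hG' using fun s => (hx s).exists_normal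
  have hGs := contMDiff_gaussNormal hx hG hG'
  have hGd : ∀ s, MDifferentiableAt (𝓡 n) (IU n) G s := fun s => hGs.mdifferentiableAt (by simp)
  have hGx : (fun s => (G s).1.1) = x := funext hG
  have hfst : ∀ (s : S) (v : TangentSpace (𝓡 n) s),
      (comps (G s) (mfderiv (𝓡 n) (IU n) G s v)).1 = mfderiv (𝓡 n) 𝓘(ℝ, R2 n) x s v := by
    intro s v
    rw [comps_mfderiv_fst (hGd s), hGx]
    rfl
  have hh : ∀ (s : S) (v : TangentSpace (𝓡 n) s),
      ip (comps (G s) (mfderiv (𝓡 n) (IU n) G s v)).1 (G s).1.2 = 0 := fun s v => by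
    rw [hfst]; exact hG' s v
  have hmem : ∀ s, x s ∈ geodesicOf (proj (G s)) := fun s => ⟨G s, rfl, hG s⟩
  refine ⟨fun s => proj (G s), ?_, ⟨contMDiff_proj.comp hGs, ?_,
    pullback_proj_comp_symplTG hGs hh⟩, ?_⟩
  · intro s τ
    constructor
    · rintro ⟨p, hp, rfl, hp'⟩
      rw [gaussNormal_unique (hx s) (Eventually.of_forall fun s => (hx s).mem) (hG s) hp (hG' s) hp']
    · rintro rfl
      exact ⟨G s, hG s, rfl, hG' s⟩
  · intro s
    refine (injective_iff_map_eq_zero _).2 fun v hv => by_contra fun h0 => ?_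
    have h1 := mfderiv_proj_comp_eq_zero (hGd s) hv (hh s v)
    have h2 := (hx s).spacelike v h0
    rw [← hfst, h1] at h2
    simp only [Prod.fst_zero, ip_zero_left] at h2
    exact lt_irrefl _ h2
  · intro hemb hsub
    have huniq : ∀ s s', x s ∈ geodesicOf (proj (G s')) → s = s' := fun s s' h =>
      hemb.injective (hsub _ ⟨h, mem_range_self s⟩ ⟨hmem s', mem_range_self s'⟩)
    have hcont : Continuous fun s => proj (G s) := continuous_proj.comp hGs.continuous
    -- If the geodesic τ passes through x(s), then any normal geodesic close to τ meets the
    -- hypersurface close to x(s). As it meets it only once, its foot is close to s. The geodesic τ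
    -- need not be normal at s, which is what closedness requires.
    have hnhds : ∀ {s : S} {τ : TG n}, x s ∈ geodesicOf τ → ∀ U ∈ 𝓝 s,
        ∀ᶠ τ' in 𝓝 τ, ∀ s', proj (G s') = τ' → s' ∈ U := by
      intro s τ hτ U hU
      filter_upwards [eventually_exists_mem_geodesicOf_image hx hτ hU] with τ' hτ' s' hs'
      obtain ⟨s'', hs, hs2⟩ := hτ'
      rw [← hs'] at hs2
      rwa [← huniq _ _ hs2]
    refine ⟨⟨?_, ?_⟩, ?_⟩
    · rw [isInducing_iff_nhds]
      intro s
      refine le_antisymm hcont.continuousAt.le_comap ?_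
      intro U hU
      exact ⟨_, hnhds (hmem s) U hU, fun s' h => h s' rfl⟩
    · intro s s' h
      refine huniq s s' ?_
      have := hmem s
      rwa [show proj (G s) = proj (G s') from h] at this
    · intro hne
      refine isClosed_of_closure_subset fun τ hτ => ?_
      obtain ⟨_, hs, ⟨s, rfl⟩⟩ := hne τ
      refine ⟨s, by_contra fun h => ?_⟩
      -- If τ differed from the normal geodesic at s, disjoint neighbourhoods would separate them,
      -- but normal geodesics close to τ have feet close to s and so are close to that normal
      -- geodesic.
      obtain ⟨V₁, V₂, o₁, o₂, m₁, m₂, hd⟩ := t2_separation h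
      have h1 := hnhds hs _ (hcont.continuousAt.preimage_mem_nhds (o₁.mem_nhds m₁))
      obtain ⟨τ', ⟨h2, h3⟩, ⟨s', rfl⟩⟩ :=
        mem_closure_iff_nhds.1 hτ _ (inter_mem h1 (o₂.mem_nhds m₂))
      exact disjoint_left.1 hd (h2 s' rfl) h3

end GaussMap

/-! ### Gluing of local functions on simply connected spaces -/

section Gluing

/-- On a simply connected space, local functions that differ by locally constant functions can be
corrected by locally constant functions to become a global function. -/
lemma exists_glue {S A : Type*} [TopologicalSpace S] [SimplyConnectedSpace S]
    [LocallyPathConnectedSpace S] [AddCommGroup A] (U : S → Set S) (hU : ∀ s, IsOpen (U s))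
    (hm : ∀ s, s ∈ U s) (f : S → S → A)
    (hf : ∀ i j, ∀ x ∈ U i ∩ U j, ∀ᶠ y in 𝓝 x, f i y - f j y = f i x - f j x) :
    ∃ g : S → A, ∀ x, ∀ᶠ y in 𝓝 x, g y - f x y = g x - f x x := by
  let _ : TopologicalSpace A := ⊥
  have : DiscreteTopology A := ⟨rfl⟩
  -- The values a global function may take at x form a bundle with discrete fibre: the coordinate v
  -- in index i stands for the value v + f i x. The transition functions are locally constant by
  -- `hf`, so this is a covering, and the identity of S lifts to a section.
  let Z : FiberBundleCore S S A :=
    { baseSet := U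
      isOpen_baseSet := hU
      indexAt := id
      mem_baseSet_at := hm
      coordChange := fun i j x v => v + (f i x - f j x)
      coordChange_self := fun i x _ v => by simp
      continuousOn_coordChange := by
        rintro i j ⟨x, v⟩ ⟨hx, -⟩
        refine ContinuousAt.continuousWithinAt ?_
        have h1 : ∀ᶠ p : S × A in 𝓝 (x, v), f i p.1 - f j p.1 = f i x - f j x :=
          (continuousAt_fst (p := (x, v))).eventually (hf i j x hx)
        have h2 : ∀ᶠ p : S × A in 𝓝 (x, v), p.2 = v :=
          (continuousAt_snd (p := (x, v))).eventually (p := fun a => a = v) (by simp [nhds_discrete])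
        refine (continuousAt_const (y := v + (f i x - f j x))).congr ?_
        filter_upwards [h1, h2] with p e1 e2
        rw [e1, e2]
      coordChange_comp := fun i j k x _ v => by abel }
  have hcov : IsCoveringMap (Bundle.TotalSpace.proj (F := A) (E := Z.Fiber)) :=
    FiberBundle.isCoveringMap
  obtain ⟨s₀⟩ : Nonempty S := inferInstance
  obtain ⟨F, ⟨-, hF⟩, -⟩ := hcov.existsUnique_continuousMap_lifts (ContinuousMap.id S) s₀
    (Bundle.TotalSpace.mk s₀ (0 : A)) rfl
  have hF1 : ∀ x, (F x).1 = x := fun x => congrFun hF x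
  let σ : S → A := fun x => (F x).2
  refine ⟨fun x => σ x + f x x, fun x => ?_⟩
  -- Read in the fixed index x, the section is continuous into a discrete space, hence locally
  -- constant; this coordinate is exactly g y - f x y.
  have h1 : ContinuousAt (fun y => (Z.localTriv x (F y)).2) x :=
    continuousAt_snd.comp (((Z.localTriv x).continuousAt (by
      change (F x).1 ∈ U x
      rw [hF1]; exact hm x)).comp F.continuous.continuousAt)
  have h2 : ∀ y, (Z.localTriv x (F y)).2 = σ y + (f y y - f x y) := by
    intro y
    change σ y + (f (F y).1 (F y).1 - f x (F y).1) = _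
    rw [hF1]
  have h3 := h1.eventually (p := fun a => a = (Z.localTriv x (F x)).2) (by simp [nhds_discrete])
  filter_upwards [h3] with y hy
  rw [h2, h2] at hy
  rw [add_sub_assoc, hy]
  abel

end Gluing

/-! ### Primitives of the Liouville form along isotropic maps -/

section Primitive

/-- The Liouville form, up to sign, pulled back by a map from a vector space. -/
def ambPrimitive {E : Type*} [NormedAddCommGroup E] [NormedSpace ℝ E] (F : E → R2 n × R2 n)
    (u : E) : E →L[ℝ] ℝ :=
  (ipL (F u).2).comp ((ContinuousLinearMap.fst ℝ (R2 n) (R2 n)).comp (fderiv ℝ F u))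

lemma contDiffAt_ambPrimitive {E : Type*} [NormedAddCommGroup E] [NormedSpace ℝ E]
    {F : E → R2 n × R2 n} {u : E} (hF : ContDiffAt ℝ ∞ F u) :
    ContDiffAt ℝ ∞ (ambPrimitive F) u :=
  ((ipB n).contDiff.contDiffAt.comp u hF.snd).clm_comp
    (contDiffAt_const.clm_comp (hF.fderiv_right (by simp)))

/-- Closedness of the pulled-back Liouville form on (v, w), written as symmetry of a derivative, the
form needed by the Poincaré lemma. -/
lemma fderiv_ambPrimitive_symm {E : Type*} [NormedAddCommGroup E] [NormedSpace ℝ E]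
    {F : E → R2 n × R2 n} {u : E} (hF : ContDiffAt ℝ ∞ F u) (v w : E)
    (h : sympl (fderiv ℝ F u v) (fderiv ℝ F u w) = 0) :
    fderiv ℝ (ambPrimitive F) u v w = fderiv ℝ (ambPrimitive F) u w v := by
  have hd : DifferentiableAt ℝ (ambPrimitive F) u :=
    (contDiffAt_ambPrimitive hF).differentiableAt (by simp)
  have key : ∀ a b : E, fderiv ℝ (fun u' => pullLiouville F u' ![a]) u b =
      -fderiv ℝ (ambPrimitive F) u b a := by
    intro a b
    have h1 : HasFDerivAt (fun u' => -(ambPrimitive F u' a)) _ u :=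
      (hd.hasFDerivAt.clm_apply (hasFDerivAt_const a u)).neg
    have h2 : (fun u' => pullLiouville F u' ![a]) = fun u' => -(ambPrimitive F u' a) := rfl
    rw [h2, h1.fderiv]
    simp
  have h1 := (extDeriv_pullLiouville hF v w).trans h
  rw [extDeriv_apply ((contDiffAt_pullLiouville hF).differentiableAt (by simp))] at h1
  have h2 := (Fin.sum_univ_two _).symm.trans h1
  have e0 : Fin.removeNth (0 : Fin 2) ![v, w] = ![w] := by ext1 i; fin_cases i; rfl
  have e1 : Fin.removeNth (1 : Fin 2) ![v, w] = ![v] := by ext1 i; fin_cases i; rfl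
  simp only [e0, e1, key] at h2
  simp at h2
  linarith

variable {S : Type*} [TopologicalSpace S] [ChartedSpace (EuclideanSpace ℝ (Fin n)) S]

lemma eventually_eq_of_hasMFDerivAt_zero [IsManifold (𝓡 n) ∞ S] {g : S → ℝ} {x : S}
    (h : ∀ᶠ y in 𝓝 x, HasMFDerivAt (𝓡 n) 𝓘(ℝ, ℝ) g y 0) : ∀ᶠ y in 𝓝 x, g y = g x := by
  set u₀ := extChartAt (𝓡 n) x x with hu₀
  have h1 : ∀ᶠ u in 𝓝 u₀, HasFDerivAt (g ∘ (extChartAt (𝓡 n) x).symm)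
      (0 : EuclideanSpace ℝ (Fin n) →L[ℝ] ℝ) u := by
    filter_upwards [eventually_extChartAt_symm x h,
      (isOpen_extChartAt_target (I := 𝓡 n) x).mem_nhds (mem_extChartAt_target x)] with u e1 e2
    have := e1.comp u (mdifferentiableAt_extChartAt_symm' x e2).hasMFDerivAt
    have h3 := this.hasFDerivAt
    exact h3.congr_fderiv (ContinuousLinearMap.ext fun v : EuclideanSpace ℝ (Fin n) => rfl)
  obtain ⟨r, hr, hb⟩ := Metric.eventually_nhds_iff_ball.1 h1
  have h2 : ∀ᶠ u in 𝓝 u₀, g ((extChartAt (𝓡 n) x).symm u) = g x := by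
    filter_upwards [Metric.ball_mem_nhds u₀ hr] with u hu
    have := Metric.isOpen_ball.is_const_of_fderiv_eq_zero (𝕜 := ℝ)
      (convex_ball u₀ r).isPreconnected
      (fun u hu => (hb u hu).differentiableAt.differentiableWithinAt)
      (fun u hu => (hb u hu).fderiv) hu (Metric.mem_ball_self hr)
    simp only [Function.comp_apply] at this
    rw [this, hu₀, extChartAt_to_inv]
  filter_upwards [(continuousAt_extChartAt (I := 𝓡 n) x).eventually h2,
    extChartAt_source_mem_nhds (I := 𝓡 n) x] with y e1 e2
  rwa [(extChartAt (𝓡 n) x).left_inv e2] at e1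

/-- The Liouville form, up to sign, pulled back by a map from a manifold. -/
def mfdPrimitive (H : S → R2 n × R2 n) (s : S) : TangentSpace (𝓡 n) s →L[ℝ] ℝ :=
  (ipL (H s).2).comp ((ContinuousLinearMap.fst ℝ (R2 n) (R2 n)).comp
    (mfderiv (𝓡 n) 𝓘(ℝ, R2 n × R2 n) H s))

lemma mfdPrimitive_apply (H : S → R2 n × R2 n) (s : S) (v : TangentSpace (𝓡 n) s) :
    mfdPrimitive H s v = ip (mfderiv (𝓡 n) 𝓘(ℝ, R2 n × R2 n) H s v).1 (H s).2 := rfl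

variable [IsManifold (𝓡 n) ∞ S]

/-- The Poincaré lemma on a ball inside a chart, transported to the manifold. -/
lemma exists_local_primitive {H : S → R2 n × R2 n} (hH : ContMDiff (𝓡 n) 𝓘(ℝ, R2 n × R2 n) ∞ H)
    (h0 : ∀ (s : S) (v w : TangentSpace (𝓡 n) s), sympl (mfderiv (𝓡 n) 𝓘(ℝ, R2 n × R2 n) H s v)
      (mfderiv (𝓡 n) 𝓘(ℝ, R2 n × R2 n) H s w) = 0) (s₀ : S) :
    ∃ U : Set S, IsOpen U ∧ s₀ ∈ U ∧ ∃ f : S → ℝ, ∀ s ∈ U,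
      HasMFDerivAt (𝓡 n) 𝓘(ℝ, ℝ) f s (mfdPrimitive H s) := by
  set K := H ∘ (extChartAt (𝓡 n) s₀).symm with hK
  have hHd : ∀ s, MDifferentiableAt (𝓡 n) 𝓘(ℝ, R2 n × R2 n) H s := fun s =>
    hH.mdifferentiableAt (by simp)
  obtain ⟨r, hr, hb⟩ := Metric.isOpen_iff.1 (isOpen_extChartAt_target (I := 𝓡 n) s₀) _
    (mem_extChartAt_target s₀)
  have hKs : ∀ u ∈ Metric.ball (extChartAt (𝓡 n) s₀ s₀) r, ContDiffAt ℝ ∞ K u := fun u hu =>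
    contDiffAt_comp_extChartAt_symm s₀ (hb hu) (hH _)
  obtain ⟨f, hf⟩ := (convex_ball (extChartAt (𝓡 n) s₀ s₀)
    r).exists_forall_hasFDerivAt_of_fderiv_symmetric Metric.isOpen_ball
    (show DifferentiableOn ℝ (ambPrimitive K) _ from fun u hu =>
      ((contDiffAt_ambPrimitive (hKs u hu)).differentiableAt (by simp)).differentiableWithinAt)
    (fun u hu v w => fderiv_ambPrimitive_symm (hKs u hu) v w (by
      refine (congrArg₂ sympl (fderiv_comp_extChartAt_symm s₀ (hb hu) (hHd _) v)
        (fderiv_comp_extChartAt_symm s₀ (hb hu) (hHd _) w)).trans ?_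
      exact h0 _ _ _))
  refine ⟨(extChartAt (𝓡 n) s₀).source ∩
    extChartAt (𝓡 n) s₀ ⁻¹' Metric.ball (extChartAt (𝓡 n) s₀ s₀) r,
    isOpen_extChartAt_preimage' s₀ Metric.isOpen_ball,
    ⟨mem_extChartAt_source s₀, Metric.mem_ball_self hr⟩, f ∘ extChartAt (𝓡 n) s₀, ?_⟩
  rintro s ⟨hs, hs'⟩
  have h1 := (hf _ hs').hasMFDerivAt.comp s
    (mdifferentiableAt_extChartAt (by rwa [extChartAt_source] at hs)).hasMFDerivAt
  refine h1.congr_mfderiv (ContinuousLinearMap.ext fun v => Eq.symm ?_)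
  have h2 := mfderiv_eq_fderiv_extChartAt_symm s₀ hs (hHd s) v
  refine (mfdPrimitive_apply H s v).trans ((congrArg (fun a : R2 n × R2 n => ip a.1 (H s).2) h2).trans ?_)
  change _ = ip _ (H _).2
  rw [(extChartAt (𝓡 n) s₀).left_inv hs]
  rfl

/-- Two local primitives differ by a locally constant function, so simple connectedness lets them be
glued by `exists_glue`. -/
lemma exists_primitive [SimplyConnectedSpace S] {H : S → R2 n × R2 n}
    (hH : ContMDiff (𝓡 n) 𝓘(ℝ, R2 n × R2 n) ∞ H)
    (h0 : ∀ (s : S) (v w : TangentSpace (𝓡 n) s), sympl (mfderiv (𝓡 n) 𝓘(ℝ, R2 n × R2 n) H s v)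
      (mfderiv (𝓡 n) 𝓘(ℝ, R2 n × R2 n) H s w) = 0) :
    ∃ h : S → ℝ, ContMDiff (𝓡 n) 𝓘(ℝ, ℝ) ∞ h ∧
      ∀ s, HasMFDerivAt (𝓡 n) 𝓘(ℝ, ℝ) h s (mfdPrimitive H s) := by
  have : LocallyPathConnectedSpace S :=
    ChartedSpace.locallyPathConnectedSpace (EuclideanSpace ℝ (Fin n)) S
  choose U hU hm f hf using exists_local_primitive hH h0
  obtain ⟨h, hh⟩ := exists_glue U hU hm f (by
    intro i j x hx
    refine eventually_eq_of_hasMFDerivAt_zero (n := n) (g := fun y => f i y - f j y) ?_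
    filter_upwards [((hU i).inter (hU j)).mem_nhds hx] with y hy
    have := (hf i y hy.1).sub (hf j y hy.2)
    rw [sub_self] at this
    exact this)
  have hd : ∀ s, HasMFDerivAt (𝓡 n) 𝓘(ℝ, ℝ) h s (mfdPrimitive H s) := by
    intro s
    have h1 := (hf s s (hm s)).add (hasMFDerivAt_const (h s - f s s) s)
    have h2 := h1.congr_of_eventuallyEq (f₁ := h) ?_
    · exact h2.congr_mfderiv (add_zero _)
    filter_upwards [hh s] with y hy
    simp only [Pi.add_apply]
    linarith
  refine ⟨h, fun s₀ => contMDiffAt_of_comp_extChartAt_symm s₀ ?_, hd⟩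
  have ho := isOpen_extChartAt_target (I := 𝓡 n) s₀
  have hHd : ∀ s, MDifferentiableAt (𝓡 n) 𝓘(ℝ, R2 n × R2 n) H s := fun s =>
    hH.mdifferentiableAt (by simp)
  have h1 : ∀ u ∈ (extChartAt (𝓡 n) s₀).target, HasFDerivAt (h ∘ (extChartAt (𝓡 n) s₀).symm)
      (ambPrimitive (H ∘ (extChartAt (𝓡 n) s₀).symm) u) u := by
    intro u hu
    have h2 := ((hd _).comp u (mdifferentiableAt_extChartAt_symm' s₀ hu).hasMFDerivAt).hasFDerivAt
    refine h2.congr_fderiv ?_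
    refine ContinuousLinearMap.ext fun v : EuclideanSpace ℝ (Fin n) => ?_
    exact (congrArg (fun a : R2 n × R2 n => ip a.1 (H ((extChartAt (𝓡 n) s₀).symm u)).2)
      (fderiv_comp_extChartAt_symm s₀ hu (hHd _) v)).symm
  -- The primitive is smooth because its derivative is the smooth form it integrates.
  have h2 : ContDiffOn ℝ ∞ (h ∘ (extChartAt (𝓡 n) s₀).symm) (extChartAt (𝓡 n) s₀).target := by
    rw [contDiffOn_infty_iff_fderiv_of_isOpen ho]
    refine ⟨fun u hu => (h1 u hu).differentiableAt.differentiableWithinAt, ?_⟩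
    have h3 : ContDiffOn ℝ ∞ (ambPrimitive (H ∘ (extChartAt (𝓡 n) s₀).symm))
        (extChartAt (𝓡 n) s₀).target := fun u hu => (contDiffAt_ambPrimitive
      (contDiffAt_comp_extChartAt_symm s₀ hu (hH _))).contDiffWithinAt
    exact h3.congr fun u hu => (h1 u hu).fderiv
  exact h2.contDiffAt (ho.mem_nhds (mem_extChartAt_target s₀))

end Primitive

/-! ### Lifts of Lagrangian immersions -/

section Lift

variable {S : Type*} [TopologicalSpace S] [ChartedSpace (EuclideanSpace ℝ (Fin n)) S]

/-- The differential of the geodesic flow in the time and space variables. -/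
lemma hasFDerivAt_rotPair (a : ℝ × (R2 n × R2 n)) :
    ∃ R' : ℝ × (R2 n × R2 n) →L[ℝ] R2 n × R2 n,
      HasFDerivAt (fun a : ℝ × (R2 n × R2 n) => rotPair (Real.cos a.1) (Real.sin a.1) a.2) R' a ∧
      ∀ (t : ℝ) (q : R2 n × R2 n), R' (t, q) =
        t • reeb (rotPair (Real.cos a.1) (Real.sin a.1) a.2) +
          rotPair (Real.cos a.1) (Real.sin a.1) q := by
  have hc : ContDiff ℝ ∞ fun a : ℝ × (R2 n × R2 n) =>
      rotPair (Real.cos a.1) (Real.sin a.1) a.2 :=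
    contDiff_rotPair.comp (((Real.contDiff_cos.comp contDiff_fst).prodMk
      (Real.contDiff_sin.comp contDiff_fst)).prodMk contDiff_snd)
  have hd := (hc.differentiable (by simp) a).hasFDerivAt
  refine ⟨_, hd, fun t q => ?_⟩
  have h1 : HasFDerivAt (fun s : ℝ => (s, a.2)) (ContinuousLinearMap.inl ℝ ℝ (R2 n × R2 n)) a.1 :=
    hasFDerivAt_prodMk_left a.1 a.2
  have h2 : HasFDerivAt (fun q => (a.1, q)) (ContinuousLinearMap.inr ℝ ℝ (R2 n × R2 n)) a.2 :=
    hasFDerivAt_prodMk_right a.1 a.2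
  have h3 := (hd.comp (f := fun s : ℝ => (s, a.2)) a.1 h1).unique
    (hasDerivAt_rotPair a.2 a.1).hasFDerivAt
  have h4 : HasFDerivAt (fun q => rotPair (Real.cos a.1) (Real.sin a.1) q)
      (rotL (Real.cos a.1) (Real.sin a.1)) a.2 :=
    ((rotL (Real.cos a.1) (Real.sin a.1)).hasFDerivAt (x := a.2)).congr_of_eventuallyEq
      (Eventually.of_forall fun q => (rotL_apply _ _ q).symm)
  have h5 := (hd.comp (f := fun q => (a.1, q)) a.2 h2).unique h4
  have h6 := congrArg (fun L => L t) h3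
  have h7 := congrArg (fun L => L q) h5
  simp only [ContinuousLinearMap.comp_apply, ContinuousLinearMap.inl_apply,
    ContinuousLinearMap.inr_apply, rotL_apply, ContinuousLinearMap.toSpanSingleton_apply] at h6 h7
  rw [← h7, ← h6, ← map_add]
  simp

lemma comps_mfderiv_flow_comp {G : S → UT n} {h : S → ℝ} {s : S} {h' : TangentSpace (𝓡 n) s →L[ℝ] ℝ}
    (hG : MDifferentiableAt (𝓡 n) (IU n) G s) (hh : HasMFDerivAt (𝓡 n) 𝓘(ℝ, ℝ) h s h')
    (hF : MDifferentiableAt (𝓡 n) (IU n) (fun s => flow (h s) (G s)) s)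
    (v : TangentSpace (𝓡 n) s) :
    comps (flow (h s) (G s)) (mfderiv (𝓡 n) (IU n) (fun s => flow (h s) (G s)) s v) =
      h' v • reeb (flow (h s) (G s)).1 + rotPair (Real.cos (h s)) (Real.sin (h s))
        (comps (G s) (mfderiv (𝓡 n) (IU n) G s v)) := by
  obtain ⟨R', hR, hR'⟩ := hasFDerivAt_rotPair (h s, (G s).1)
  refine (comps_mfderiv (f := fun s => flow (h s) (G s)) hF v).trans ?_
  rw [comps_mfderiv hG]
  have h0 := ((mdifferentiableAt_incl (G s)).comp s hG).hasMFDerivAt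
  have h1 := HasMFDerivAt.comp (g := fun a : ℝ × (R2 n × R2 n) =>
    rotPair (Real.cos a.1) (Real.sin a.1) a.2) (f := fun s => (h s, incl (G s))) s hR.hasMFDerivAt
    ⟨hh.1.prodMk h0.1, hh.2.prodMk h0.2⟩
  exact (congrArg (fun L => L v) h1.mfderiv).trans (hR' _ _)

lemma sympl_comps_eq_zero_of_lagrangian {G : S → UT n} (hG : ContMDiff (𝓡 n) (IU n) ∞ G)
    (h : DForm.pullback (𝓡 n) (fun s => proj (G s)) (symplTG n) = 0)
    (s : S) (v w : TangentSpace (𝓡 n) s) :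
    sympl (comps (G s) (mfderiv (𝓡 n) (IU n) G s v))
      (comps (G s) (mfderiv (𝓡 n) (IU n) G s w)) = 0 := by
  have hmd : MDifferentiableAt (𝓡 n) (IU n) G s := hG.mdifferentiableAt (by simp)
  rw [← symplTG_dproj, dproj_mfderiv hmd, dproj_mfderiv hmd]
  have h1 := congrArg (fun L => L ![v, w]) (congrFun h s)
  refine Eq.trans ?_ h1
  change _ = symplTG n (proj (G s)) (mfderiv (𝓡 n) (IT n) (fun s => proj (G s)) s ∘ ![v, w])
  congr 1
  ext1 i
  fin_cases i <;> rfl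

/-- The flow preserves λ and λ(Z) = 1, so flowing for the variable time h adds dh to the pullback of
λ. The sign is reversed here because λ = -⟨ẋ|y⟩. -/
lemma ip_comps_mfderiv_flow_comp {G : S → UT n} {h : S → ℝ} {s : S}
    {h' : TangentSpace (𝓡 n) s →L[ℝ] ℝ}
    (hG : MDifferentiableAt (𝓡 n) (IU n) G s) (hh : HasMFDerivAt (𝓡 n) 𝓘(ℝ, ℝ) h s h')
    (hF : MDifferentiableAt (𝓡 n) (IU n) (fun s => flow (h s) (G s)) s)
    (v : TangentSpace (𝓡 n) s) :
    ip (comps (flow (h s) (G s)) (mfderiv (𝓡 n) (IU n) (fun s => flow (h s) (G s)) s v)).1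
        (flow (h s) (G s)).1.2 =
      ip (comps (G s) (mfderiv (𝓡 n) (IU n) G s v)).1 (G s).1.2 - h' v := by
  rw [comps_mfderiv_flow_comp hG hh hF, Prod.fst_add, ip_add_left, Prod.smul_fst, ip_smul_left]
  have h2 : ip (rotPair (Real.cos (h s)) (Real.sin (h s))
      (comps (G s) (mfderiv (𝓡 n) (IU n) G s v))).1 (flow (h s) (G s)).1.2 =
      ip (comps (G s) (mfderiv (𝓡 n) (IU n) G s v)).1 (G s).1.2 :=
    liouville_rotPair (Real.cos_sq_add_sin_sq _) (comps_mem _ _)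
  have h3 : ip (reeb (flow (h s) (G s)).1).1 (flow (h s) (G s)).1.2 = -1 :=
    (flow (h s) (G s)).2.2.2.1
  rw [h2, h3]
  ring

variable [IsManifold (𝓡 n) ∞ S]

/-- A map to the unit timelike bundle with Lagrangian projection can be made horizontal by
applying the geodesic flow. -/
lemma exists_horizontal_flow_comp [SimplyConnectedSpace S] {G : S → UT n}
    (hG : ContMDiff (𝓡 n) (IU n) ∞ G)
    (h : DForm.pullback (𝓡 n) (fun s => proj (G s)) (symplTG n) = 0) :
    ∃ f : S → ℝ, ContMDiff (𝓡 n) (IU n) ∞ (fun s => flow (f s) (G s)) ∧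
      ∀ (s : S) (v : TangentSpace (𝓡 n) s), ip (comps (flow (f s) (G s))
        (mfderiv (𝓡 n) (IU n) (fun s => flow (f s) (G s)) s v)).1 (flow (f s) (G s)).1.2 = 0 := by
  have hmd : ∀ s, MDifferentiableAt (𝓡 n) (IU n) G s := fun s => hG.mdifferentiableAt (by simp)
  obtain ⟨f, hf, hf'⟩ := exists_primitive (H := incl ∘ G) (contMDiff_incl.comp hG) (by
    intro s v w
    rw [← comps_mfderiv (hmd s), ← comps_mfderiv (hmd s)]
    exact sympl_comps_eq_zero_of_lagrangian hG h s v w)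
  have hψ : ContMDiff (𝓡 n) (IU n) ∞ fun s => flow (f s) (G s) :=
    ContMDiff.comp (g := fun a : ℝ × UT n => flow a.1 a.2) (f := fun s => (f s, G s))
      contMDiff_flow (hf.prodMk hG)
  refine ⟨f, hψ, fun s v => ?_⟩
  rw [ip_comps_mfderiv_flow_comp (hmd s) (hf' s) (hψ.mdifferentiableAt (by simp)),
    mfdPrimitive_apply, comps_mfderiv (hmd s)]
  exact sub_self _

/-- A Lagrangian immersion of a simply connected manifold has a horizontal lift. -/
lemma exists_lift [SimplyConnectedSpace S] {φ : S → TG n}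
    (hφ : ContMDiff (𝓡 n) (IT n) ∞ φ) (h : DForm.pullback (𝓡 n) φ (symplTG n) = 0) :
    ∃ ψ : S → UT n, ContMDiff (𝓡 n) (IU n) ∞ ψ ∧ (φ = fun s => proj (ψ s)) ∧
      ∀ (s : S) (v : TangentSpace (𝓡 n) s),
        ip (comps (ψ s) (mfderiv (𝓡 n) (IU n) ψ s v)).1 (ψ s).1.2 = 0 := by
  have hφ' : φ = fun s => proj (gsec (φ s)) := funext fun s => (proj_gsec _).symm
  obtain ⟨f, hf, hf'⟩ := exists_horizontal_flow_comp (contMDiff_gsec.comp hφ) (by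
    change DForm.pullback (𝓡 n) (fun s => proj (gsec (φ s))) (symplTG n) = 0
    rwa [← hφ'])
  exact ⟨_, hf, hφ'.trans (funext fun s => (proj_flow _ _).symm), hf'⟩

end Lift

/-! ### Base point maps after a small time of the flow -/

section SmallTime

/-- Two linear maps spanning an isotropic subspace: all small rotations of the first one are
injective, with the possible exception of the first one itself. -/
lemma eventually_injective_rotation {V K : Type*} [NormedAddCommGroup V] [NormedSpace ℝ V]
    [FiniteDimensional ℝ V] [NormedAddCommGroup K] [NormedSpace ℝ K] (A B : V →L[ℝ] R2 n) (hAB : ∀ v w, ip (A v) (B w) = ip (B v) (A w))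
    (j : K →L[ℝ] V) (hj : ∀ v, A v = 0 ↔ ∃ k, j k = v)
    (hB : ∀ v, A v = 0 → ip (B v) (B v) = 0 → v = 0) :
    ∀ᶠ t in 𝓝[≠] (0 : ℝ), Function.Injective (Real.cos t • A + Real.sin t • B) := by
  -- This records the pairing of B v with B on the kernel of A, which j parametrizes. Adjoining it
  -- to A gives an injective map by `hB`; injectivity is an open condition, so it persists for the
  -- rotated map.
  let Λ : V →L[ℝ] (K →L[ℝ] ℝ) := ((ContinuousLinearMap.compL ℝ K (R2 n) ℝ).flip
    (B.comp j)).comp ((ipB n).comp B)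
  have hΛ : ∀ v k, Λ v k = ip (B (j k)) (B v) := fun v k => rfl
  let T : ℝ → V →L[ℝ] R2 n × (K →L[ℝ] ℝ) := fun t =>
    (ContinuousLinearMap.inl ℝ (R2 n) (K →L[ℝ] ℝ)).comp (Real.cos t • A + Real.sin t • B) +
      (ContinuousLinearMap.inr ℝ (R2 n) (K →L[ℝ] ℝ)).comp Λ
  have hT : ∀ t v, T t v = (Real.cos t • A v + Real.sin t • B v, Λ v) := fun t v => by
    simp [T]
  have hTc : Continuous T := by
    refine continuous_clm_apply.2 fun v => ?_
    simp only [hT]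
    exact ((Real.continuous_cos.smul continuous_const).add
      (Real.continuous_sin.smul continuous_const)).prodMk continuous_const
  have hT0 : Function.Injective (T 0) := by
    refine (injective_iff_map_eq_zero _).2 fun v hv => ?_
    rw [hT, Prod.mk_eq_zero] at hv
    have h1 : A v = 0 := by simpa using hv.1
    refine hB v h1 ?_
    obtain ⟨k, rfl⟩ := (hj v).1 h1
    have h2 : Λ (j k) k = 0 := by rw [hv.2]; rfl
    rwa [hΛ] at h2
  have h1 : ∀ᶠ t in 𝓝 (0 : ℝ), Function.Injective (T t) :=
    hTc.continuousAt (ContinuousLinearMap.isOpen_injective.mem_nhds hT0)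
  have h2 : Ioo (-Real.pi) Real.pi ∈ 𝓝 (0 : ℝ) :=
    Ioo_mem_nhds (neg_neg_of_pos Real.pi_pos) Real.pi_pos
  filter_upwards [nhdsWithin_le_nhds h1, nhdsWithin_le_nhds h2, self_mem_nhdsWithin] with t e1 e2 e3
  have hs : Real.sin t ≠ 0 := fun h =>
    e3 ((Real.sin_eq_zero_iff_of_lt_of_lt e2.1 e2.2).1 h)
  refine (injective_iff_map_eq_zero _).2 fun v hv => ?_
  have hv' : Real.cos t • A v + Real.sin t • B v = 0 := hv
  refine (injective_iff_map_eq_zero _).1 e1 v ?_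
  rw [hT, hv']
  refine Prod.ext rfl (ContinuousLinearMap.ext fun k => ?_)
  change ip (B (j k)) (B v) = 0
  -- Pairing the relation with B (j k) kills the A-term, as isotropy gives ⟨B j k | A v⟩ = ⟨A j k |
  -- B v⟩ = 0. Since sin t ≠ 0, the additional component Λ v vanishes too.
  have h3 := congrArg (fun z => ip (B (j k)) z) hv'
  have h4 : A (j k) = 0 := (hj _).2 ⟨k, rfl⟩
  simp only [ip_add_right, ip_smul_right, ip_zero_right, ← hAB, h4, ip_zero_left, mul_zero,
    zero_add] at h3
  exact (mul_eq_zero.1 h3).resolve_left hs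

variable {S : Type*} [TopologicalSpace S] [ChartedSpace (EuclideanSpace ℝ (Fin n)) S]
  [IsManifold (𝓡 n) ∞ S]

lemma mfderiv_extChartAt_injective (s₀ : S) {s : S} (hs : s ∈ (extChartAt (𝓡 n) s₀).source) :
    Function.Injective
      (mfderiv (𝓡 n) 𝓘(ℝ, EuclideanSpace ℝ (Fin n)) (extChartAt (𝓡 n) s₀) s) :=
  (isInvertible_mfderiv_extChartAt hs).injective

/-- Injectivity of the differential is an open condition. -/
lemma eventually_injective_mfderiv {W : Type*} [NormedAddCommGroup W] [NormedSpace ℝ W] {x : S → W}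
    (hx : ContMDiff (𝓡 n) 𝓘(ℝ, W) ∞ x) {s₀ : S}
    (h : Function.Injective (mfderiv (𝓡 n) 𝓘(ℝ, W) x s₀)) :
    ∀ᶠ s in 𝓝 s₀, Function.Injective (mfderiv (𝓡 n) 𝓘(ℝ, W) x s) := by
  have hd : ∀ s, MDifferentiableAt (𝓡 n) 𝓘(ℝ, W) x s := fun s => hx.mdifferentiableAt (by simp)
  have ht := mem_extChartAt_target (I := 𝓡 n) s₀
  have hc : ContinuousAt (fderiv ℝ (x ∘ (extChartAt (𝓡 n) s₀).symm)) (extChartAt (𝓡 n) s₀ s₀) :=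
    ((contDiffAt_comp_extChartAt_symm s₀ ht (hx _)).fderiv_right (m := ∞) (by simp)).continuousAt
  have h0 : Function.Injective
      (fderiv ℝ (x ∘ (extChartAt (𝓡 n) s₀).symm) (extChartAt (𝓡 n) s₀ s₀)) := by
    have h1 : ∀ s, s = s₀ → Function.Injective (mfderiv (𝓡 n) 𝓘(ℝ, W) x s) := by
      rintro s rfl; exact h
    intro v w hvw
    rw [fderiv_comp_extChartAt_symm s₀ ht (hd _), fderiv_comp_extChartAt_symm s₀ ht (hd _)] at hvw
    exact mfderiv_extChartAt_symm_injective s₀ ht (h1 _ (extChartAt_to_inv s₀) hvw)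
  have h1 := hc (ContinuousLinearMap.isOpen_injective.mem_nhds h0)
  filter_upwards [(continuousAt_extChartAt (I := 𝓡 n) s₀) h1,
    extChartAt_source_mem_nhds (I := 𝓡 n) s₀] with s e1 e2
  intro v w hvw
  rw [mfderiv_eq_fderiv_extChartAt_symm s₀ e2 (hd s),
    mfderiv_eq_fderiv_extChartAt_symm s₀ e2 (hd s)] at hvw
  exact mfderiv_extChartAt_injective s₀ e2 (e1 hvw)

/-- Where the base point component of a horizontal map is an immersion, it is spacelike and the
map is its Gauss map. -/
lemma eventually_isSpacelikeImmersionAt {G : S → UT n} (hG : ContMDiff (𝓡 n) (IU n) ∞ G)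
    (hh : ∀ (s : S) (v : TangentSpace (𝓡 n) s),
      ip (comps (G s) (mfderiv (𝓡 n) (IU n) G s v)).1 (G s).1.2 = 0) {s₀ : S}
    (h : Function.Injective (mfderiv (𝓡 n) 𝓘(ℝ, R2 n) (fun s => (G s).1.1) s₀)) :
    ∀ᶠ s in 𝓝 s₀, IsSpacelikeImmersionAt (fun s => (G s).1.1) s ∧
      IsGaussImageAt (fun s => (G s).1.1) s (proj (G s)) := by
  have hx : ContMDiff (𝓡 n) 𝓘(ℝ, R2 n) ∞ fun s => (G s).1.1 :=
    (ContinuousLinearMap.fst ℝ (R2 n) (R2 n)).contDiff.contMDiff.comp (contMDiff_incl.comp hG)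
  have hfst : ∀ (s : S) (v : TangentSpace (𝓡 n) s),
      (comps (G s) (mfderiv (𝓡 n) (IU n) G s v)).1 =
        mfderiv (𝓡 n) 𝓘(ℝ, R2 n) (fun s => (G s).1.1) s v := fun s v =>
    comps_mfderiv_fst (hG.mdifferentiableAt (by simp)) v
  filter_upwards [eventually_injective_mfderiv hx h] with s hs
  refine ⟨⟨(G s).2.1, hx s, fun v hv => ?_⟩, G s, rfl, rfl, fun v => ?_⟩
  · have h1 := (comps_mem (G s) (mfderiv (𝓡 n) (IU n) G s v)).1
    have h2 := hh s v
    rw [hfst] at h1 h2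
    refine ip_self_pos (by rw [show ip (G s).1.1 (G s).1.1 = -1 from (G s).2.1]; norm_num)
      (by rw [show ip (G s).1.2 (G s).1.2 = -1 from (G s).2.2.2.1]; norm_num) (G s).2.2.1 h1 h2 ?_
    exact fun h0 => hv (hs (h0.trans (map_zero _).symm))
  · rw [← hfst]
    exact hh s v

/-- Positivity of the metric on horizontal vectors makes the lift spacelike. It also makes the
second component of its differential definite on the kernel of the first, as the rotation lemma
requires. -/
theorem exists_horizontal_lift [SimplyConnectedSpace S] (φ : S → TG n)
    (hφ : IsLagrangianImmersion (symplTG n) φ) :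
    ∃ ψ : S → UT n,
      ContMDiff (𝓡 n) (IU n) ∞ ψ ∧
      (∀ s, proj (ψ s) = φ s) ∧
      (∀ s, Function.Injective (mfderiv (𝓡 n) (IU n) ψ s)) ∧
      (∀ (s : S) (v : TangentSpace (𝓡 n) s),
        metricU (ψ s) (mfderiv (𝓡 n) (IU n) ψ s v) (flowField (ψ s)) = 0) ∧
      (∀ (s : S) (v : TangentSpace (𝓡 n) s), v ≠ 0 →
        0 < metricU (ψ s) (mfderiv (𝓡 n) (IU n) ψ s v) (mfderiv (𝓡 n) (IU n) ψ s v)) ∧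
      ∀ s₀ : S,
        (∀ᶠ t in 𝓝[≠] (0 : ℝ), ∀ᶠ s in 𝓝 s₀,
          IsSpacelikeImmersionAt (fun s' => (flow t (ψ s')).1.1) s ∧
          IsGaussImageAt (fun s' => (flow t (ψ s')).1.1) s (φ s)) ∧
        (Function.Injective (mfderiv (𝓡 n) 𝓘(ℝ, R2 n) (fun s' => (ψ s').1.1) s₀) →
          ∀ᶠ s in 𝓝 s₀,
            IsSpacelikeImmersionAt (fun s' => (ψ s').1.1) s ∧
            IsGaussImageAt (fun s' => (ψ s').1.1) s (φ s)) := by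
  obtain ⟨ψ, hψ, rfl, hh⟩ := exists_lift hφ.smooth hφ.lagrangian
  have hmd : ∀ s, MDifferentiableAt (𝓡 n) (IU n) ψ s := fun s => hψ.mdifferentiableAt (by simp)
  have hinj : ∀ s, Function.Injective (mfderiv (𝓡 n) (IU n) ψ s) := by
    intro s
    refine (injective_iff_map_eq_zero _).2 fun v hv => ?_
    refine (injective_iff_map_eq_zero _).1 (hφ.immersion s) v ?_
    have h1 := dproj_mfderiv (hmd s) v
    rw [hv, map_zero] at h1
    exact h1.symm
  have hpos : ∀ (s : S) (v : TangentSpace (𝓡 n) s), v ≠ 0 →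
      0 < metricU (ψ s) (mfderiv (𝓡 n) (IU n) ψ s v) (mfderiv (𝓡 n) (IU n) ψ s v) := by
    intro s v hv
    rw [metricU_eq]
    refine ambMetric_pos (ψ s).2 (comps_mem _ _) (hh s v) fun h0 => hv ?_
    exact hinj s ((comps_injective _ (h0.trans (map_zero _).symm)).trans (map_zero _).symm)
  refine ⟨ψ, hψ, fun s => rfl, hinj, fun s v => ?_, hpos, fun s₀ => ⟨?_, fun h =>
    eventually_isSpacelikeImmersionAt hψ hh h⟩⟩
  · rw [metricU_flowField, hh, mul_zero]
  · let C : EuclideanSpace ℝ (Fin n) →L[ℝ] R2 n × R2 n :=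
      (comps (ψ s₀)).comp (mfderiv (𝓡 n) (IU n) ψ s₀)
    have hC : ∀ v, C v = comps (ψ s₀) (mfderiv (𝓡 n) (IU n) ψ s₀ v) := fun v => rfl
    have hev := eventually_injective_rotation
      ((ContinuousLinearMap.fst ℝ (R2 n) (R2 n)).comp C)
      ((ContinuousLinearMap.snd ℝ (R2 n) (R2 n)).comp C)
      (fun v w => sub_eq_zero.1 (sympl_comps_eq_zero hψ hh s₀ v w))
      (LinearMap.ker ((ContinuousLinearMap.fst ℝ (R2 n) (R2 n)).comp C).toLinearMap).subtypeL
      (fun v => ⟨fun h => ⟨⟨v, h⟩, rfl⟩, by rintro ⟨k, rfl⟩; exact k.2⟩) (fun v h1 h2 => by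
        by_contra hv
        have h3 := hpos s₀ v hv
        have h4 : ip (C v).1 (C v).1 + ip (C v).2 (C v).2 = 0 := by
          rw [show (C v).1 = 0 from h1, show ip (C v).2 (C v).2 = 0 from h2, ip_zero_left,
            add_zero]
        exact h3.ne' h4)
    filter_upwards [hev] with t ht
    -- For fixed t the flowed lift is again horizontal with the same projection, so injectivity at
    -- s₀ is all that remains to be checked.
    have hft : ContMDiff (𝓡 n) (IU n) ∞ fun s => flow t (ψ s) := (contMDiff_flow_right t).comp hψ
    have hcomps : ∀ (s : S) (v : TangentSpace (𝓡 n) s),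
        comps (flow t (ψ s)) (mfderiv (𝓡 n) (IU n) (fun s => flow t (ψ s)) s v) =
          rotPair (Real.cos t) (Real.sin t) (comps (ψ s) (mfderiv (𝓡 n) (IU n) ψ s v)) := by
      intro s v
      rw [← comps_mfderiv_flow]
      refine congrArg (comps (flow t (ψ s))) ?_
      have h1 := mfderiv_comp s ((contMDiff_flow_right t).mdifferentiableAt (by simp)) (hmd s)
      exact congrArg (fun L => L v) h1
    have hht : ∀ (s : S) (v : TangentSpace (𝓡 n) s),
        ip (comps (flow t (ψ s)) (mfderiv (𝓡 n) (IU n) (fun s => flow t (ψ s)) s v)).1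
          (flow t (ψ s)).1.2 = 0 := by
      intro s v
      rw [hcomps]
      exact (liouville_rotPair (Real.cos_sq_add_sin_sq t) (comps_mem _ _)).trans (hh s v)
    have hinj₀ : Function.Injective
        (mfderiv (𝓡 n) 𝓘(ℝ, R2 n) (fun s => (flow t (ψ s)).1.1) s₀) := by
      refine (injective_iff_map_eq_zero _).2 fun v hv => ?_
      refine (injective_iff_map_eq_zero _).1 ht v ?_
      have h1 := comps_mfderiv_fst (G := fun s => flow t (ψ s))
        (hft.mdifferentiableAt (by simp)) v
      rw [hcomps] at h1
      exact h1.trans hv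
    filter_upwards [eventually_isSpacelikeImmersionAt hft hht hinj₀] with s hs
    exact ⟨hs.1, by simpa only [proj_flow] using hs.2⟩

end SmallTime

end AdSGauss

end

theorem mainTheorem1 (n : ℕ) :
    -- the orbit space of the flow is the space of timelike geodesics
    (Function.Injective (geodesicOf (n := n)) ∧
      Set.range (geodesicOf (n := n)) =
        {γ : Set (R2 n) | IsTimelikeGeodesic γ}) ∧
    -- the unit timelike bundle is an embedded submanifold, with the expected tangent spaces
    (ContMDiff (IU n) 𝓘(ℝ, R2 n × R2 n) ∞ (incl (n := n)) ∧
      IsEmbedding (incl (n := n)) ∧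
      ∀ p : UT n, Function.Injective (comps p) ∧
        Set.range (comps p) = {a : R2 n × R2 n |
          ip a.1 p.1.1 = 0 ∧ ip a.2 p.1.2 = 0 ∧
            ip a.1 p.1.2 + ip a.2 p.1.1 = 0}) ∧
    -- the geodesic flow is a smooth flow; the orbits consist of velocities of timelike geodesics
    (ContMDiff (𝓘(ℝ, ℝ).prod (IU n)) (IU n) ∞
        (fun a : ℝ × UT n => flow a.1 a.2) ∧
      ∀ (p : UT n) (t : ℝ),
        HasDerivAt (fun s : ℝ => (flow s p).1.1) (flow t p).1.2 t) ∧
    -- the Liouville form is a contact form and the geodesic flow is its Reeb flow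
    (IsContactForm (liouville n) ∧
      IsReebField (liouville n) flowField ∧
      (∀ p : UT n, comps p (flowField p) = (p.1.2, -p.1.1)) ∧
      (∀ p : UT n, IsMIntegralCurve (I := IU n)
        (fun t : ℝ => flow t p) flowField) ∧
      (∀ t : ℝ, DForm.pullback (IU n) (flow t) (liouville n) =
        liouville n) ∧
      ∀ (p : UT n) (v : TangentSpace (IU n) p),
        liouville n p ![v] = 0 ↔ metricU p v (flowField p) = 0) ∧
    -- the projection onto the orbit space is a smooth submersion whose fibers are the orbits
    (ContMDiff (IU n) (IT n) ∞ (proj (n := n)) ∧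
      ∀ p : UT n, Function.Surjective (dproj p) ∧
        ∀ v, dproj p v = 0 ↔ ∃ c : ℝ, v = c • flowField p) ∧
    -- the exterior derivative of the Liouville form descends to a symplectic form
    ∃ Ω : DForm (IT n) (TG n) 2,
      IsSymplectic Ω ∧
      DForm.pullback (IU n) proj Ω = (liouville n).d ∧
      (∀ Ω' : DForm (IT n) (TG n) 2,
        DForm.pullback (IU n) proj Ω' = (liouville n).d → Ω' = Ω) ∧
      -- the compatible complex structure and Riemannian metric
      (∃ (J : ∀ τ : TG n,
            TangentSpace (IT n) τ →L[ℝ] TangentSpace (IT n) τ)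
          (g : Bundle.ContMDiffRiemannianMetric (IT n) ∞ (EC n)
            (fun τ : TG n => TangentSpace (IT n) τ)),
        IsComplexStructure J ∧
        (∀ (p : UT n) (v : TangentSpace (IU n) p),
          liouville n p ![v] = 0 →
            ∃ w : TangentSpace (IU n) p, liouville n p ![w] = 0 ∧
              comps p w = ((comps p v).2, -(comps p v).1) ∧
              J (proj p) (dproj p v) = dproj p w) ∧
        (∀ (p : UT n) (v w : TangentSpace (IU n) p),
          liouville n p ![v] = 0 → liouville n p ![w] = 0 →
            g.inner (proj p) (dproj p v) (dproj p w) =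
              metricU p v w) ∧
        ∀ (τ : TG n) (ξ ξ' : TangentSpace (IT n) τ),
          Ω τ ![ξ, ξ'] = g.inner τ ξ (J τ ξ') ∧
          g.inner τ (J τ ξ) (J τ ξ') = g.inner τ ξ ξ') ∧
      -- the Gauss map of a spacelike hypersurface is a Lagrangian immersion
      (∀ (S : Type u) [TopologicalSpace S] [ChartedSpace (EuclideanSpace ℝ (Fin n)) S]
          [IsManifold (𝓡 n) ∞ S] (x : S → R2 n),
        (∀ s, IsSpacelikeImmersionAt x s) →
          ∃ ν : S → TG n,
            (∀ s τ, IsGaussImageAt x s τ ↔ τ = ν s) ∧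
            IsLagrangianImmersion Ω ν ∧
            -- for an embedded hypersurface met at most once, respectively exactly once, by each
            -- timelike geodesic, it is an embedding, respectively a closed embedding
            (IsEmbedding x →
              (∀ τ, (geodesicOf τ ∩ Set.range x).Subsingleton) →
                IsEmbedding ν ∧
                ((∀ τ, (geodesicOf τ ∩ Set.range x).Nonempty) →
                  IsClosed (Set.range ν)))) ∧
      -- the converse
      (∀ (S : Type u) [TopologicalSpace S] [ChartedSpace (EuclideanSpace ℝ (Fin n)) S]
          [IsManifold (𝓡 n) ∞ S] [SimplyConnectedSpace S] (φ : S → TG n),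
        IsLagrangianImmersion Ω φ →
          ∃ ψ : S → UT n,
            ContMDiff (𝓡 n) (IU n) ∞ ψ ∧
            (∀ s, proj (ψ s) = φ s) ∧
            (∀ s, Function.Injective (mfderiv (𝓡 n) (IU n) ψ s)) ∧
            (∀ (s : S) (v : TangentSpace (𝓡 n) s),
              metricU (ψ s) (mfderiv (𝓡 n) (IU n) ψ s v)
                (flowField (ψ s)) = 0) ∧
            (∀ (s : S) (v : TangentSpace (𝓡 n) s), v ≠ 0 →
              0 < metricU (ψ s) (mfderiv (𝓡 n) (IU n) ψ s v)
                (mfderiv (𝓡 n) (IU n) ψ s v)) ∧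
            -- near each point, the base point map, after the flow has been applied for any small
            -- nonzero time, is a spacelike immersion with Gauss map `φ`; time zero is also
            -- possible if the base point map is an immersion there
            ∀ s₀ : S,
              (∀ᶠ t in 𝓝[≠] (0 : ℝ), ∀ᶠ s in 𝓝 s₀,
                IsSpacelikeImmersionAt (fun s' => (flow t (ψ s')).1.1) s ∧
                IsGaussImageAt (fun s' => (flow t (ψ s')).1.1) s (φ s)) ∧
              (Function.Injective
                  (mfderiv (𝓡 n) 𝓘(ℝ, R2 n) (fun s' => (ψ s').1.1) s₀) →
                ∀ᶠ s in 𝓝 s₀,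
                  IsSpacelikeImmersionAt (fun s' => (ψ s').1.1) s ∧
                  IsGaussImageAt (fun s' => (ψ s').1.1) s (φ s))) := by
  refine ⟨⟨geodesicOf_injective, range_geodesicOf⟩,
    ⟨contMDiff_incl, isEmbedding_incl, fun p => ⟨comps_injective p, range_comps p⟩⟩,
    ⟨contMDiff_flow, fun p t => (hasDerivAt_rotPair p.1 t).fst⟩,
    ⟨isContactForm_liouville, isReebField_flowField, comps_flowField, isMIntegralCurve_flow,
      pullback_flow_liouville, liouville_eq_zero_iff_metricU⟩,
    ⟨contMDiff_proj, fun p => ⟨dproj_surjective p, dproj_eq_zero_iff p⟩⟩,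
    symplTG n, isSymplectic_symplTG, pullback_proj_symplTG,
    fun Ω' h => pullback_proj_injective (h.trans pullback_proj_symplTG.symm),
    ⟨complexTG, metricTG n, isComplexStructure_complexTG, ?_, ?_,
      fun τ ξ ξ' => ⟨symplTG_eq_metric τ ξ ξ', metricTG_complexTG τ ξ ξ'⟩⟩,
    fun S _ _ _ x hx => exists_gaussMap x hx, fun S _ _ _ _ φ hφ => exists_horizontal_lift φ hφ⟩
  · intro p v hv
    obtain ⟨w, hw⟩ := exists_comps_ambJ p v hv
    exact ⟨w, hw.1, hw.2, complexTG_dproj p v w hw.2⟩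
  · intro p v w _ hw
    exact metricTG_dproj p v w hw
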